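/- Let $A=(\alpha_1,\alpha_2)\in\,]0,1[^2$ with $\alpha_1+\alpha_2\ge 1$, let $q\in\mathbb R\setminus\{0\}$ and $k\in\{0,1\}$. Let $\mathcal S_A$ be the space of entire functions $f$ on $\mathbb C^2$ for which there are $a_1,a_2,b_1,b_2,C>0$ with $$|f(x+iy)|\le C\exp\bigl(-a_1|x_1|^{1/\alpha_1}-a_2|x_2|^{1/\alpha_2}+b_1|y_1|^{1/(1-\alpha_2)}+b_2|y_2|^{1/(1-\alpha_1)}\bigr)\qquad(x,y\in\mathbb R^2).$$ With $\omega(x,y)=x_1y_2-x_2y_1$, put $\mathcal{SF}(u)(y)=\int_{\mathbb R^2}e^{i\omega(x,y)}u(x)\,dx$, $(u\times_q v)(x)=\int_{\mathbb R^2}e^{iq\omega(x,y)}u(y)v(x-y)\,dy$, and let $u\star^W_q v=\mathcal{SF}[\mathcal{SF}(u)\times_q\mathcal{SF}(v)]$ be the Weyl product. For $f\in\mathcal S_A$ let $\hat f(y_1,x_2)=f(iy_1,x_2)$, and let $\hat{\mathcal S}_A=\{\hat f: f\in\mathcal S_A\}$, a space of functions on $\mathbb R^2$. Let $\mathcal L(u)(z)=\int_{\mathbb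 R}e^{-zx}u(x)\,dx$, and let $\phi=\phi^{(k)}_q$ be the twisting map $\phi(z)=\frac{e^{ik\pi/2}}{q}\sinh(iqz)$; $\phi^{-1}$ denotes the inverse of the restriction of $\phi$ to the strip $S_q=\{|\mathrm{Re}\,z|<\frac{\pi}{2|q|}\}$. Let $\Gamma$ be one of the two intervals $]0,\infty[$, $]-\infty,0[$ if $k=0$, and $\Gamma=\,]-\frac1{|q|},\frac1{|q|}[$ if $k=1$. For $c\in\Gamma$ and a function $\psi$ on $\mathbb R^2$ in $\hat{\mathcal S}_A$ put $$\tau^{(k)}_q(\psi)(y_1,x_2)=\frac1{2\pi}\int_{\mathbb R}e^{(c+it)x_2}\,\mathcal L\bigl(\psi(y_1,\cdot)\bigr)\bigl(\phi^{-1}(c+it)\bigr)\,dt ,$$ that is, $\tau^{(k)}_q=\mathrm{id}\otimes(\mathcal L^{-1}\circ(\phi^{-1})^*\circ\mathcal L)$. Set $\widehat{E^{(k)}}=\tau^{(k)}_q(\hat{\mathcal S}_A)$. Then the following hold. 1. The maps $f\mapsto\hat f$ and $f\mapsto f|_{\mathbb R^2}$ are injective on $\mathcal S_A$. For $f,g\in\mathcal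 S_A$ the functions $f|_{\mathbb R^2}$, $\mathcal{SF}(f|_{\mathbb R^2})$ and $\mathcal{SF}(f|_{\mathbb R^2})\times_q\mathcal{SF}(g|_{\mathbb R^2})$ are integrable, and $f|_{\mathbb R^2}\star^W_q g|_{\mathbb R^2}$ is the restriction to $\mathbb R^2$ of an element of $\mathcal S_A$. So the Weyl product is transported by $f\mapsto\hat f$ to a product $\widehat{\star^W_q}$ on $\hat{\mathcal S}_A$. 2. The integrals that define $\tau^{(k)}_q(\psi)$ for $\psi\in\hat{\mathcal S}_A$ converge absolutely and the result does not depend on $c\in\Gamma$. The map $\tau^{(k)}_q$ is injective on $\hat{\mathcal S}_A$, and $\widehat{E^{(k)}}\subset C^\infty(\mathbb R^2)$. Its inverse $T^{(k)}_q:\widehat{E^{(k)}}\to\hat{\mathcal S}_A$ is $\mathrm{id}\otimes(\mathcal L^{-1}\circ\phi^*\circ\mathcal L)$, in the sense that $\mathcal L(T^{(k)}_q a(y_1,\cdot))(z)=\mathcal L(a(y_1,\cdot))(\phi(z))$, with an absolutely convergent integral on the right, for all $a\in\widehat{E^{(k)}}$, $y_1\in\mathbb R$ and $z\in S_q$ with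 $\mathrm{Re}\,\phi(z)\in\Gamma$. 3. $\widehat{E^{(k)}}$ is a real vector space, and the formula $$a\,\widehat{\star^{(k)}_q}\,b:=\tau^{(k)}_q\bigl(T^{(k)}_q a\;\widehat{\star^W_q}\;T^{(k)}_q b\bigr)\qquad(a,b\in\widehat{E^{(k)}})$$ defines on it an associative (not necessarily unital) $\mathbb R$-algebra structure. 4. $\widehat{E^{(k)}}$ contains elements of exponential growth, which are not tempered: there are $a\in\widehat{E^{(k)}}$, $x_2\in\mathbb R$ and $C,r>0$ with $|a(y_1,x_2)|\ge Ce^{r|y_1|}$ for all $y_1\in\mathbb R$, such that the distribution defined by $a$ on $\mathbb R^2$ is not tempered. -/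

import Mathlib

open MeasureTheory

noncomputable section

namespace TwistedWeyl

/-- The fundamental space `S_α^β(2)` of type S: entire functions `φ` on `ℂ²` with
`|φ(x + iy)| ≤ C exp(∑ⱼ (-aⱼ |xⱼ|^(1/αⱼ) + bⱼ |yⱼ|^(1/(1-βⱼ))))` for some positive `aⱼ, bⱼ, C`. -/
def typeS (α β : ℝ × ℝ) : Set (ℂ × ℂ → ℂ) :=
  {φ | Differentiable ℂ φ ∧ ∃ a₁ > 0, ∃ a₂ > 0, ∃ b₁ > 0, ∃ b₂ > 0, ∃ C > (0 : ℝ),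
    ∀ z : ℂ × ℂ, ‖φ z‖ ≤ C * Real.exp
      (-(a₁ * |z.1.re| ^ (1 / α.1)) - a₂ * |z.2.re| ^ (1 / α.2)
        + b₁ * |z.1.im| ^ (1 / (1 - β.1)) + b₂ * |z.2.im| ^ (1 / (1 - β.2)))}

/-- The space `S_A = S_A^{σ(A)}(2)`, where `σ` exchanges the two entries of `A`. -/
def spaceS (A : ℝ × ℝ) : Set (ℂ × ℂ → ℂ) := typeS A A.swap

/-- Restriction of a function on `ℂ²` to the real plane. -/
def realRestrict (f : ℂ × ℂ → ℂ) : ℝ × ℝ → ℂ := fun x => f (x.1, x.2)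

/-- The holomorphic presentation `f̂(y₁, x₂) = f(i y₁, x₂)`. -/
def hat (f : ℂ × ℂ → ℂ) : ℝ × ℝ → ℂ := fun p => f (Complex.I * p.1, p.2)

/-- The space of all `f̂`, for `f` in `S_A`. -/
def hatS (A : ℝ × ℝ) : Set (ℝ × ℝ → ℂ) := hat '' spaceS A

/-- The standard symplectic form on `ℝ²`. -/
def omega (x y : ℝ × ℝ) : ℝ := x.1 * y.2 - x.2 * y.1

/-- The symplectic Fourier transform. -/
def symplFourier (u : ℝ × ℝ → ℂ) : ℝ × ℝ → ℂ :=
  fun y => ∫ x : ℝ × ℝ, Complex.exp (Complex.I * omega x y) * u x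

/-- The twisted convolution `u ×_q v`. -/
def twistedConv (q : ℝ) (u v : ℝ × ℝ → ℂ) : ℝ × ℝ → ℂ :=
  fun x => ∫ y : ℝ × ℝ, Complex.exp (Complex.I * (q * omega x y)) * u y * v (x - y)

/-- The Weyl product of functions on `ℝ²`. -/
def weyl (q : ℝ) (u v : ℝ × ℝ → ℂ) : ℝ × ℝ → ℂ :=
  symplFourier (twistedConv q (symplFourier u) (symplFourier v))

/-- The Weyl product of `S_A`, transported along `f ↦ f̂`: the function `ĥ`, where `ψ = f̂`, `χ = ĝ`
and `h` is the element of `S_A` whose restriction to `ℝ²` is the Weyl product of the restrictions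
of `f` and `g`. -/
def hatWeyl (A : ℝ × ℝ) (q : ℝ) (ψ χ : ℝ × ℝ → ℂ) : ℝ × ℝ → ℂ :=
  hat (Function.invFunOn realRestrict (spaceS A)
    (weyl q (realRestrict (Function.invFunOn hat (spaceS A) ψ))
      (realRestrict (Function.invFunOn hat (spaceS A) χ))))

/-- The (two-sided) Laplace transform. -/
def laplace (u : ℝ → ℂ) (z : ℂ) : ℂ := ∫ x : ℝ, Complex.exp (-z * x) * u x

/-- The inverse Laplace transform, as an integral over the vertical line of abscissa `c`. -/
def laplaceInv (c : ℝ) (F : ℂ → ℂ) (x : ℝ) : ℂ :=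
  (1 / (2 * Real.pi)) * ∫ t : ℝ, Complex.exp ((c + t * Complex.I) * x) * F (c + t * Complex.I)

/-- The twisting map `φ_{q,θ}`, for `q ≠ 0`, with `θ = k π / 2`. -/
def twistMap (q : ℝ) (k : Fin 2) (z : ℂ) : ℂ :=
  Complex.exp (Complex.I * ((k : ℕ) * Real.pi / 2)) / q * Complex.sinh (Complex.I * q * z)

/-- The strip `|Re z| < π / (2|q|)`, on which the twisting map is injective. -/
def strip (q : ℝ) : Set ℂ := {z | |z.re| < Real.pi / (2 * |q|)}

/-- The inverse of the restriction of the twisting map to the strip. -/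
def twistMapInv (q : ℝ) (k : Fin 2) : ℂ → ℂ := Function.invFunOn (twistMap q k) (strip q)

/-- The maximal open intervals `Γ` such that all vertical lines with abscissa in `Γ` lie in the
domain of the inverse of the twisting map. -/
def IsLaplaceInterval (q : ℝ) (k : Fin 2) (Γ : Set ℝ) : Prop :=
  (k = 0 ∧ (Γ = Set.Ioi 0 ∨ Γ = Set.Iio 0)) ∨ (k = 1 ∧ Γ = Set.Ioo (-(1 / |q|)) (1 / |q|))

/-- The map `τ = id ⊗ (L⁻¹ ∘ (φ⁻¹)^* ∘ L)`, the second factor acting on the second variable. -/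
def tau (q : ℝ) (k : Fin 2) (c : ℝ) (ψ : ℝ × ℝ → ℂ) : ℝ × ℝ → ℂ :=
  fun p => laplaceInv c (fun w => laplace (fun x => ψ (p.1, x)) (twistMapInv q k w)) p.2

/-- The image of the space of all `f̂` under `τ`. -/
def hatE (A : ℝ × ℝ) (q : ℝ) (k : Fin 2) (c : ℝ) : Set (ℝ × ℝ → ℂ) := tau q k c '' hatS A

/-- The inverse `T` of `τ` on its range. -/
def tauInv (A : ℝ × ℝ) (q : ℝ) (k : Fin 2) (c : ℝ) : (ℝ × ℝ → ℂ) → (ℝ × ℝ → ℂ) :=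
  Function.invFunOn (tau q k c) (hatS A)

/-- The product `τ(T a ⋆ T b)`, where `⋆` is the transported Weyl product. -/
def twistedProduct (A : ℝ × ℝ) (q : ℝ) (k : Fin 2) (c : ℝ) (a b : ℝ × ℝ → ℂ) : ℝ × ℝ → ℂ :=
  tau q k c (hatWeyl A q (tauInv A q k c a) (tauInv A q k c b))

/-- (At least) exponential growth, along a line parallel to the first axis. -/
def HasExponentialGrowth (a : ℝ × ℝ → ℂ) : Prop :=
  ∃ x₂ : ℝ, ∃ C > 0, ∃ r > 0, ∀ y₁ : ℝ, C * Real.exp (r * |y₁|) ≤ ‖a (y₁, x₂)‖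

/-- The distribution defined by the (locally integrable) function `a` is tempered. -/
def IsTempered (a : ℝ × ℝ → ℂ) : Prop :=
  ∃ D : SchwartzMap (ℝ × ℝ) ℂ →L[ℂ] ℂ, ∀ φ : SchwartzMap (ℝ × ℝ) ℂ,
    HasCompactSupport φ → D φ = ∫ p, a p * φ p

end TwistedWeyl

end

/-! Write `p_j = 1/α_j` for the decay exponents and `r₁ = 1/(1-α₂)`, `r₂ = 1/(1-α₁)` for the growth
exponents of `S_A`, so that `p₁` is conjugate to `r₂` and `p₂` to `r₁`. A Laplace transform turns
decay of exponent `p` into growth of the conjugate exponent in `Re z`, and growth of exponent `r`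
into decay of the conjugate exponent in `Im z` (`exists_laplace_bound`, by moving the contour). The
symplectic Fourier transform also exchanges the two coordinates, so it returns exactly the decay
exponents of `S_A`. That is the reason for the crossed exponents.

Weyl product: Fourier inversion gives `(u ⋆ v)(x) = (2π)² ∫ e^{iω(w,x)} SF(u)(w) v(x + qw) dw`
(`weyl_eq_integral`). The integrand extends holomorphically in `x`, and Young's inequality for the
conjugate pairs bounds the extension within `S_A` (`integral_weylIntegrand`). Associativity is that
of the twisted convolution, which is a cocycle identity for `ω`.

The map `τ`: up to a constant and a scaling, `φ` is a sine, and its inverse takes values in a strip,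
where `|Im φ⁻¹(w)|` is at least a constant multiple of `log |w|` minus a constant. On the strip the
Laplace transform of a section decays like `exp(-a |Im z|^{1/α₁})` with `1/α₁ > 1`, which beats
every power of `|w|` (`exists_tauKernel_bound`). From this come absolute convergence, independence
of the vertical line, smoothness, and the inversion formula on all of `Γ`. For injectivity, `τ(ψ)`
determines the Laplace transform of `ψ(y₁, ·)` on a nonempty open set, hence everywhere since it is
entire, hence `ψ` by Fourier inversion (`hat_eq_of_tau_eq`). The algebra structure is then
transported.

Exponential growth: `τ` does not touch `y₁`, so it suffices to find `f₁ ⊗ f₂` in `S_A` with `f₁(iy)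
≥ c e^{|y|}` and `f₂ ≠ 0`. Both factors are taken with equal decay and growth exponents; the
condition `α₁ + α₂ ≥ 1` makes these growth exponents admissible. Nonzero functions with equal
exponents `ρ ≥ 2` come from a canonical product that decays in a sector, composed with powers of two
of the variable; for `ρ < 2` they come by Laplace duality (`exists_typeBound_ne_zero`). If `h` has
the dual type, the rotated Laplace transform of the entire extension of `|h|²` is, at `iy`, equal to
`∫ e^{yx} |h(x)|² dx`, which has the required lower bound. Pairing the result with translates of a
test function contradicts the polynomial bound for tempered distributions. -/

/-! ### Tools: holomorphic parameter integrals, contour shift, Young's inequality, identity theorem.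
-/

open Filter Topology in
/-- Differentiability of an integral depending holomorphically on a parameter, with a locally
uniform integrable bound on the integrand only. -/
theorem hasFDerivAt_integral_of_locally_dominated {α E : Type*} [MeasurableSpace α] {μ : Measure α}
    [NormedAddCommGroup E] [NormedSpace ℂ E] [FiniteDimensional ℂ E] {F : E → α → ℂ}
    (hF : ∀ z, AEStronglyMeasurable (F z) μ) (hd : ∀ a, Differentiable ℂ fun z => F z a)
    (hb : ∀ R : ℝ, ∃ g : α → ℝ, Integrable g μ ∧ ∀ z a, ‖z‖ ≤ R → ‖F z a‖ ≤ g a) (z₀ : E) :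
    HasFDerivAt (fun z => ∫ a, F z a ∂μ) (∫ a, fderiv ℂ (fun z => F z a) z₀ ∂μ) z₀ := by
  obtain ⟨g, hg, hFg⟩ := hb (‖z₀‖ + 2)
  -- Cauchy estimate on the unit ball around `x`, which stays within norm `‖z₀‖ + 2`; increments
  -- there are at most `2 * g a`.
  have hbd : ∀ a, ∀ x ∈ Metric.ball z₀ 1, ‖fderiv ℂ (fun z => F z a) x‖ ≤ 2 * g a := by
    intro a x hx
    have hx' : ‖x‖ ≤ ‖z₀‖ + 1 := by
      have h1 := norm_sub_norm_le x z₀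
      rw [Metric.mem_ball, dist_eq_norm] at hx
      linarith
    have := Complex.norm_fderiv_le_div_of_mapsTo_ball (R₁ := 1) (R₂ := 2 * g a) (c := x)
      (f := fun z => F z a) (hd a).differentiableOn (fun y hy => by
        rw [Metric.mem_ball, dist_eq_norm] at hy
        rw [Metric.mem_closedBall, dist_eq_norm]
        have h1 := norm_sub_norm_le y x
        have h2 := hFg y a (by linarith)
        have h3 := hFg x a (by linarith)
        have h4 := norm_sub_le (F y a) (F x a)
        linarith) one_pos
    simpa using this
  -- Directional derivatives are measurable as limits of difference quotients with step `1/n`.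
  have hmv : ∀ v : E, AEStronglyMeasurable (fun a => fderiv ℂ (fun z => F z a) z₀ v) μ := by
    intro v
    refine aestronglyMeasurable_of_tendsto_ae (u := atTop)
      (f := fun (n : ℕ) a => ((n : ℂ)) • (F (z₀ + ((n : ℂ))⁻¹ • v) a - F z₀ a))
      (fun n => by
        have h := ((hF (z₀ + ((n : ℂ))⁻¹ • v)).sub (hF z₀)).const_smul (n : ℂ)
        exact h) ?_
    refine Eventually.of_forall fun a => ?_
    refine ((hd a) z₀).hasFDerivAt.lim v (c := fun n : ℕ => (n : ℂ)) ?_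
    simpa using tendsto_natCast_atTop_atTop (R := ℝ)
  -- In finite dimension the full derivative depends linearly and continuously on its values on a
  -- basis.
  have hm : AEStronglyMeasurable (fun a => fderiv ℂ (fun z => F z a) z₀) μ := by
    let b := Module.finBasis ℂ E
    let Φ : (Fin (Module.finrank ℂ E) → ℂ) →ₗ[ℂ] (E →L[ℂ] ℂ) :=
      (LinearMap.toContinuousLinearMap (𝕜 := ℂ) (E := E) (F' := ℂ)).toLinearMap ∘ₗ
        (b.constr ℂ).toLinearMap
    have hΦ : Continuous Φ := LinearMap.continuous_of_finiteDimensional _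
    have : (fun a => fderiv ℂ (fun z => F z a) z₀) =
        fun a => Φ (fun i => fderiv ℂ (fun z => F z a) z₀ (b i)) := by
      funext a
      ext1 v
      have : b.constr ℂ (fun i => fderiv ℂ (fun z => F z a) z₀ (b i)) =
          (fderiv ℂ (fun z => F z a) z₀ : E →ₗ[ℂ] ℂ) := b.ext fun i => by simp
      simp [Φ, this]
    rw [this]
    exact hΦ.comp_aestronglyMeasurable
      ((aemeasurable_pi_lambda _ fun i => (hmv (b i)).aemeasurable).aestronglyMeasurable)
  refine hasFDerivAt_integral_of_dominated_of_fderiv_le (Metric.ball_mem_nhds z₀ one_pos)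
    (Eventually.of_forall hF) (hg.mono' (hF z₀) (Eventually.of_forall fun a => hFg _ _ (by linarith)))
    hm (Eventually.of_forall hbd) (hg.const_mul 2)
    (Eventually.of_forall fun a x _ => (hd a x).hasFDerivAt)

/-- An integral depending holomorphically on a parameter is entire. -/
theorem differentiable_integral_of_locally_dominated {α E : Type*} [MeasurableSpace α]
    {μ : Measure α} [NormedAddCommGroup E] [NormedSpace ℂ E] [FiniteDimensional ℂ E]
    {F : E → α → ℂ} (hF : ∀ z, AEStronglyMeasurable (F z) μ)
    (hd : ∀ a, Differentiable ℂ fun z => F z a)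
    (hb : ∀ R : ℝ, ∃ g : α → ℝ, Integrable g μ ∧ ∀ z a, ‖z‖ ≤ R → ‖F z a‖ ≤ g a) :
    Differentiable ℂ fun z => ∫ a, F z a ∂μ := fun z₀ =>
  (hasFDerivAt_integral_of_locally_dominated hF hd hb z₀).differentiableAt

open Filter Topology in
/-- Shift of a horizontal line of integration. -/
theorem integral_horizontal_shift {F : ℂ → ℂ} {η : ℝ}
    (hF : DifferentiableOn ℂ F {z | z.im ∈ Set.uIcc 0 η}) {g : ℝ → ℝ} (hg : Integrable g)
    (hg0 : Tendsto g (cocompact ℝ) (𝓝 0))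
    (hFg : ∀ x : ℝ, ∀ y ∈ Set.uIcc 0 η, ‖F (x + y * Complex.I)‖ ≤ g x) :
    ∫ x : ℝ, F (x + η * Complex.I) = ∫ x : ℝ, F x := by
  have hcont : ∀ y ∈ Set.uIcc 0 η, Continuous fun x : ℝ => F (x + y * Complex.I) := by
    intro y hy
    refine hF.continuousOn.comp_continuous (by fun_prop) fun x => ?_
    simpa using hy
  have hint : ∀ y ∈ Set.uIcc 0 η, Integrable fun x : ℝ => F (x + y * Complex.I) := fun y hy =>
    hg.mono' (hcont y hy).aestronglyMeasurable (Eventually.of_forall fun x => hFg x y hy)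
  have hlim : ∀ y ∈ Set.uIcc 0 η,
      Tendsto (fun T : ℝ => ∫ x in (-T)..T, F (x + y * Complex.I)) atTop
        (𝓝 (∫ x : ℝ, F (x + y * Complex.I))) := fun y hy =>
    intervalIntegral_tendsto_integral (hint y hy) tendsto_neg_atTop_atBot tendsto_id
  -- The vertical sides of the rectangle have fixed length and the integrand on them is at most `g
  -- (±T)`, so they vanish in the limit.
  have hside : ∀ s : ℝ → ℝ, Tendsto s atTop (cocompact ℝ) →
      Tendsto (fun T : ℝ => Complex.I • ∫ y in (0 : ℝ)..η, F (s T + y * Complex.I)) atTop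
        (𝓝 0) := by
    intro s hs
    rw [tendsto_zero_iff_norm_tendsto_zero]
    have h1 : Tendsto (fun T : ℝ => g (s T) * |η - 0|) atTop (𝓝 0) := by
      simpa using (hg0.comp hs).mul_const |η - 0|
    refine squeeze_zero (fun _ => norm_nonneg _) (fun T => ?_) h1
    rw [norm_smul, Complex.norm_I, one_mul]
    exact intervalIntegral.norm_integral_le_of_norm_le_const fun y hy =>
      hFg _ y (Set.uIoc_subset_uIcc hy)
  have h0 := hlim 0 Set.left_mem_uIcc
  have hη := hlim η Set.right_mem_uIcc
  have hR := hside id (tendsto_id.mono_right atTop_le_cocompact)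
  have hL := hside (fun T => -T) (tendsto_neg_atTop_atBot.mono_right atBot_le_cocompact)
  have hsum := ((h0.sub hη).add hR).sub hL
  have hz : ∀ T : ℝ, ((∫ x in (-T)..T, F (x + (0 : ℝ) * Complex.I)) -
      (∫ x in (-T)..T, F (x + η * Complex.I)) +
      Complex.I • ∫ y in (0 : ℝ)..η, F ((id T : ℝ) + y * Complex.I)) -
      Complex.I • ∫ y in (0 : ℝ)..η, F ((-T : ℝ) + y * Complex.I) = 0 := by
    intro T
    have := Complex.integral_boundary_rect_eq_zero_of_differentiableOn F
      ⟨-T, 0⟩ ⟨T, η⟩ (hF.mono fun z hz => by simpa using hz.2)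
    simpa using this
  rw [tendsto_congr hz] at hsum
  have := tendsto_nhds_unique hsum tendsto_const_nhds
  simp only [Complex.ofReal_zero, zero_mul, add_zero, sub_zero] at this
  exact (sub_eq_zero.1 this).symm

theorem integrable_of_even_of_integrableOn_Ioi {f : ℝ → ℝ} (hf : IntegrableOn f (Set.Ioi 0))
    (he : ∀ x, f (-x) = f x) : Integrable f := by
  rw [← integrableOn_univ, ← Set.Iic_union_Ioi (a := (0 : ℝ))]
  refine IntegrableOn.union ?_ hf
  rw [integrableOn_Iic_iff_integrableOn_Iio]
  have := ((Measure.measurePreserving_neg (volume : Measure ℝ)).integrableOn_comp_preimage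
    (Homeomorph.neg ℝ).measurableEmbedding (f := f) (s := Set.Ioi 0)).2 hf
  have he' : f ∘ Neg.neg = f := funext he
  simpa [he'] using this

theorem integrable_exp_neg_mul_abs_rpow {a p : ℝ} (ha : 0 < a) (hp : 0 < p) :
    Integrable fun x : ℝ => Real.exp (-(a * |x| ^ p)) := by
  refine integrable_of_even_of_integrableOn_Ioi ?_ (by simp)
  have := integrableOn_rpow_mul_exp_neg_mul_rpow (p := p) (s := 0) (b := a) (by norm_num) hp ha
  refine this.congr_fun (fun x hx => ?_) measurableSet_Ioi
  simp [abs_of_pos (Set.mem_Ioi.1 hx)]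

open Filter Topology in
theorem tendsto_exp_neg_mul_abs_rpow {a p : ℝ} (ha : 0 < a) (hp : 0 < p) :
    Tendsto (fun x : ℝ => Real.exp (-(a * |x| ^ p))) (cocompact ℝ) (𝓝 0) := by
  refine Real.tendsto_exp_neg_atTop_nhds_zero.comp ?_
  refine Tendsto.const_mul_atTop ha ((tendsto_rpow_atTop hp).comp ?_)
  exact tendsto_norm_cocompact_atTop

/-- Young's inequality with a small parameter. -/
theorem exists_young_const {p q : ℝ} (hpq : p.HolderConjugate q) {ε : ℝ} (hε : 0 < ε) :
    ∃ K > 0, ∀ s t : ℝ, 0 ≤ s → 0 ≤ t → s * t ≤ ε * s ^ p + K * t ^ q := by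
  have hp := hpq.pos
  have hq := hpq.symm.pos
  -- Chosen so that `l ^ p / p = ε`; Young's inequality is applied to `l * s` and `t / l`.
  set l : ℝ := (ε * p) ^ (1 / p) with hl
  have hl0 : 0 < l := Real.rpow_pos_of_pos (by positivity) _
  refine ⟨(1 / l) ^ q / q, by positivity, fun s t hs ht => ?_⟩
  have h := Real.young_inequality_of_nonneg (a := l * s) (b := 1 / l * t) (by positivity)
    (by positivity) hpq
  have hlp : l ^ p = ε * p := by
    rw [hl, ← Real.rpow_mul (by positivity), one_div_mul_cancel hp.ne', Real.rpow_one]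
  rw [Real.mul_rpow hl0.le hs, Real.mul_rpow (by positivity) ht, hlp] at h
  have e1 : l * s * (1 / l * t) = s * t := by field_simp
  have e2 : ε * p * s ^ p / p = ε * s ^ p := by field_simp
  rw [e1, e2] at h
  linarith [mul_div_right_comm ((1 / l) ^ q) (t ^ q) q]

theorem abs_add_rpow_le {p : ℝ} (hp : 0 ≤ p) (s t : ℝ) :
    |s + t| ^ p ≤ 2 ^ p * (|s| ^ p + |t| ^ p) := by
  have h1 : |s + t| ≤ 2 * max |s| |t| := by
    have := abs_add_le s t
    have := le_max_left |s| |t|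
    have := le_max_right |s| |t|
    linarith
  calc |s + t| ^ p ≤ (2 * max |s| |t|) ^ p := Real.rpow_le_rpow (abs_nonneg _) h1 hp
    _ = 2 ^ p * max |s| |t| ^ p := Real.mul_rpow (by norm_num) (le_max_of_le_left (abs_nonneg _))
    _ ≤ _ := by
      gcongr
      rcases max_cases |s| |t| with h | h <;> rw [h.1]
      · have := Real.rpow_nonneg (abs_nonneg t) p
        linarith
      · have := Real.rpow_nonneg (abs_nonneg s) p
        linarith

open Topology in
theorem differentiable_eq_of_eventually_ofReal {f g : ℂ → ℂ} (hf : Differentiable ℂ f)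
    (hg : Differentiable ℂ g) {x₀ : ℝ} (h : ∀ᶠ x : ℝ in 𝓝 x₀, f x = g x) : f = g := by
  refine AnalyticOnNhd.eq_of_frequently_eq (z₀ := (x₀ : ℂ))
    (fun z _ => hf.analyticAt z) (fun z _ => hg.analyticAt z) ?_
  have ht : Filter.Tendsto (fun x : ℝ => (x : ℂ)) (𝓝[≠] x₀) (𝓝[≠] (x₀ : ℂ)) := by
    refine tendsto_nhdsWithin_of_tendsto_nhds_of_eventually_within _ ?_ ?_
    · exact Complex.continuous_ofReal.continuousAt.mono_left nhdsWithin_le_nhds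
    · filter_upwards [self_mem_nhdsWithin] with x hx using by simpa using hx
  exact ht.frequently (h.filter_mono nhdsWithin_le_nhds).frequently

theorem differentiable_eq_of_forall_ofReal {f g : ℂ → ℂ} (hf : Differentiable ℂ f)
    (hg : Differentiable ℂ g) (h : ∀ x : ℝ, f x = g x) : f = g :=
  differentiable_eq_of_eventually_ofReal hf hg (x₀ := 0) (Filter.Eventually.of_forall h)

/-! ### Gelfand–Shilov bounds in one variable and the Laplace transform. -/

namespace TwistedWeyl

/-- The choice of the height of the contour in the estimate of a Fourier transform. -/
theorem exists_contour_height {r r' : ℝ} (hr : r.HolderConjugate r') {b : ℝ} (hb : 0 < b) :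
    ∃ a > 0, ∀ t : ℝ, ∃ η : ℝ, t * η + b * |η| ^ r ≤ -(a * |t| ^ r') := by
  have hr1 := hr.lt
  have hr1' := hr.symm.lt
  -- With `|η| = δ |t|^(r'-1)`, both `|t η|` and `|η| ^ r` are multiples of `|t| ^ r'`; this `δ`
  -- makes the growth term `b δ ^ r` eat exactly half of the linear gain `δ`.
  set δ : ℝ := (1 / (2 * b)) ^ (1 / (r - 1)) with hδ
  have hδ0 : 0 < δ := Real.rpow_pos_of_pos (by positivity) _
  have hδr : b * δ ^ r = δ / 2 := by
    have h1 : δ ^ (r - 1) = 1 / (2 * b) := by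
      rw [hδ, ← Real.rpow_mul (by positivity), one_div_mul_cancel (by linarith), Real.rpow_one]
    have h2 : δ ^ r = δ ^ (r - 1) * δ := by
      rw [← Real.rpow_add_one hδ0.ne', sub_add_cancel]
    rw [h2, h1]
    field_simp
  refine ⟨δ / 2, by positivity, fun t => ?_⟩
  have hmul : (r' - 1) * r = r' := by
    have := hr.symm.sub_one_mul_conj
    linarith
  have hpos : |t| * (δ * |t| ^ (r' - 1)) + 0 = δ * |t| ^ r' := by
    rcases eq_or_ne t 0 with rfl | ht
    · simp [Real.zero_rpow hr.symm.ne_zero]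
    · have : |t| ^ r' = |t| ^ (r' - 1) * |t| := by
        rw [← Real.rpow_add_one (abs_pos.2 ht).ne', sub_add_cancel]
      rw [this]; ring
  have habs : (δ * |t| ^ (r' - 1)) ^ r = δ ^ r * |t| ^ r' := by
    rw [Real.mul_rpow hδ0.le (by positivity), ← Real.rpow_mul (abs_nonneg t), hmul]
  have h0 : 0 ≤ δ * |t| ^ (r' - 1) := by positivity
  have key : -(|t| * (δ * |t| ^ (r' - 1))) + b * (δ * |t| ^ (r' - 1)) ^ r =
      -(δ / 2 * |t| ^ r') := by
    rw [habs, ← mul_assoc b, hδr]; linarith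
  rcases le_total 0 t with ht | ht
  · refine ⟨-(δ * |t| ^ (r' - 1)), ?_⟩
    rw [abs_neg, abs_of_nonneg h0, ← key]
    rw [abs_of_nonneg ht]
    linarith
  · refine ⟨δ * |t| ^ (r' - 1), ?_⟩
    rw [abs_of_nonneg h0, ← key]
    rw [abs_of_nonpos ht]
    linarith

/-- Gelfand–Shilov type bound for a function of one complex variable. -/
def TypeBound (p r a b C : ℝ) (F : ℂ → ℂ) : Prop :=
  ∀ z : ℂ, ‖F z‖ ≤ C * Real.exp (-(a * |z.re| ^ p) + b * |z.im| ^ r)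

theorem TypeBound.const_nonneg {p r a b C : ℝ} {F : ℂ → ℂ} (h : TypeBound p r a b C F) : 0 ≤ C :=
  nonneg_of_mul_nonneg_left ((norm_nonneg _).trans (h 0)) (Real.exp_pos _)

theorem TypeBound.ofReal {p r a b C : ℝ} (hr : 0 < r) {F : ℂ → ℂ} (h : TypeBound p r a b C F)
    (x : ℝ) : ‖F x‖ ≤ C * Real.exp (-(a * |x| ^ p)) := by
  simpa [Real.zero_rpow hr.ne'] using h x

theorem norm_exp_neg_mul_ofReal (z : ℂ) (x : ℝ) :
    ‖Complex.exp (-z * x)‖ = Real.exp (-(z.re * x)) := by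
  simp [Complex.norm_exp]

/-- The Laplace integrand of a function with superexponential decay is dominated, locally uniformly
in the Laplace variable. -/
theorem exists_laplace_integrand_bound {p p' : ℝ} (hp : p.HolderConjugate p') {a : ℝ}
    (ha : 0 < a) : ∃ K > 0, ∀ (C : ℝ) (u : ℝ → ℂ), (∀ x, ‖u x‖ ≤ C * Real.exp (-(a * |x| ^ p))) →
      ∀ (z : ℂ) (x : ℝ), ‖Complex.exp (-z * x) * u x‖ ≤
        C * Real.exp (K * |z.re| ^ p') * Real.exp (-(a / 2 * |x| ^ p)) := by
  obtain ⟨K, hK, hY⟩ := exists_young_const hp (half_pos ha)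
  refine ⟨K, hK, fun C u hu z x => ?_⟩
  rw [norm_mul, norm_exp_neg_mul_ofReal]
  have hC : 0 ≤ C := nonneg_of_mul_nonneg_left ((norm_nonneg _).trans (hu 0)) (Real.exp_pos _)
  calc Real.exp (-(z.re * x)) * ‖u x‖
      ≤ Real.exp (-(z.re * x)) * (C * Real.exp (-(a * |x| ^ p))) := by gcongr; exact hu x
    _ = C * Real.exp (-(z.re * x) - a * |x| ^ p) := by rw [sub_eq_add_neg, Real.exp_add]; ring
    _ ≤ C * Real.exp (K * |z.re| ^ p' + -(a / 2 * |x| ^ p)) := by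
        gcongr
        have h1 := hY |x| |z.re| (abs_nonneg _) (abs_nonneg _)
        have h2 : -(z.re * x) ≤ |x| * |z.re| := by
          rw [← abs_mul, mul_comm x]; exact neg_le_abs _
        linarith
    _ = _ := by rw [Real.exp_add]; ring

theorem integrable_laplace_integrand {p : ℝ} (hp : 1 < p) {a C : ℝ} (ha : 0 < a) {u : ℝ → ℂ}
    (hm : AEStronglyMeasurable u) (hu : ∀ x, ‖u x‖ ≤ C * Real.exp (-(a * |x| ^ p))) (z : ℂ) :
    Integrable fun x : ℝ => Complex.exp (-z * x) * u x := by
  obtain ⟨K, -, hK⟩ := exists_laplace_integrand_bound (Real.HolderConjugate.conjExponent hp) ha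
  exact ((integrable_exp_neg_mul_abs_rpow (half_pos ha) (by linarith)).const_mul _).mono'
    ((Continuous.aestronglyMeasurable (by fun_prop)).mul hm)
    (Filter.Eventually.of_forall fun x => hK C u hu z x)

/-- The Laplace transform maps bounds of Gelfand–Shilov type to bounds of the dual type. -/
theorem exists_laplace_bound {p p' r r' : ℝ} (hp : p.HolderConjugate p')
    (hr : r.HolderConjugate r') {a b : ℝ} (ha : 0 < a) (hb : 0 < b) :
    ∃ a' > 0, ∃ b' > 0, ∃ K > 0, ∀ (C : ℝ) (F : ℂ → ℂ), Differentiable ℂ F → TypeBound p r a b C F →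
      ∀ z : ℂ, ‖laplace (fun x => F x) z‖ ≤
        C * K * Real.exp (b' * |z.re| ^ p' - a' * |z.im| ^ r') := by
  obtain ⟨a', ha', hη⟩ := exists_contour_height hr hb
  obtain ⟨K, hK, hY⟩ := exists_laplace_integrand_bound hp ha
  have hint := integrable_exp_neg_mul_abs_rpow (half_pos ha) hp.pos
  have hI : 0 < ∫ x : ℝ, Real.exp (-(a / 2 * |x| ^ p)) := integral_exp_pos hint
  refine ⟨a', ha', K, hK, _, hI, fun C F hF hFb z => ?_⟩
  have hC := hFb.const_nonneg
  obtain ⟨η, hη⟩ := hη z.im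
  have hbd : ∀ y x : ℝ,
      ‖Complex.exp (-z * (x + y * Complex.I)) * F (x + y * Complex.I)‖ ≤
        C * Real.exp (z.im * y + b * |y| ^ r) * Real.exp (K * |z.re| ^ p') *
          Real.exp (-(a / 2 * |x| ^ p)) := by
    intro y x
    have h1 := hY (C * Real.exp (b * |y| ^ r)) (fun x => F (x + y * Complex.I)) (fun x => by
      have := hFb (x + y * Complex.I)
      simp only [Complex.add_re, Complex.ofReal_re, Complex.mul_re, Complex.I_re, mul_zero,
        Complex.ofReal_im, Complex.I_im, sub_zero, add_zero, Complex.add_im,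
        Complex.mul_im, mul_one, zero_add] at this
      rw [Real.exp_add] at this
      linarith) z x
    have h2 : Complex.exp (-z * (x + y * Complex.I)) =
        Complex.exp (-z * (y * Complex.I)) * Complex.exp (-z * x) := by
      rw [← Complex.exp_add]; ring_nf
    have h3 : ‖Complex.exp (-z * (y * Complex.I))‖ = Real.exp (z.im * y) := by
      simp [Complex.norm_exp]
    rw [h2, mul_assoc, norm_mul, h3, Real.exp_add]
    calc _ ≤ Real.exp (z.im * y) * _ := mul_le_mul_of_nonneg_left h1 (Real.exp_pos _).le
      _ = _ := by ring
  -- On the line of height `η` the exponential contributes `exp(z.im * η)` and `F` contributes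
  -- `exp(b |η| ^ r)`; the choice of `η` makes the product decay in `z.im`.
  have hshift : laplace (fun x => F x) z =
      ∫ x : ℝ, Complex.exp (-z * (x + η * Complex.I)) * F (x + η * Complex.I) := by
    refine (integral_horizontal_shift (F := fun w => Complex.exp (-z * w) * F w) (η := η)
      (g := fun x => C * Real.exp (|z.im| * |η| + b * |η| ^ r) * Real.exp (K * |z.re| ^ p') *
          Real.exp (-(a / 2 * |x| ^ p))) (Differentiable.differentiableOn (by fun_prop))
      (hint.const_mul _) ?_ fun x y hy => (hbd y x).trans ?_).symm
    · simpa using (tendsto_exp_neg_mul_abs_rpow (half_pos ha) hp.pos).const_mul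
        (C * Real.exp (|z.im| * |η| + b * |η| ^ r) * Real.exp (K * |z.re| ^ p'))
    · have hyη : |y| ≤ |η| := by
        have := Set.abs_sub_left_of_mem_uIcc hy
        simpa using this
      have : z.im * y ≤ |z.im| * |η| := (le_abs_self _).trans (by rw [abs_mul]; gcongr)
      have hr0 := hr.pos
      gcongr
  rw [hshift]
  calc _ ≤ ∫ x : ℝ, C * Real.exp (z.im * η + b * |η| ^ r) * Real.exp (K * |z.re| ^ p') *
          Real.exp (-(a / 2 * |x| ^ p)) :=
        norm_integral_le_of_norm_le (hint.const_mul _) (Filter.Eventually.of_forall (hbd η))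
    _ = C * Real.exp (z.im * η + b * |η| ^ r) * Real.exp (K * |z.re| ^ p') *
          ∫ x : ℝ, Real.exp (-(a / 2 * |x| ^ p)) := integral_const_mul _ _
    _ ≤ C * Real.exp (-(a' * |z.im| ^ r')) * Real.exp (K * |z.re| ^ p') *
          ∫ x : ℝ, Real.exp (-(a / 2 * |x| ^ p)) := by gcongr
    _ = _ := by rw [sub_eq_add_neg, Real.exp_add]; ring

theorem differentiable_laplace {p : ℝ} (hp : 1 < p) {a C : ℝ} (ha : 0 < a) {u : ℝ → ℂ}
    (hm : AEStronglyMeasurable u) (hu : ∀ x, ‖u x‖ ≤ C * Real.exp (-(a * |x| ^ p))) :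
    Differentiable ℂ (laplace u) := by
  obtain ⟨K, hK0, hK⟩ := exists_laplace_integrand_bound (Real.HolderConjugate.conjExponent hp) ha
  have hC : 0 ≤ C := nonneg_of_mul_nonneg_left ((norm_nonneg _).trans (hu 0)) (Real.exp_pos _)
  refine differentiable_integral_of_locally_dominated
    (F := fun (z : ℂ) (x : ℝ) => Complex.exp (-z * x) * u x)
    (fun z => (Continuous.aestronglyMeasurable (by fun_prop)).mul hm) (fun x => by fun_prop)
    fun R => ⟨fun x => C * Real.exp (K * R ^ (Real.conjExponent p)) *
      Real.exp (-(a / 2 * |x| ^ p)),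
      (integrable_exp_neg_mul_abs_rpow (half_pos ha) (by linarith)).const_mul _, fun z x hz => ?_⟩
  refine (hK C u hu z x).trans ?_
  have : |z.re| ≤ R := (Complex.abs_re_le_norm z).trans hz
  have := (Real.HolderConjugate.conjExponent hp).symm.pos
  beta_reduce
  gcongr

/-! ### Laplace inversion on a vertical line, from Fourier inversion. -/

open FourierTransform in
theorem fourier_eq_laplace (u : ℝ → ℂ) (ξ : ℝ) :
    𝓕 u ξ = laplace u ((2 * Real.pi * ξ : ℝ) * Complex.I) := by
  rw [Real.fourier_eq', laplace]
  congr with x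
  simp only [smul_eq_mul]
  congr 2
  simp
  ring

open FourierTransform in
/-- The Laplace transform on a vertical line determines a continuous integrable function. -/
theorem laplace_inversion {u : ℝ → ℂ} (hc : Continuous u) (hu : Integrable u)
    (hL : Integrable fun t : ℝ => laplace u (t * Complex.I)) (x : ℝ) :
    u x = laplaceInv 0 (laplace u) x := by
  have h2pi : (2 * Real.pi) ≠ 0 := by positivity
  have hF : Integrable (𝓕 u) := by
    have := hL.comp_mul_left' h2pi
    refine this.congr (Filter.Eventually.of_forall fun ξ => ?_)
    simp only [fourier_eq_laplace]
  have h := congrFun (hc.fourierInv_fourier_eq hu hF) x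
  rw [← h, Real.fourierInv_eq', laplaceInv]
  have := Measure.integral_comp_mul_left
    (fun t : ℝ => Complex.exp (((0 : ℝ) + t * Complex.I) * x) *
      laplace u ((0 : ℝ) + t * Complex.I)) (2 * Real.pi)
  rw [abs_of_pos (by positivity)] at this
  simp only [fourier_eq_laplace, smul_eq_mul]
  have e : ∀ v : ℝ, Complex.exp (((2 * Real.pi * inner ℝ v x : ℝ) : ℂ) * Complex.I) =
      Complex.exp (((0 : ℝ) + (2 * Real.pi * v : ℝ) * Complex.I) * x) := by
    intro v
    congr 1
    simp
    ring
  simp only [e]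
  simp only [Complex.ofReal_zero, zero_add] at this ⊢
  rw [this]
  simp

open FourierTransform in
/-- The inverse Laplace transform is a right inverse of the Laplace transform. -/
theorem laplace_laplaceInv {H : ℂ → ℂ} {c : ℝ}
    (hc : Continuous fun t : ℝ => H (c + t * Complex.I))
    (hi : Integrable fun t : ℝ => H (c + t * Complex.I))
    (hL : Integrable fun x : ℝ => Complex.exp (-c * x) * laplaceInv c H x) (t : ℝ) :
    laplace (laplaceInv c H) (c + t * Complex.I) = H (c + t * Complex.I) := by
  have h2pi : (2 * Real.pi) ≠ 0 := by positivity
  have hpi : (Real.pi : ℂ) ≠ 0 := by simp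
  set h : ℝ → ℂ := fun t => H (c + t * Complex.I) with hh
  -- Up to the scaling by `2π`, the function `exp(-c x) * laplaceInv c H x` is the inverse Fourier
  -- transform of `H` along the line of abscissa `c`.
  have e : ∀ x : ℝ, 𝓕⁻ h x =
      2 * Real.pi * (Complex.exp (-c * (2 * Real.pi * x : ℝ)) *
        laplaceInv c H (2 * Real.pi * x : ℝ)) := by
    intro x
    rw [Real.fourierInv_eq', laplaceInv]
    have : ∀ s : ℝ, Complex.exp ((c + s * Complex.I) * (2 * Real.pi * x : ℝ)) *
        H (c + s * Complex.I) = Complex.exp (c * (2 * Real.pi * x : ℝ)) *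
        (Complex.exp (((2 * Real.pi * inner ℝ s x : ℝ) : ℂ) * Complex.I) • h s) := by
      intro s
      rw [smul_eq_mul, ← mul_assoc, ← Complex.exp_add, hh]
      congr 2
      simp
      ring
    simp only [this]
    rw [integral_const_mul]
    have h3 : Complex.exp (-c * (2 * Real.pi * x : ℝ)) *
        Complex.exp (c * (2 * Real.pi * x : ℝ)) = 1 := by
      rw [← Complex.exp_add]; simp
    have aux : ∀ A B J : ℂ, A * B = 1 → J = 2 * Real.pi * (A * (1 / (2 * Real.pi) * (B * J))) := by
      intro A B J hAB
      calc J = A * B * J := by rw [hAB, one_mul]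
        _ = _ := by field_simp
    exact aux _ _ _ h3
  have hiF : Integrable (𝓕⁻ h) := by
    have := (hL.comp_mul_left' h2pi).const_mul (2 * Real.pi : ℂ)
    exact this.congr (Filter.Eventually.of_forall fun x => (e x).symm)
  have hiF' : Integrable (𝓕 h) := by
    have := hiF.comp_neg
    simpa only [Real.fourierInv_eq_fourier_neg, neg_neg] using this
  have key := congrFun (hc.fourier_fourierInv_eq hi hiF') t
  rw [Real.fourier_eq'] at key
  simp only [e, smul_eq_mul] at key
  have := Measure.integral_comp_mul_left (fun x : ℝ => Complex.exp (-(c + t * Complex.I) * x) *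
      laplaceInv c H x) (2 * Real.pi)
  rw [abs_of_pos (by positivity)] at this
  change _ = h t
  rw [← key, laplace]
  have e2 : ∀ v : ℝ, Complex.exp (((-2 * Real.pi * inner ℝ v t : ℝ) : ℂ) * Complex.I) *
      (2 * Real.pi * (Complex.exp (-c * (2 * Real.pi * v : ℝ)) *
        laplaceInv c H (2 * Real.pi * v : ℝ))) = 2 * Real.pi *
      (Complex.exp (-(c + t * Complex.I) * (2 * Real.pi * v : ℝ)) *
        laplaceInv c H (2 * Real.pi * v : ℝ)) := by
    intro v
    have : Complex.exp (-(c + t * Complex.I) * (2 * Real.pi * v : ℝ)) =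
        Complex.exp (((-2 * Real.pi * inner ℝ v t : ℝ) : ℂ) * Complex.I) *
        Complex.exp (-c * (2 * Real.pi * v : ℝ)) := by
      rw [← Complex.exp_add]
      congr 1
      simp
      ring
    rw [this]; ring
  simp only [e2]
  rw [integral_const_mul, this, Complex.real_smul]
  push_cast
  field_simp

/-! ### Gelfand–Shilov bounds in two variables. -/

/-- Gelfand–Shilov type bound for a function of two complex variables. -/
def TypeBound₂ (p₁ r₁ p₂ r₂ a₁ b₁ a₂ b₂ C : ℝ) (f : ℂ × ℂ → ℂ) : Prop :=
  ∀ z : ℂ × ℂ, ‖f z‖ ≤ C * Real.exp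
      (-(a₁ * |z.1.re| ^ p₁) - a₂ * |z.2.re| ^ p₂ + b₁ * |z.1.im| ^ r₁ + b₂ * |z.2.im| ^ r₂)

theorem mem_spaceS_iff {A : ℝ × ℝ} {f : ℂ × ℂ → ℂ} :
    f ∈ spaceS A ↔ Differentiable ℂ f ∧ ∃ a₁ > 0, ∃ a₂ > 0, ∃ b₁ > 0, ∃ b₂ > 0, ∃ C > (0 : ℝ),
      TypeBound₂ (1 / A.1) (1 / (1 - A.2)) (1 / A.2) (1 / (1 - A.1)) a₁ b₁ a₂ b₂ C f := Iff.rfl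

theorem holderConjugate_one_div {α : ℝ} (hα : α ∈ Set.Ioo (0 : ℝ) 1) :
    (1 / α).HolderConjugate (1 / (1 - α)) := by
  rw [Real.holderConjugate_iff]
  refine ⟨?_, by simp⟩
  rw [lt_div_iff₀ hα.1]
  linarith [hα.2]

section Bounds

variable {p₁ r₁ p₂ r₂ a₁ b₁ a₂ b₂ C : ℝ} {f : ℂ × ℂ → ℂ}

theorem TypeBound₂.const_nonneg (h : TypeBound₂ p₁ r₁ p₂ r₂ a₁ b₁ a₂ b₂ C f) : 0 ≤ C :=
  nonneg_of_mul_nonneg_left ((norm_nonneg _).trans (h 0)) (Real.exp_pos _)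

theorem TypeBound₂.swap (h : TypeBound₂ p₁ r₁ p₂ r₂ a₁ b₁ a₂ b₂ C f) :
    TypeBound₂ p₂ r₂ p₁ r₁ a₂ b₂ a₁ b₁ C (f ∘ Prod.swap) := fun z => by
  refine (h z.swap).trans (le_of_eq ?_)
  simp only [Prod.fst_swap, Prod.snd_swap]
  ring_nf

/-- Freezing one variable only changes the constant, so the one-variable Laplace estimates apply
with explicit dependence on the frozen variable. -/
theorem TypeBound₂.section (h : TypeBound₂ p₁ r₁ p₂ r₂ a₁ b₁ a₂ b₂ C f) (z₁ : ℂ) :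
    TypeBound p₂ r₂ a₂ b₂ (C * Real.exp (-(a₁ * |z₁.re| ^ p₁) + b₁ * |z₁.im| ^ r₁))
      (fun z => f (z₁, z)) := fun z => by
  refine (h (z₁, z)).trans (le_of_eq ?_)
  rw [mul_assoc, ← Real.exp_add]
  ring_nf

theorem TypeBound₂.differentiable_laplace (h : TypeBound₂ p₁ r₁ p₂ r₂ a₁ b₁ a₂ b₂ C f)
    (hf : Differentiable ℂ f) (hp₂ : 1 < p₂) (hr₁ : 0 < r₁) (hr₂ : 0 < r₂) (ha₁ : 0 < a₁)
    (hb₁ : 0 < b₁) (ha₂ : 0 < a₂) :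
    Differentiable ℂ fun z : ℂ × ℂ => laplace (fun x => f (z.1, x)) z.2 := by
  obtain ⟨K, hK0, hK⟩ := exists_laplace_integrand_bound (Real.HolderConjugate.conjExponent hp₂) ha₂
  have hC := h.const_nonneg
  have hc := hf.continuous
  refine differentiable_integral_of_locally_dominated
    (F := fun (z : ℂ × ℂ) (x : ℝ) => Complex.exp (-z.2 * x) * f (z.1, x))
    (fun z => Continuous.aestronglyMeasurable (by fun_prop))
    (fun x => ?_)
    fun R => ⟨fun x => C * Real.exp (b₁ * R ^ r₁) * Real.exp (K * R ^ (Real.conjExponent p₂)) *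
      Real.exp (-(a₂ / 2 * |x| ^ p₂)),
      (integrable_exp_neg_mul_abs_rpow (half_pos ha₂) (by linarith)).const_mul _, fun z x hz => ?_⟩
  · exact Differentiable.mul (by fun_prop) (hf.comp (by fun_prop))
  have h1 : |z.1.im| ≤ R := (Complex.abs_im_le_norm z.1).trans ((norm_fst_le z).trans hz)
  have h2 : |z.2.re| ≤ R := (Complex.abs_re_le_norm z.2).trans ((norm_snd_le z).trans hz)
  refine (hK _ _ ((h.section z.1).ofReal hr₂) z.2 x).trans ?_
  have := (Real.HolderConjugate.conjExponent hp₂).symm.pos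
  have h3 : -(a₁ * |z.1.re| ^ p₁) + b₁ * |z.1.im| ^ r₁ ≤ b₁ * R ^ r₁ := by
    have h4 : b₁ * |z.1.im| ^ r₁ ≤ b₁ * R ^ r₁ := by gcongr
    have h5 : 0 ≤ a₁ * |z.1.re| ^ p₁ := by positivity
    linarith
  beta_reduce
  gcongr

theorem TypeBound₂.differentiable_laplace_fst (h : TypeBound₂ p₁ r₁ p₂ r₂ a₁ b₁ a₂ b₂ C f)
    (hf : Differentiable ℂ f) (hp₁ : 1 < p₁) (hr₁ : 0 < r₁) (hr₂ : 0 < r₂) (ha₁ : 0 < a₁)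
    (hb₂ : 0 < b₂) (ha₂ : 0 < a₂) (w : ℂ) :
    Differentiable ℂ fun z : ℂ => laplace (fun x => f (x, z)) w := by
  have := h.swap.differentiable_laplace (hf.comp (differentiable_snd.prodMk differentiable_fst)) hp₁ hr₂ hr₁ ha₂ hb₂ ha₁
  exact this.comp (f := fun z : ℂ => (z, w)) (by fun_prop)

end Bounds

/-! ### Decay on the real plane and the symplectic Fourier transform. -/

/-- Continuous functions on the plane with superexponential decay. -/
def RapidDecay (p₁ p₂ : ℝ) (u : ℝ × ℝ → ℂ) : Prop :=
  Continuous u ∧ ∃ a₁ > 0, ∃ a₂ > 0, ∃ C ≥ (0 : ℝ), ∀ x : ℝ × ℝ,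
    ‖u x‖ ≤ C * (Real.exp (-(a₁ * |x.1| ^ p₁)) * Real.exp (-(a₂ * |x.2| ^ p₂)))

theorem RapidDecay.integrable {p₁ p₂ : ℝ} (hp₁ : 0 < p₁) (hp₂ : 0 < p₂) {u : ℝ × ℝ → ℂ}
    (hu : RapidDecay p₁ p₂ u) : Integrable u := by
  obtain ⟨hc, a₁, ha₁, a₂, ha₂, C, hC, hu⟩ := hu
  exact (((integrable_exp_neg_mul_abs_rpow ha₁ hp₁).mul_prod
    (integrable_exp_neg_mul_abs_rpow ha₂ hp₂)).const_mul C).mono' hc.aestronglyMeasurable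
    (Filter.Eventually.of_forall hu)

theorem RapidDecay.exists_bound {p₁ p₂ : ℝ} {u : ℝ × ℝ → ℂ} (hu : RapidDecay p₁ p₂ u) :
    ∃ C, ∀ x, ‖u x‖ ≤ C := by
  obtain ⟨hc, a₁, ha₁, a₂, ha₂, C, hC, hu⟩ := hu
  refine ⟨C, fun x => (hu x).trans ?_⟩
  have h1 : Real.exp (-(a₁ * |x.1| ^ p₁)) ≤ 1 := Real.exp_le_one_iff.2 (by
    have : 0 ≤ a₁ * |x.1| ^ p₁ := by positivity
    linarith)
  have h2 : Real.exp (-(a₂ * |x.2| ^ p₂)) ≤ 1 := Real.exp_le_one_iff.2 (by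
    have : 0 ≤ a₂ * |x.2| ^ p₂ := by positivity
    linarith)
  have := mul_le_one₀ h1 (Real.exp_pos _).le h2
  exact mul_le_of_le_one_right hC this

section SpaceS

variable {A : ℝ × ℝ}

theorem continuous_realRestrict {f : ℂ × ℂ → ℂ} (hf : Differentiable ℂ f) :
    Continuous (realRestrict f) := hf.continuous.comp (by fun_prop)

theorem rapidDecay_realRestrict (hA₁ : A.1 ∈ Set.Ioo (0 : ℝ) 1) (hA₂ : A.2 ∈ Set.Ioo (0 : ℝ) 1)
    {f : ℂ × ℂ → ℂ} (hf : f ∈ spaceS A) : RapidDecay (1 / A.1) (1 / A.2) (realRestrict f) := by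
  obtain ⟨hd, a₁, ha₁, a₂, ha₂, b₁, hb₁, b₂, hb₂, C, hC, h⟩ := mem_spaceS_iff.1 hf
  refine ⟨continuous_realRestrict hd, a₁, ha₁, a₂, ha₂, C, hC.le, fun x => (h _).trans ?_⟩
  have hr₁ := (holderConjugate_one_div hA₁).symm.ne_zero
  have hr₂ := (holderConjugate_one_div hA₂).symm.ne_zero
  simp only [Complex.ofReal_im, Complex.ofReal_re, abs_zero, Real.zero_rpow hr₁,
    Real.zero_rpow hr₂, mul_zero, add_zero]
  rw [← Real.exp_add, sub_eq_add_neg]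

theorem continuous_symplFourier {u : ℝ × ℝ → ℂ} (hu : Integrable u) :
    Continuous (symplFourier u) := by
  refine continuous_of_dominated (bound := fun x => ‖u x‖) (fun y => ?_) (fun y => ?_) hu.norm ?_
  · exact (Continuous.aestronglyMeasurable (by unfold omega; fun_prop)).mul hu.1
  · refine Filter.Eventually.of_forall fun x => ?_
    simp [Complex.norm_exp]
  · refine Filter.Eventually.of_forall fun x => ?_
    unfold omega
    fun_prop

/-- By Fubini. The crossing matters: `y.2` is dual to `x₁` and `y.1` is dual to `x₂`. -/
theorem symplFourier_eq_laplace {u : ℝ × ℝ → ℂ} (hu : Integrable u) (y : ℝ × ℝ) :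
    symplFourier u y =
      laplace (fun x₂ => laplace (fun x₁ => u (x₁, x₂)) (-(y.2 * Complex.I))) (y.1 * Complex.I) := by
  have hi : Integrable fun x : ℝ × ℝ => Complex.exp (Complex.I * omega x y) * u x := by
    refine hu.norm.mono' ((Continuous.aestronglyMeasurable (by unfold omega; fun_prop)).mul hu.1)
      (Filter.Eventually.of_forall fun x => ?_)
    simp [Complex.norm_exp]
  rw [symplFourier, Measure.volume_eq_prod, integral_prod_symm _ hi, laplace]
  congr with x₂
  rw [laplace, ← integral_const_mul]
  congr with x₁
  rw [← mul_assoc, ← Complex.exp_add]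
  congr 2
  simp only [omega]
  push_cast
  ring

/-- The transform in the first variable converts growth exponent `1/(1-A.2)` into decay exponent
`1/A.2` in `y.2`, and leaves an entire function with the same bounds in the second variable. The
transform in that variable converts `1/(1-A.1)` into decay exponent `1/A.1` in `y.1`. The exponents
are those of the original space. -/
theorem rapidDecay_symplFourier (hA₁ : A.1 ∈ Set.Ioo (0 : ℝ) 1) (hA₂ : A.2 ∈ Set.Ioo (0 : ℝ) 1)
    {f : ℂ × ℂ → ℂ} (hf : f ∈ spaceS A) :
    RapidDecay (1 / A.1) (1 / A.2) (symplFourier (realRestrict f)) := by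
  have hp₁ := holderConjugate_one_div hA₁
  have hp₂ := holderConjugate_one_div hA₂
  have hint := (rapidDecay_realRestrict hA₁ hA₂ hf).integrable hp₁.pos hp₂.pos
  obtain ⟨hd, a₁, ha₁, a₂, ha₂, b₁, hb₁, b₂, hb₂, C, hC, h⟩ := mem_spaceS_iff.1 hf
  obtain ⟨a₁', ha₁', b₁', hb₁', K, hK, hF₁⟩ := exists_laplace_bound hp₁ hp₂.symm ha₁ hb₁
  obtain ⟨a₂', ha₂', b₂', hb₂', K', hK', hF₂⟩ := exists_laplace_bound hp₂ hp₁.symm ha₂ hb₂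
  refine ⟨continuous_symplFourier hint, a₂', ha₂', a₁', ha₁', C * K * K', by positivity,
    fun y => ?_⟩
  rw [symplFourier_eq_laplace hint]
  have hT : TypeBound (1 / A.2) (1 / (1 - A.1)) a₂ b₂
      (C * K * Real.exp (-(a₁' * |y.2| ^ (1 / A.2))))
      (fun z => laplace (fun x => f (x, z)) (-(y.2 * Complex.I))) := by
    intro z
    have := hF₁ _ (fun w => f (w, z)) (hd.comp (by fun_prop)) (h.swap.section z)
      (-(y.2 * Complex.I))
    refine this.trans (le_of_eq ?_)
    simp only [Complex.neg_re, Complex.mul_re, Complex.ofReal_re, Complex.I_re, mul_zero,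
      Complex.ofReal_im, Complex.I_im, mul_one, sub_self, neg_zero, abs_zero,
      Real.zero_rpow hp₁.symm.ne_zero, Complex.neg_im, Complex.mul_im, add_zero, abs_neg, zero_sub]
    ring
  have := hF₂ _ _ (h.differentiable_laplace_fst hd hp₁.lt hp₂.symm.pos hp₁.symm.pos ha₁ hb₂ ha₂
    (-(y.2 * Complex.I))) hT (y.1 * Complex.I)
  refine this.trans (le_of_eq ?_)
  simp only [Complex.mul_re, Complex.ofReal_re, Complex.I_re, mul_zero,
      Complex.ofReal_im, Complex.I_im, mul_one, sub_self, abs_zero,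
      Real.zero_rpow hp₂.symm.ne_zero, Complex.mul_im, add_zero, zero_sub]
  ring

end SpaceS

/-- Rotation by a right angle preserves the area. -/
theorem integral_comp_rotate (h : ℝ × ℝ → ℂ) :
    ∫ x : ℝ × ℝ, h (x.2, -x.1) = ∫ x : ℝ × ℝ, h x := by
  let e : ℝ × ℝ ≃ᵐ ℝ × ℝ := MeasurableEquiv.prodComm.trans
    (MeasurableEquiv.prodCongr (MeasurableEquiv.refl ℝ) (MeasurableEquiv.neg ℝ))
  have he : MeasurePreserving e := by
    have h1 : MeasurePreserving (Prod.swap : ℝ × ℝ → ℝ × ℝ) := Measure.measurePreserving_swap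
    have h2 := (MeasurePreserving.id (volume : Measure ℝ)).prod
      (Measure.measurePreserving_neg (volume : Measure ℝ))
    exact h2.comp h1
  exact he.integral_comp' h

theorem integrable_comp_rotate {h : ℝ × ℝ → ℂ} (hi : Integrable h) :
    Integrable fun x : ℝ × ℝ => h (x.2, -x.1) := by
  have h1 : MeasurePreserving (Prod.swap : ℝ × ℝ → ℝ × ℝ) := Measure.measurePreserving_swap
  have h2 := (MeasurePreserving.id (volume : Measure ℝ)).prod
    (Measure.measurePreserving_neg (volume : Measure ℝ))
  exact (h2.comp h1).integrable_comp_of_integrable hi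

open FourierTransform in
/-- The symplectic Fourier transform is an involution, up to a constant. -/
theorem symplFourier_symplFourier {u : ℝ × ℝ → ℂ} (hc : Continuous u) (hu : Integrable u)
    (hF : Integrable (symplFourier u)) (x : ℝ × ℝ) :
    symplFourier (symplFourier u) x = (2 * Real.pi) ^ 2 * u x := by
  have h2pi : (2 * Real.pi) ≠ 0 := by positivity
  -- The plane is replaced by `ℂ`, an inner product space, where Fourier inversion applies;
  -- `symplFourier` is then `𝓕` after a right-angle rotation and a scaling by `2π`.
  set e := Complex.measurableEquivRealProd with he
  have hvp := Complex.volume_preserving_equiv_real_prod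
  have hee : ∀ z : ℂ, e z = (z.re, z.im) := fun z => rfl
  set U : ℂ → ℂ := fun z => u (z.re, z.im) with hU
  have hin : ∀ v w : ℂ, inner ℝ v w = v.re * w.re + v.im * w.im := by
    intro v w; simp [Complex.inner, mul_comm]
  have hFU : ∀ ξ : ℂ, 𝓕 U ξ = symplFourier u (2 * Real.pi * ξ.im, -(2 * Real.pi * ξ.re)) := by
    intro ξ
    rw [Real.fourier_eq', symplFourier, ← hvp.integral_comp']
    congr with z
    rw [← he, hee, smul_eq_mul, hU, hin]
    congr 2
    simp only [omega]
    push_cast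
    ring
  have hUi : Integrable U := hvp.integrable_comp_of_integrable hu
  have hG : Integrable fun y : ℝ × ℝ => symplFourier u (2 * Real.pi * y.2, -(2 * Real.pi * y.1)) := by
    have := integrable_comp_rotate (hF.comp_smul h2pi)
    simpa using this
  have hFUi : Integrable (𝓕 U) := by
    have := hvp.integrable_comp_of_integrable hG
    exact this.congr (Filter.Eventually.of_forall fun ξ => (hFU ξ).symm)
  have hUc : Continuous U := by
    simp only [hU]; fun_prop
  have key := congrFun (hUc.fourierInv_fourier_eq hUi hFUi) ⟨x.1, x.2⟩
  have hux : U ⟨x.1, x.2⟩ = u x := rfl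
  rw [hux] at key
  rw [← key, Real.fourierInv_eq']
  have e1 := hvp.integral_comp' (fun y : ℝ × ℝ => Complex.exp (Complex.I *
    omega ((2 * Real.pi) • (y.2, -y.1)) x) * symplFourier u ((2 * Real.pi) • (y.2, -y.1)))
  rw [integral_comp_rotate (fun y : ℝ × ℝ => Complex.exp (Complex.I *
    omega ((2 * Real.pi) • y) x) * symplFourier u ((2 * Real.pi) • y)),
    Measure.integral_comp_smul volume (fun y : ℝ × ℝ => Complex.exp (Complex.I *
    omega y x) * symplFourier u y)] at e1
  have e2 : ∫ v : ℂ, Complex.exp (((2 * Real.pi * inner ℝ v ⟨x.1, x.2⟩ : ℝ) : ℂ) * Complex.I) •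
      𝓕 U v = (((2 * Real.pi) ^ 2)⁻¹ : ℝ) • symplFourier (symplFourier u) x := by
    have h3 : |((2 * Real.pi) ^ Module.finrank ℝ (ℝ × ℝ))⁻¹| = ((2 * Real.pi) ^ 2)⁻¹ := by
      rw [abs_of_pos (by positivity)]
      simp
    rw [h3] at e1
    rw [symplFourier, ← e1]
    congr with z
    rw [← he, hee, smul_eq_mul, hFU, hin]
    simp only [omega, Prod.smul_mk, smul_eq_mul, mul_neg]
    congr 2
    push_cast
    ring
  rw [e2, Complex.real_smul]
  have hpi : (Real.pi : ℂ) ≠ 0 := by simp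
  push_cast
  field_simp

theorem norm_exp_I_mul_ofReal (t : ℝ) : ‖Complex.exp (Complex.I * t)‖ = 1 := by
  simp [Complex.norm_exp]

/-! ### The twisted convolution. -/

section TwistedConvolution

variable {q : ℝ} {U V W : ℝ × ℝ → ℂ}

/-- The twisting phase has modulus one, so this is the integrability behind the ordinary convolution
of two integrable functions. -/
theorem integrable_twistedConv_integrand₂ (hU : Integrable U) (hV : Integrable V) :
    Integrable (fun p : (ℝ × ℝ) × (ℝ × ℝ) =>
      Complex.exp (Complex.I * (q * omega p.1 p.2)) * U p.2 * V (p.1 - p.2))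
      (volume.prod volume) := by
  have h := hU.convolution_integrand (ContinuousLinearMap.mul ℝ ℂ) hV
  have he : Continuous fun p : (ℝ × ℝ) × (ℝ × ℝ) =>
      Complex.exp (Complex.I * (q * omega p.1 p.2)) := by
    unfold omega; fun_prop
  refine (h.bdd_mul (c := 1) he.aestronglyMeasurable (Filter.Eventually.of_forall fun p => ?_)).congr
    (Filter.Eventually.of_forall fun p => (mul_assoc _ _ _).symm)
  exact (by exact_mod_cast norm_exp_I_mul_ofReal (q * omega p.1 p.2) :
    ‖Complex.exp (Complex.I * (q * omega p.1 p.2))‖ = 1).le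

theorem integrable_twistedConv (hU : Integrable U) (hV : Integrable V) :
    Integrable (twistedConv q U V) :=
  (integrable_twistedConv_integrand₂ hU hV).integral_prod_left

theorem norm_twistedConv_integrand (x y : ℝ × ℝ) :
    ‖Complex.exp (Complex.I * (q * omega x y)) * U y * V (x - y)‖ = ‖U y‖ * ‖V (x - y)‖ := by
  have : ‖Complex.exp (Complex.I * (q * omega x y))‖ = 1 := by
    exact_mod_cast norm_exp_I_mul_ofReal (q * omega x y)
  rw [norm_mul, norm_mul, this, one_mul]

theorem continuous_twistedConv (hUc : Continuous U) (hU : Integrable U) (hVc : Continuous V)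
    {M : ℝ} (hV : ∀ x, ‖V x‖ ≤ M) : Continuous (twistedConv q U V) := by
  refine continuous_of_dominated (bound := fun y => ‖U y‖ * M) (fun x => ?_) (fun x => ?_)
    (hU.norm.mul_const M) ?_
  · exact Continuous.aestronglyMeasurable (by unfold omega; fun_prop)
  · refine Filter.Eventually.of_forall fun y => ?_
    rw [norm_twistedConv_integrand]
    gcongr
    exact hV _
  · refine Filter.Eventually.of_forall fun y => ?_
    unfold omega
    fun_prop

/-- The twisted convolution is associative. -/
theorem twistedConv_assoc (hU : Integrable U) (hV : Integrable V) (hWc : Continuous W)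
    {M : ℝ} (hW : ∀ x, ‖W x‖ ≤ M) :
    twistedConv q (twistedConv q U V) W = twistedConv q U (twistedConv q V W) := by
  funext x
  have hi := integrable_twistedConv_integrand₂ (q := q) hU hV
  have hi2 : Integrable (fun p : (ℝ × ℝ) × (ℝ × ℝ) =>
      (Complex.exp (Complex.I * (q * omega x p.1)) * W (x - p.1)) *
      (Complex.exp (Complex.I * (q * omega p.1 p.2)) * U p.2 * V (p.1 - p.2)))
      (volume.prod volume) := by
    refine hi.bdd_mul (c := M) (Continuous.aestronglyMeasurable (by unfold omega; fun_prop))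
      (Filter.Eventually.of_forall fun p => ?_)
    have : ‖Complex.exp (Complex.I * (q * omega x p.1))‖ = 1 := by
      exact_mod_cast norm_exp_I_mul_ofReal (q * omega x p.1)
    rw [norm_mul, this, one_mul]
    exact hW _
  have h1 : twistedConv q (twistedConv q U V) W x = ∫ y : ℝ × ℝ, ∫ s : ℝ × ℝ,
      (Complex.exp (Complex.I * (q * omega x y)) * W (x - y)) *
      (Complex.exp (Complex.I * (q * omega y s)) * U s * V (y - s)) := by
    rw [twistedConv]
    congr with y
    rw [integral_const_mul, twistedConv]
    ring
  rw [h1, integral_integral_swap hi2, twistedConv]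
  congr with s
  rw [twistedConv, ← integral_const_mul, ← integral_add_right_eq_self _ s]
  congr with y
  -- The cocycle identity `ω(x, y+s) + ω(y+s, s) = ω(x, s) + ω(x-s, y)`, from bilinearity and
  -- antisymmetry.
  have e1 : Complex.exp (Complex.I * (q * omega x (y + s))) *
      Complex.exp (Complex.I * (q * omega (y + s) s)) =
      Complex.exp (Complex.I * (q * omega x s)) *
      Complex.exp (Complex.I * (q * omega (x - s) y)) := by
    rw [← Complex.exp_add, ← Complex.exp_add]
    congr 1
    simp only [omega, Prod.fst_add, Prod.snd_add, Prod.fst_sub, Prod.snd_sub]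
    push_cast
    ring
  rw [add_sub_cancel_right, show x - (y + s) = x - s - y by abel]
  linear_combination (U s * V y * W (x - s - y)) * e1

end TwistedConvolution

/-! ### The Weyl product of elements of `S_A` extends to an element of `S_A`. -/

/-- The Weyl product as an absolutely convergent integral in which only one Fourier transform
appears. -/
theorem weyl_eq_integral (q : ℝ) {u v : ℝ × ℝ → ℂ} (hu : Integrable (symplFourier u))
    (hvc : Continuous v) (hvi : Integrable v) (hv : Integrable (symplFourier v)) (x : ℝ × ℝ) :
    weyl q u v x = (2 * Real.pi) ^ 2 *
      ∫ w : ℝ × ℝ, Complex.exp (Complex.I * omega w x) * symplFourier u w * v (x + q • w) := by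
  have hi := integrable_twistedConv_integrand₂ (q := q) hu hv
  have hi2 : Integrable (fun p : (ℝ × ℝ) × (ℝ × ℝ) =>
      Complex.exp (Complex.I * omega p.1 x) *
      (Complex.exp (Complex.I * (q * omega p.1 p.2)) * symplFourier u p.2 *
        symplFourier v (p.1 - p.2))) (volume.prod volume) := by
    refine hi.bdd_mul (c := 1) (Continuous.aestronglyMeasurable (by unfold omega; fun_prop))
      (Filter.Eventually.of_forall fun p => ?_)
    rw [norm_exp_I_mul_ofReal]
  have h1 : weyl q u v x = ∫ y : ℝ × ℝ, ∫ w : ℝ × ℝ, Complex.exp (Complex.I * omega y x) *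
      (Complex.exp (Complex.I * (q * omega y w)) * symplFourier u w *
        symplFourier v (y - w)) := by
    rw [weyl, symplFourier]
    congr with y
    rw [integral_const_mul, twistedConv]
  rw [h1, integral_integral_swap hi2, ← integral_const_mul]
  congr with w
  have h2 := symplFourier_symplFourier hvc hvi hv (x + q • w)
  calc ∫ y : ℝ × ℝ, Complex.exp (Complex.I * omega y x) *
      (Complex.exp (Complex.I * (q * omega y w)) * symplFourier u w * symplFourier v (y - w))
      = ∫ y : ℝ × ℝ, Complex.exp (Complex.I * omega w x) * symplFourier u w *
        (Complex.exp (Complex.I * omega y (x + q • w)) * symplFourier v y) := by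
        -- After translating by `w`, the `y`-integral is the double symplectic Fourier transform of
        -- `v` at `x + q • w`, which inversion evaluates.
        rw [← integral_add_right_eq_self _ w]
        congr with y
        have e1 : Complex.exp (Complex.I * omega (y + w) x) *
            Complex.exp (Complex.I * (q * omega (y + w) w)) =
            Complex.exp (Complex.I * omega w x) *
            Complex.exp (Complex.I * omega y (x + q • w)) := by
          rw [← Complex.exp_add, ← Complex.exp_add]
          congr 1
          simp only [omega, Prod.fst_add, Prod.snd_add, Prod.smul_fst, Prod.smul_snd, smul_eq_mul]
          push_cast
          ring
        rw [add_sub_cancel_right]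
        linear_combination (symplFourier u w * symplFourier v y) * e1
    _ = Complex.exp (Complex.I * omega w x) * symplFourier u w *
        symplFourier (symplFourier v) (x + q • w) := by rw [integral_const_mul]; rfl
    _ = _ := by rw [h2]; ring

/-- Superexponential decay survives a shift by a multiple of a second decaying argument. -/
theorem exists_shift_decay {p a a' : ℝ} (hp : 0 < p) (ha : 0 < a) (ha' : 0 < a') (q : ℝ) :
    ∃ c > 0, ∀ w x : ℝ, -(a * |w| ^ p) - a' * |x + q * w| ^ p ≤ -(c * |x| ^ p) := by
  -- Small enough for `d |q| ^ p ≤ a` and `d ≤ a'`; then `x = (x + q w) - q w` is split, at the cost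
  -- of the factor `2 ^ p`.
  set d := min (a / (|q| ^ p + 1)) a' with hd
  have hq : 0 < |q| ^ p + 1 := by positivity
  have hd0 : 0 < d := by positivity
  refine ⟨d / 2 ^ p, by positivity, fun w x => ?_⟩
  have h := abs_add_rpow_le hp.le (x + q * w) (-(q * w))
  rw [add_neg_cancel_right, abs_neg, abs_mul, Real.mul_rpow (abs_nonneg _) (abs_nonneg _)] at h
  have h1 : d * |x + q * w| ^ p ≤ a' * |x + q * w| ^ p := by gcongr; exact min_le_right _ _
  have h2 : d * (|q| ^ p * |w| ^ p) ≤ a * |w| ^ p := by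
    have h3 : d * (|q| ^ p + 1) ≤ a := by
      rw [← le_div_iff₀ hq]; exact min_le_left _ _
    have h4 : d * |q| ^ p ≤ a := by linarith
    rw [← mul_assoc]
    gcongr
  have h5 : d / 2 ^ p * |x| ^ p ≤ d * (|x + q * w| ^ p + |q| ^ p * |w| ^ p) := by
    calc d / 2 ^ p * |x| ^ p ≤ d / 2 ^ p * (2 ^ p * (|x + q * w| ^ p + |q| ^ p * |w| ^ p)) := by
          gcongr
      _ = _ := by field_simp
  linarith

/-- The holomorphic extension of the integrand in `weyl_eq_integral`. -/
noncomputable def weylIntegrand (q : ℝ) (U : ℝ × ℝ → ℂ) (g : ℂ × ℂ → ℂ) (z : ℂ × ℂ) (w : ℝ × ℝ) : ℂ :=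
  Complex.exp (Complex.I * (w.1 * z.2 - w.2 * z.1)) * U w * g (z.1 + q * w.1, z.2 + q * w.2)

theorem exists_weylIntegrand_bound {p₁ r₁ p₂ r₂ a₁ b₁ a₂ b₂ C : ℝ} (hp₁ : p₁.HolderConjugate r₂)
    (hp₂ : p₂.HolderConjugate r₁) (q : ℝ) {U : ℝ × ℝ → ℂ} (hU : RapidDecay p₁ p₂ U)
    {g : ℂ × ℂ → ℂ} (hg : TypeBound₂ p₁ r₁ p₂ r₂ a₁ b₁ a₂ b₂ C g) (ha₁ : 0 < a₁) (ha₂ : 0 < a₂)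
    (hb₁ : 0 < b₁) (hb₂ : 0 < b₂) :
    ∃ c₁ > 0, ∃ c₂ > 0, ∃ B₁ > 0, ∃ B₂ > 0, ∃ β₁ > 0, ∃ β₂ > 0, ∃ M ≥ (0 : ℝ), ∀ z w,
      ‖weylIntegrand q U g z w‖ ≤ M * Real.exp (-(c₁ * |z.1.re| ^ p₁) - c₂ * |z.2.re| ^ p₂ +
        B₁ * |z.1.im| ^ r₁ + B₂ * |z.2.im| ^ r₂) *
        (Real.exp (-(β₁ * |w.1| ^ p₁)) * Real.exp (-(β₂ * |w.2| ^ p₂))) := by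
  obtain ⟨hUc, α₁, hα₁, α₂, hα₂, D, hD, hU⟩ := hU
  have hC := hg.const_nonneg
  -- The decay rate `α` of `U` is divided in three: a quarter produces decay in `Re z` through the
  -- shift `z + q w`, a quarter absorbs the exponential factor by Young, and a half keeps the
  -- integral over `w` convergent.
  obtain ⟨c₁, hc₁, hs₁⟩ := exists_shift_decay hp₁.pos (half_pos (half_pos hα₁)) ha₁ q
  obtain ⟨c₂, hc₂, hs₂⟩ := exists_shift_decay hp₂.pos (half_pos (half_pos hα₂)) ha₂ q
  obtain ⟨K₁, hK₁, hY₁⟩ := exists_young_const hp₁ (half_pos (half_pos hα₁))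
  obtain ⟨K₂, hK₂, hY₂⟩ := exists_young_const hp₂ (half_pos (half_pos hα₂))
  refine ⟨c₁, hc₁, c₂, hc₂, b₁ + K₂, by positivity, b₂ + K₁, by positivity, α₁ / 2, half_pos hα₁,
    α₂ / 2, half_pos hα₂, D * C, by positivity, fun z w => ?_⟩
  have e0 : ‖Complex.exp (Complex.I * (w.1 * z.2 - w.2 * z.1))‖ =
      Real.exp (-(w.1 * z.2.im) + w.2 * z.1.im) := by
    rw [Complex.norm_exp]
    congr 1
    simp
    ring
  have e1 : -(w.1 * z.2.im) ≤ α₁ / 2 / 2 * |w.1| ^ p₁ + K₁ * |z.2.im| ^ r₂ := by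
    refine le_trans ?_ (hY₁ |w.1| |z.2.im| (abs_nonneg _) (abs_nonneg _))
    rw [← abs_mul]; exact neg_le_abs _
  have e2 : w.2 * z.1.im ≤ α₂ / 2 / 2 * |w.2| ^ p₂ + K₂ * |z.1.im| ^ r₁ := by
    refine le_trans ?_ (hY₂ |w.2| |z.1.im| (abs_nonneg _) (abs_nonneg _))
    rw [← abs_mul]; exact le_abs_self _
  have e3 := hs₁ w.1 z.1.re
  have e4 := hs₂ w.2 z.2.re
  have e5 := hg (z.1 + q * w.1, z.2 + q * w.2)
  simp only [Complex.add_re, Complex.mul_re, Complex.ofReal_re, Complex.ofReal_im, mul_zero,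
    sub_zero, Complex.add_im, Complex.mul_im, zero_mul, add_zero] at e5
  rw [weylIntegrand, norm_mul, norm_mul, e0]
  calc _ ≤ Real.exp (-(w.1 * z.2.im) + w.2 * z.1.im) *
        (D * (Real.exp (-(α₁ * |w.1| ^ p₁)) * Real.exp (-(α₂ * |w.2| ^ p₂)))) *
        (C * Real.exp (-(a₁ * |z.1.re + q * w.1| ^ p₁) - a₂ * |z.2.re + q * w.2| ^ p₂ +
          b₁ * |z.1.im| ^ r₁ + b₂ * |z.2.im| ^ r₂)) := by
        gcongr
        exact hU w
    _ = D * C * Real.exp (-(w.1 * z.2.im) + w.2 * z.1.im +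
        (-(α₁ * |w.1| ^ p₁) + -(α₂ * |w.2| ^ p₂)) +
        (-(a₁ * |z.1.re + q * w.1| ^ p₁) - a₂ * |z.2.re + q * w.2| ^ p₂ +
          b₁ * |z.1.im| ^ r₁ + b₂ * |z.2.im| ^ r₂)) := by
        simp only [Real.exp_add]; ring
    _ ≤ D * C * Real.exp ((-(c₁ * |z.1.re| ^ p₁) - c₂ * |z.2.re| ^ p₂ +
        (b₁ + K₂) * |z.1.im| ^ r₁ + (b₂ + K₁) * |z.2.im| ^ r₂) +
        (-(α₁ / 2 * |w.1| ^ p₁) + -(α₂ / 2 * |w.2| ^ p₂))) := by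
        refine mul_le_mul_of_nonneg_left (Real.exp_le_exp.2 ?_) (by positivity)
        linarith
    _ = _ := by
        rw [Real.exp_add _ (-(α₁ / 2 * |w.1| ^ p₁) + -(α₂ / 2 * |w.2| ^ p₂)), Real.exp_add (-_) (-_)]
        ring

/-- The integral of `weylIntegrand` is of the same Gelfand–Shilov type. -/
theorem integral_weylIntegrand {p₁ r₁ p₂ r₂ a₁ b₁ a₂ b₂ C : ℝ} (hp₁ : p₁.HolderConjugate r₂)
    (hp₂ : p₂.HolderConjugate r₁) (q : ℝ) {U : ℝ × ℝ → ℂ} (hU : RapidDecay p₁ p₂ U)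
    {g : ℂ × ℂ → ℂ} (hd : Differentiable ℂ g)
    (hg : TypeBound₂ p₁ r₁ p₂ r₂ a₁ b₁ a₂ b₂ C g) (ha₁ : 0 < a₁) (ha₂ : 0 < a₂)
    (hb₁ : 0 < b₁) (hb₂ : 0 < b₂) :
    (Differentiable ℂ fun z => ∫ w, weylIntegrand q U g z w) ∧
    ∃ c₁ > 0, ∃ c₂ > 0, ∃ B₁ > 0, ∃ B₂ > 0, ∃ M > 0,
      TypeBound₂ p₁ r₁ p₂ r₂ c₁ B₁ c₂ B₂ M fun z => ∫ w, weylIntegrand q U g z w := by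
  obtain ⟨c₁, hc₁, c₂, hc₂, B₁, hB₁, B₂, hB₂, β₁, hβ₁, β₂, hβ₂, M, hM, hbound⟩ :=
    exists_weylIntegrand_bound hp₁ hp₂ q hU hg ha₁ ha₂ hb₁ hb₂
  have hUc := hU.1
  have hgc := hd.continuous
  have hI := (integrable_exp_neg_mul_abs_rpow hβ₁ hp₁.pos).mul_prod
    (integrable_exp_neg_mul_abs_rpow hβ₂ hp₂.pos)
  set I₀ := ∫ w : ℝ × ℝ, Real.exp (-(β₁ * |w.1| ^ p₁)) * Real.exp (-(β₂ * |w.2| ^ p₂)) with hI₀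
  have hI0 : 0 ≤ I₀ := integral_nonneg fun w => by positivity
  constructor
  · refine differentiable_integral_of_locally_dominated
      (fun z => Continuous.aestronglyMeasurable (by unfold weylIntegrand; fun_prop)) (fun w => ?_)
      fun R => ⟨fun w => M * Real.exp (B₁ * R ^ r₁ + B₂ * R ^ r₂) *
        (Real.exp (-(β₁ * |w.1| ^ p₁)) * Real.exp (-(β₂ * |w.2| ^ p₂))), hI.const_mul _,
        fun z w hz => (hbound z w).trans ?_⟩
    · unfold weylIntegrand
      exact Differentiable.mul (by fun_prop) (hd.comp (by fun_prop))
    · have h1 : |z.1.im| ≤ R := (Complex.abs_im_le_norm z.1).trans ((norm_fst_le z).trans hz)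
      have h2 : |z.2.im| ≤ R := (Complex.abs_im_le_norm z.2).trans ((norm_snd_le z).trans hz)
      have h3 := hp₁.symm.pos
      have h4 := hp₂.symm.pos
      have h5 : 0 ≤ c₁ * |z.1.re| ^ p₁ := by positivity
      have h6 : 0 ≤ c₂ * |z.2.re| ^ p₂ := by positivity
      have h7 : B₁ * |z.1.im| ^ r₁ ≤ B₁ * R ^ r₁ := by gcongr
      have h8 : B₂ * |z.2.im| ^ r₂ ≤ B₂ * R ^ r₂ := by gcongr
      refine mul_le_mul_of_nonneg_right (mul_le_mul_of_nonneg_left (Real.exp_le_exp.2 ?_) hM)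
        (by positivity)
      linarith
  · refine ⟨c₁, hc₁, c₂, hc₂, B₁, hB₁, B₂, hB₂, M * I₀ + 1, by positivity, fun z => ?_⟩
    have hn := norm_integral_le_of_norm_le (hI.const_mul _)
      (Filter.Eventually.of_forall (hbound z))
    rw [integral_const_mul, ← Measure.volume_eq_prod, ← hI₀] at hn
    refine hn.trans ?_
    have := Real.exp_pos (-(c₁ * |z.1.re| ^ p₁) - c₂ * |z.2.re| ^ p₂ +
        B₁ * |z.1.im| ^ r₁ + B₂ * |z.2.im| ^ r₂)
    linarith

theorem const_mul_mem_spaceS {A : ℝ × ℝ} {f : ℂ × ℂ → ℂ} (hf : f ∈ spaceS A) (c : ℂ) :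
    (fun z => c * f z) ∈ spaceS A := by
  obtain ⟨hd, a₁, ha₁, a₂, ha₂, b₁, hb₁, b₂, hb₂, C, hC, h⟩ := mem_spaceS_iff.1 hf
  refine mem_spaceS_iff.2 ⟨hd.const_mul c, a₁, ha₁, a₂, ha₂, b₁, hb₁, b₂, hb₂, (‖c‖ + 1) * C,
    by positivity, fun z => ?_⟩
  rw [norm_mul, mul_assoc]
  gcongr
  · linarith
  · exact h z

theorem add_mem_spaceS {A : ℝ × ℝ} {f g : ℂ × ℂ → ℂ} (hf : f ∈ spaceS A) (hg : g ∈ spaceS A) :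
    (fun z => f z + g z) ∈ spaceS A := by
  obtain ⟨hd, a₁, ha₁, a₂, ha₂, b₁, hb₁, b₂, hb₂, C, hC, h⟩ := mem_spaceS_iff.1 hf
  obtain ⟨hd', a₁', ha₁', a₂', ha₂', b₁', hb₁', b₂', hb₂', C', hC', h'⟩ := mem_spaceS_iff.1 hg
  refine mem_spaceS_iff.2 ⟨hd.add hd', min a₁ a₁', lt_min ha₁ ha₁', min a₂ a₂', lt_min ha₂ ha₂',
    max b₁ b₁', lt_max_of_lt_left hb₁, max b₂ b₂', lt_max_of_lt_left hb₂, C + C',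
    by positivity, fun z => ?_⟩
  refine (norm_add_le _ _).trans ?_
  rw [add_mul]
  refine add_le_add ((h z).trans ?_) ((h' z).trans ?_)
  · gcongr
    exacts [min_le_left _ _, min_le_left _ _, le_max_left _ _, le_max_left _ _]
  · gcongr
    exacts [min_le_right _ _, min_le_right _ _, le_max_right _ _, le_max_right _ _]

/-- The Weyl product of (restrictions of) elements of `S_A` is in `S_A`. -/
theorem weyl_mem_spaceS {A : ℝ × ℝ} (hA₁ : A.1 ∈ Set.Ioo (0 : ℝ) 1) (hA₂ : A.2 ∈ Set.Ioo (0 : ℝ) 1)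
    (q : ℝ) {f g : ℂ × ℂ → ℂ} (hf : f ∈ spaceS A) (hg : g ∈ spaceS A) :
    weyl q (realRestrict f) (realRestrict g) ∈ realRestrict '' spaceS A := by
  have hp₁ := holderConjugate_one_div hA₁
  have hp₂ := holderConjugate_one_div hA₂
  have hfF := rapidDecay_symplFourier hA₁ hA₂ hf
  have hgF := rapidDecay_symplFourier hA₁ hA₂ hg
  have hgR := rapidDecay_realRestrict hA₁ hA₂ hg
  have hweyl := weyl_eq_integral q (hfF.integrable hp₁.pos hp₂.pos) hgR.1
    (hgR.integrable hp₁.pos hp₂.pos) (hgF.integrable hp₁.pos hp₂.pos)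
  obtain ⟨hd, a₁, ha₁, a₂, ha₂, b₁, hb₁, b₂, hb₂, C, hC, h⟩ := mem_spaceS_iff.1 hg
  refine ⟨_, const_mul_mem_spaceS (mem_spaceS_iff.2
    (integral_weylIntegrand hp₁ hp₂ q hfF hd h ha₁ ha₂ hb₁ hb₂)) ((2 * Real.pi) ^ 2), ?_⟩
  funext x
  rw [hweyl, realRestrict]
  congr with w
  simp only [weylIntegrand, omega, realRestrict, Prod.fst_add, Prod.snd_add, Prod.smul_fst,
    Prod.smul_snd, smul_eq_mul]
  push_cast
  rfl

/-! ### Bilinearity and associativity of the Weyl product. -/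

section Algebra

variable {A : ℝ × ℝ}

theorem symplFourier_add {u v : ℝ × ℝ → ℂ} (hu : Integrable u) (hv : Integrable v) :
    symplFourier (u + v) = symplFourier u + symplFourier v := by
  have hi : ∀ {u : ℝ × ℝ → ℂ}, Integrable u → ∀ y,
      Integrable fun x : ℝ × ℝ => Complex.exp (Complex.I * omega x y) * u x := fun hu y =>
    hu.bdd_mul (c := 1) (Continuous.aestronglyMeasurable (by unfold omega; fun_prop))
      (Filter.Eventually.of_forall fun x => (norm_exp_I_mul_ofReal _).le)
  funext y
  simp only [symplFourier, Pi.add_apply, mul_add]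
  exact integral_add (hi hu y) (hi hv y)

theorem symplFourier_smul (c : ℂ) (u : ℝ × ℝ → ℂ) :
    symplFourier (c • u) = c • symplFourier u := by
  funext y
  simp only [symplFourier, Pi.smul_apply, smul_eq_mul]
  rw [← integral_const_mul]
  congr with x
  ring

theorem integrable_weyl_integrand {q : ℝ} {U v : ℝ × ℝ → ℂ} (hU : Integrable U)
    (hvc : Continuous v) {M : ℝ} (hv : ∀ x, ‖v x‖ ≤ M) (x : ℝ × ℝ) :
    Integrable fun w : ℝ × ℝ => Complex.exp (Complex.I * omega w x) * U w * v (x + q • w) := by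
  have h1 : Integrable fun w : ℝ × ℝ => Complex.exp (Complex.I * omega w x) * U w :=
    hU.bdd_mul (c := 1) (Continuous.aestronglyMeasurable (by unfold omega; fun_prop))
      (Filter.Eventually.of_forall fun x => (norm_exp_I_mul_ofReal _).le)
  exact h1.mul_bdd (c := M) (Continuous.aestronglyMeasurable (by fun_prop))
    (Filter.Eventually.of_forall fun w => hv _)

/-- The functions on the plane to which the Weyl calculus is applied. -/
structure WeylAdmissible (u : ℝ × ℝ → ℂ) : Prop where
  continuous : Continuous u
  integrable : Integrable u
  bounded : ∃ C, ∀ x, ‖u x‖ ≤ C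
  integrable_fourier : Integrable (symplFourier u)
  bounded_fourier : ∃ C, ∀ x, ‖symplFourier u x‖ ≤ C

theorem weylAdmissible_realRestrict (hA₁ : A.1 ∈ Set.Ioo (0 : ℝ) 1)
    (hA₂ : A.2 ∈ Set.Ioo (0 : ℝ) 1) {f : ℂ × ℂ → ℂ} (hf : f ∈ spaceS A) :
    WeylAdmissible (realRestrict f) := by
  have hp₁ := (holderConjugate_one_div hA₁).pos
  have hp₂ := (holderConjugate_one_div hA₂).pos
  have h1 := rapidDecay_realRestrict hA₁ hA₂ hf
  have h2 := rapidDecay_symplFourier hA₁ hA₂ hf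
  exact ⟨h1.1, h1.integrable hp₁ hp₂, h1.exists_bound, h2.integrable hp₁ hp₂, h2.exists_bound⟩

variable {q : ℝ} {u u' v v' w : ℝ × ℝ → ℂ}

theorem WeylAdmissible.weyl_eq (hu : WeylAdmissible u) (hv : WeylAdmissible v) (x : ℝ × ℝ) :
    weyl q u v x = (2 * Real.pi) ^ 2 *
      ∫ w : ℝ × ℝ, Complex.exp (Complex.I * omega w x) * symplFourier u w * v (x + q • w) :=
  weyl_eq_integral q hu.integrable_fourier hv.continuous hv.integrable hv.integrable_fourier x

theorem WeylAdmissible.add (hu : WeylAdmissible u) (hv : WeylAdmissible v) :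
    WeylAdmissible (u + v) := by
  obtain ⟨C, hC⟩ := hu.bounded
  obtain ⟨C', hC'⟩ := hv.bounded
  obtain ⟨D, hD⟩ := hu.bounded_fourier
  obtain ⟨D', hD'⟩ := hv.bounded_fourier
  have e := symplFourier_add hu.integrable hv.integrable
  exact ⟨hu.continuous.add hv.continuous, hu.integrable.add hv.integrable,
    ⟨C + C', fun x => (norm_add_le _ _).trans (add_le_add (hC x) (hC' x))⟩,
    by rw [e]; exact hu.integrable_fourier.add hv.integrable_fourier,
    ⟨D + D', fun x => by
      rw [e]; exact (norm_add_le _ _).trans (add_le_add (hD x) (hD' x))⟩⟩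

/-- The single-integral formula makes additivity a matter of one absolutely convergent integral. -/
theorem WeylAdmissible.weyl_add_left (hu : WeylAdmissible u) (hu' : WeylAdmissible u')
    (hv : WeylAdmissible v) : weyl q (u + u') v = weyl q u v + weyl q u' v := by
  obtain ⟨M, hM⟩ := hv.bounded
  funext x
  rw [Pi.add_apply, (hu.add hu').weyl_eq hv, hu.weyl_eq hv, hu'.weyl_eq hv, ← mul_add,
    ← integral_add (integrable_weyl_integrand hu.integrable_fourier hv.continuous hM x)
      (integrable_weyl_integrand hu'.integrable_fourier hv.continuous hM x),
    symplFourier_add hu.integrable hu'.integrable]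
  simp only [Pi.add_apply, mul_add, add_mul]

theorem WeylAdmissible.weyl_add_right (hu : WeylAdmissible u) (hv : WeylAdmissible v)
    (hv' : WeylAdmissible v') : weyl q u (v + v') = weyl q u v + weyl q u v' := by
  obtain ⟨M, hM⟩ := hv.bounded
  obtain ⟨M', hM'⟩ := hv'.bounded
  funext x
  rw [Pi.add_apply, hu.weyl_eq (hv.add hv'), hu.weyl_eq hv, hu.weyl_eq hv', ← mul_add,
    ← integral_add (integrable_weyl_integrand hu.integrable_fourier hv.continuous hM x)
      (integrable_weyl_integrand hu.integrable_fourier hv'.continuous hM' x)]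
  simp only [Pi.add_apply, mul_add]

theorem twistedConv_smul_left (c : ℂ) (U V : ℝ × ℝ → ℂ) :
    twistedConv q (c • U) V = c • twistedConv q U V := by
  funext x
  simp only [twistedConv, Pi.smul_apply, smul_eq_mul]
  rw [← integral_const_mul]
  congr with x
  ring

theorem twistedConv_smul_right (c : ℂ) (U V : ℝ × ℝ → ℂ) :
    twistedConv q U (c • V) = c • twistedConv q U V := by
  funext x
  simp only [twistedConv, Pi.smul_apply, smul_eq_mul]
  rw [← integral_const_mul]
  congr with x
  ring

theorem weyl_smul_left (c : ℂ) : weyl q (c • u) v = c • weyl q u v := by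
  rw [weyl, symplFourier_smul, twistedConv_smul_left, symplFourier_smul, weyl]

theorem weyl_smul_right (c : ℂ) : weyl q u (c • v) = c • weyl q u v := by
  rw [weyl, symplFourier_smul, twistedConv_smul_right, symplFourier_smul, weyl]

theorem WeylAdmissible.symplFourier_weyl (hu : WeylAdmissible u) (hv : WeylAdmissible v)
    (huv : WeylAdmissible (weyl q u v)) : symplFourier (weyl q u v) =
      ((2 * Real.pi) ^ 2 : ℂ) • twistedConv q (symplFourier u) (symplFourier v) := by
  obtain ⟨M, hM⟩ := hv.bounded_fourier
  funext x
  exact symplFourier_symplFourier (continuous_twistedConv (continuous_symplFourier hu.integrable)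
    hu.integrable_fourier (continuous_symplFourier hv.integrable) hM)
    (integrable_twistedConv hu.integrable_fourier hv.integrable_fourier) huv.integrable x

/-- By inversion, `symplFourier` of a Weyl product is `(2π)²` times a twisted convolution. The same
factor appears on both sides, and `twistedConv_assoc` concludes. -/
theorem WeylAdmissible.weyl_assoc (hu : WeylAdmissible u) (hv : WeylAdmissible v)
    (hw : WeylAdmissible w) (huv : WeylAdmissible (weyl q u v))
    (hvw : WeylAdmissible (weyl q v w)) :
    weyl q (weyl q u v) w = weyl q u (weyl q v w) := by
  obtain ⟨M, hM⟩ := hw.bounded_fourier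
  change symplFourier (twistedConv q (symplFourier (weyl q u v)) (symplFourier w)) =
    symplFourier (twistedConv q (symplFourier u) (symplFourier (weyl q v w)))
  rw [hu.symplFourier_weyl hv huv, hv.symplFourier_weyl hw hvw,
    twistedConv_smul_left, twistedConv_smul_right,
    twistedConv_assoc hu.integrable_fourier hv.integrable_fourier
      (continuous_symplFourier hw.integrable) hM]

end Algebra

/-! ### The sine on its strip, and the twisting map and its inverse. -/

section Sine

theorem sin_injOn_strip : Set.InjOn Complex.sin {z : ℂ | |z.re| < Real.pi / 2} := by
  intro z hz w hw h
  rw [Set.mem_ofPred_eq, abs_lt] at hz hw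
  obtain ⟨k, hk | hk⟩ := Complex.sin_eq_sin_iff.1 h
  · have hre := congrArg Complex.re hk
    simp at hre
    have h1 : ((k : ℝ)) * 2 < 2 := by nlinarith [Real.pi_pos]
    have h2 : -2 < ((k : ℝ)) * 2 := by nlinarith [Real.pi_pos]
    have : k = 0 := by
      have h3 : k < 1 := by exact_mod_cast (by linarith : (k : ℝ) < 1)
      have h4 : -1 < k := by exact_mod_cast (by linarith : (-1 : ℝ) < k)
      omega
    rw [hk, this]; simp
  · exfalso
    have hre := congrArg Complex.re hk
    simp at hre
    have h1 : 2 * (k : ℝ) + 1 < 1 := by nlinarith [Real.pi_pos]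
    have h2 : -1 < 2 * (k : ℝ) + 1 := by nlinarith [Real.pi_pos]
    have h3 : k < 0 := by exact_mod_cast (by linarith : (k : ℝ) < 0)
    have h4 : -1 < k := by exact_mod_cast (by linarith : (-1 : ℝ) < k)
    omega

/-- The open strip covers the plane cut along the real rays `|v| ≥ 1`. Periodicity and the
reflection `z ↦ π - z` move any preimage into the closed strip, and the boundary lines `Re z = ±π/2`
only reach the real values `±cosh(Im z)`, which lie on the cuts. -/
theorem exists_sin_eq {v : ℂ} (hv : v.im = 0 → |v.re| < 1) :
    ∃ z : ℂ, |z.re| < Real.pi / 2 ∧ Complex.sin z = v := by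
  obtain ⟨z₀, hz₀⟩ := Complex.sin_surjective v
  have hpi := Real.pi_pos
  -- reduce the real part modulo the full period
  obtain ⟨z₁, hz₁, h1a, h1b⟩ : ∃ z : ℂ, Complex.sin z = v ∧ -(Real.pi / 2) ≤ z.re ∧
      z.re < 3 * Real.pi / 2 := by
    obtain ⟨n, hn, -⟩ := existsUnique_add_zsmul_mem_Ico (show (0 : ℝ) < 2 * Real.pi by positivity)
      z₀.re (-(Real.pi / 2))
    refine ⟨z₀ + n * (2 * Real.pi), ?_, ?_, ?_⟩
    · rw [Complex.sin_add_int_mul_two_pi, hz₀]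
    · have := hn.1
      simpa using this
    · have := hn.2
      have h : z₀.re + n * (2 * Real.pi) < -(Real.pi / 2) + 2 * Real.pi := by simpa using this
      simp
      linarith
  obtain ⟨z₂, hz₂, h2a, h2b⟩ : ∃ z : ℂ, Complex.sin z = v ∧ -(Real.pi / 2) ≤ z.re ∧
      z.re ≤ Real.pi / 2 := by
    rcases le_total z₁.re (Real.pi / 2) with h | h
    · exact ⟨z₁, hz₁, h1a, h⟩
    · refine ⟨Real.pi - z₁, by rw [Complex.sin_pi_sub, hz₁], ?_, ?_⟩ <;> simp <;> linarith
  refine ⟨z₂, ?_, hz₂⟩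
  have hform : v = Complex.sin z₂.re * Complex.cosh z₂.im +
      Complex.cos z₂.re * Complex.sinh z₂.im * Complex.I := by
    rw [← hz₂, ← Complex.sin_eq]
  have hform' : v = ((Real.sin z₂.re * Real.cosh z₂.im : ℝ) : ℂ) +
      ((Real.cos z₂.re * Real.sinh z₂.im : ℝ) : ℂ) * Complex.I := by
    rw [hform]; push_cast; rfl
  have hre : v.re = Real.sin z₂.re * Real.cosh z₂.im := by
    rw [hform']
    simp only [Complex.add_re, Complex.ofReal_re, Complex.re_ofReal_mul, Complex.I_re, mul_zero,
      add_zero]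
  have him : v.im = Real.cos z₂.re * Real.sinh z₂.im := by
    rw [hform']
    simp only [Complex.add_im, Complex.ofReal_im, Complex.im_ofReal_mul, Complex.I_im, mul_one,
      zero_add]
  rw [abs_lt]
  constructor
  · refine lt_of_le_of_ne h2a fun h => ?_
    rw [← h] at hre him
    simp at him hre
    have := hv him
    rw [hre, abs_neg, abs_of_pos (Real.cosh_pos _)] at this
    linarith [Real.one_le_cosh z₂.im]
  · refine lt_of_le_of_ne h2b fun h => ?_
    rw [h] at hre him
    simp at him hre
    have := hv him
    rw [hre, abs_of_pos (Real.cosh_pos _)] at this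
    linarith [Real.one_le_cosh z₂.im]

theorem norm_sin_le_exp (z : ℂ) : ‖Complex.sin z‖ ≤ Real.exp |z.im| := by
  rw [Complex.sin, norm_div, norm_mul, Complex.norm_I, mul_one]
  have h1 : ‖Complex.exp (-z * Complex.I)‖ ≤ Real.exp |z.im| := by
    rw [Complex.norm_exp]; simpa using le_abs_self _
  have h2 : ‖Complex.exp (z * Complex.I)‖ ≤ Real.exp |z.im| := by
    rw [Complex.norm_exp]; simpa using neg_le_abs _
  have h3 := norm_sub_le (Complex.exp (-z * Complex.I)) (Complex.exp (z * Complex.I))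
  rw [Complex.norm_ofNat]
  linarith

end Sine

section TwistMap

variable {q : ℝ} {k : Fin 2} {Γ : Set ℝ}

theorem twistMap_eq_sin (q : ℝ) (k : Fin 2) (z : ℂ) :
    twistMap q k z =
      Complex.exp (Complex.I * ((k : ℕ) * Real.pi / 2)) * Complex.I / q * Complex.sin (q * z) := by
  rw [twistMap, show Complex.I * q * z = (q * z) * Complex.I by ring, Complex.sinh_mul_I]
  ring

theorem mem_strip_iff (hq : q ≠ 0) {z : ℂ} : z ∈ strip q ↔ |((q : ℂ) * z).re| < Real.pi / 2 := by
  have : 0 < |q| := abs_pos.2 hq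
  rw [strip, Set.mem_ofPred_eq, lt_div_iff₀ (by positivity), Complex.re_ofReal_mul, abs_mul]
  constructor <;> intro h <;> linarith

theorem twist_factor_ne_zero (hq : q ≠ 0) :
    Complex.exp (Complex.I * ((k : ℕ) * Real.pi / 2)) * Complex.I / q ≠ 0 :=
  div_ne_zero (mul_ne_zero (Complex.exp_ne_zero _) Complex.I_ne_zero) (by exact_mod_cast hq)

theorem twistMap_injOn (hq : q ≠ 0) : Set.InjOn (twistMap q k) (strip q) := by
  intro z hz w hw h
  rw [twistMap_eq_sin, twistMap_eq_sin] at h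
  have := sin_injOn_strip ((mem_strip_iff hq).1 hz) ((mem_strip_iff hq).1 hw)
    (mul_left_cancel₀ (twist_factor_ne_zero hq) h)
  exact mul_left_cancel₀ (by exact_mod_cast hq) this

/-- After division by the constant factor the sine must take the value `-i q w` if `k = 0`, which is
not real because `Re w ≠ 0`, or `-q w` if `k = 1`, whose real part has modulus less than one. Either
way the cuts are avoided; this is what determines `Γ`. -/
theorem exists_twistMap_eq (hq : q ≠ 0) (hΓ : IsLaplaceInterval q k Γ) {w : ℂ} (hw : w.re ∈ Γ) :
    ∃ z ∈ strip q, twistMap q k z = w := by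
  have hqc : (q : ℂ) ≠ 0 := by exact_mod_cast hq
  have hu := twist_factor_ne_zero (k := k) hq
  set u := Complex.exp (Complex.I * ((k : ℕ) * Real.pi / 2)) * Complex.I / q with hudef
  obtain ⟨ζ, hζ, hs⟩ : ∃ ζ : ℂ, |ζ.re| < Real.pi / 2 ∧ Complex.sin ζ = w / u := by
    apply exists_sin_eq
    rcases hΓ with ⟨rfl, hΓ⟩ | ⟨rfl, rfl⟩
    · have : w / u = (q * w.im : ℝ) + (-(q * w.re) : ℝ) * Complex.I := by
        rw [hudef, div_eq_iff hu, hudef]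
        nth_rw 1 [← Complex.re_add_im w]
        simp
        field_simp
        ring_nf
        simp
        linear_combination -Complex.re_add_im w
      rw [this]
      intro h
      exfalso
      have hwre : w.re ≠ 0 := by
        rcases hΓ with rfl | rfl
        · exact ne_of_gt hw
        · exact ne_of_lt hw
      simp [hq, hwre] at h
    · have : w / u = -((q : ℂ) * w) := by
        rw [hudef, div_eq_iff hu, hudef]
        have : Complex.exp (Complex.I * (((1 : Fin 2) : ℕ) * Real.pi / 2)) = Complex.I := by
          rw [← Complex.exp_pi_div_two_mul_I]
          congr 1
          simp
          ring
        rw [this, Complex.I_mul_I]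
        field_simp
      rw [this]
      intro _
      have hq' : 0 < |q| := abs_pos.2 hq
      rw [Complex.neg_re, abs_neg, Complex.re_ofReal_mul, abs_mul]
      have := abs_lt.2 hw
      rwa [lt_div_iff₀ hq', mul_comm] at this
  refine ⟨ζ / q, ?_, ?_⟩
  · rw [mem_strip_iff hq, mul_div_cancel₀ _ hqc]
    exact hζ
  · rw [twistMap_eq_sin, mul_div_cancel₀ _ hqc, hs, ← hudef, mul_div_cancel₀ _ hu]

theorem twistMapInv_mem (hq : q ≠ 0) (hΓ : IsLaplaceInterval q k Γ) {w : ℂ} (hw : w.re ∈ Γ) :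
    twistMapInv q k w ∈ strip q := Function.invFunOn_mem (exists_twistMap_eq hq hΓ hw)

theorem twistMap_twistMapInv (hq : q ≠ 0) (hΓ : IsLaplaceInterval q k Γ) {w : ℂ}
    (hw : w.re ∈ Γ) : twistMap q k (twistMapInv q k w) = w :=
  Function.invFunOn_eq (exists_twistMap_eq hq hΓ hw)

theorem twistMapInv_twistMap (hq : q ≠ 0) {z : ℂ} (hz : z ∈ strip q) :
    twistMapInv q k (twistMap q k z) = z :=
  (twistMap_injOn hq).leftInvOn_invFunOn hz

theorem isOpen_strip (q : ℝ) : IsOpen (strip q) :=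
  isOpen_lt (by fun_prop) continuous_const

theorem differentiable_twistMap : Differentiable ℂ (twistMap q k) := by
  unfold twistMap
  fun_prop

theorem hasStrictDerivAt_twistMap (hq : q ≠ 0) {z : ℂ} (hz : z ∈ strip q) :
    ∃ d : ℂ, d ≠ 0 ∧ HasStrictDerivAt (twistMap q k) d z := by
  have hqc : (q : ℂ) ≠ 0 := by exact_mod_cast hq
  refine ⟨Complex.exp (Complex.I * ((k : ℕ) * Real.pi / 2)) * Complex.I / q *
    (Complex.cos (q * z) * q), ?_, ?_⟩
  · refine mul_ne_zero (twist_factor_ne_zero hq) (mul_ne_zero (fun h => ?_) hqc)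
    obtain ⟨n, hn⟩ := Complex.cos_eq_zero_iff.1 h
    have h1 := (mem_strip_iff hq).1 hz
    rw [hn, abs_lt] at h1
    simp at h1
    have h2 : 2 * (n : ℝ) + 1 < 1 := by nlinarith [Real.pi_pos, h1.2]
    have h3 : -1 < 2 * (n : ℝ) + 1 := by nlinarith [Real.pi_pos, h1.1]
    have h4 : n < 0 := by exact_mod_cast (by linarith : (n : ℝ) < 0)
    have h5 : -1 < n := by exact_mod_cast (by linarith : (-1 : ℝ) < n)
    omega
  · have h1 : HasStrictDerivAt (fun z : ℂ => (q : ℂ) * z) q z := by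
      simpa using (hasStrictDerivAt_id z).const_mul (q : ℂ)
    have := ((Complex.hasStrictDerivAt_sin (q * z)).comp z h1).const_mul
      (Complex.exp (Complex.I * ((k : ℕ) * Real.pi / 2)) * Complex.I / q)
    rw [show twistMap q k = fun z => _ from funext (twistMap_eq_sin q k)]
    exact this

-- Near a point of the domain, the local inverse of `twistMap` stays in the strip, so injectivity
-- there identifies it with the chosen global inverse.
open Filter Topology in
theorem differentiableAt_twistMapInv (hq : q ≠ 0) (hΓ : IsLaplaceInterval q k Γ) {w : ℂ}
    (hw : w.re ∈ Γ) : DifferentiableAt ℂ (twistMapInv q k) w := by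
  have hz := twistMapInv_mem hq hΓ hw
  have hzw := twistMap_twistMapInv hq hΓ hw
  set z := twistMapInv q k w with hzdef
  obtain ⟨d, hd, hs⟩ := hasStrictDerivAt_twistMap (k := k) hq hz
  have hg := hs.to_localInverse hd
  have hr := (hs.hasStrictFDerivAt_equiv hd).eventually_right_inverse
  have hgz : (hs.localInverse (twistMap q k) d z hd) (twistMap q k z) = z :=
    (hs.hasStrictFDerivAt_equiv hd).localInverse_apply_image
  have hc := hg.hasDerivAt.continuousAt
  have hev : ∀ᶠ y in 𝓝 (twistMap q k z), hs.localInverse (twistMap q k) d z hd y ∈ strip q := by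
    refine hc.eventually_mem ?_
    rw [hgz]
    exact (isOpen_strip q).mem_nhds hz
  have heq : twistMapInv q k =ᶠ[𝓝 (twistMap q k z)] hs.localInverse (twistMap q k) d z hd := by
    filter_upwards [hev, hr] with y hy hy'
    have h := twistMapInv_twistMap (k := k) hq hy
    have hy'' : twistMap q k (hs.localInverse (twistMap q k) d z hd y) = y := hy'
    rwa [hy''] at h
  rw [hzw] at heq
  rw [hzw] at hg
  exact (hg.hasDerivAt.congr_of_eventuallyEq heq).differentiableAt

/-- The inverse leaves to infinity at least logarithmically in the imaginary direction; this
converts decay in `Im z` into decay in `w`. -/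
theorem norm_le_exp_im_twistMapInv (hq : q ≠ 0) (hΓ : IsLaplaceInterval q k Γ) {w : ℂ}
    (hw : w.re ∈ Γ) : |q| * ‖w‖ ≤ Real.exp (|q| * |(twistMapInv q k w).im|) := by
  have h := twistMap_twistMapInv hq hΓ hw
  have hn : ‖Complex.exp (Complex.I * ((k : ℕ) * Real.pi / 2))‖ = 1 := by
    have := norm_exp_I_mul_ofReal ((k : ℕ) * Real.pi / 2)
    push_cast at this
    exact this
  rw [twistMap_eq_sin] at h
  have hq' : 0 < |q| := abs_pos.2 hq
  have h1 := norm_sin_le_exp (q * twistMapInv q k w)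
  rw [Complex.im_ofReal_mul, abs_mul] at h1
  refine le_trans (le_of_eq ?_) h1
  rw [← congrArg norm h, norm_mul, norm_div, norm_mul, hn, Complex.norm_I, Complex.norm_real,
    Real.norm_eq_abs]
  field_simp

theorem IsLaplaceInterval.isOpen (hΓ : IsLaplaceInterval q k Γ) : IsOpen Γ := by
  rcases hΓ with ⟨-, rfl | rfl⟩ | ⟨-, rfl⟩
  exacts [isOpen_Ioi, isOpen_Iio, isOpen_Ioo]

theorem IsLaplaceInterval.ordConnected (hΓ : IsLaplaceInterval q k Γ) : Γ.OrdConnected := by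
  rcases hΓ with ⟨-, rfl | rfl⟩ | ⟨-, rfl⟩
  exacts [Set.ordConnected_Ioi, Set.ordConnected_Iio, Set.ordConnected_Ioo]

end TwistMap

/-! ### Inverse Laplace integrals of functions decaying on a vertical strip. -/

section VerticalLines

/-- Functions holomorphic on a vertical strip, with rapid decay there. -/
structure VerticalDecay (Γ : Set ℝ) (H : ℂ → ℂ) : Prop where
  differentiableAt : ∀ w : ℂ, w.re ∈ Γ → DifferentiableAt ℂ H w
  decay : ∀ N : ℕ, ∃ M, ∀ w : ℂ, w.re ∈ Γ → ‖H w‖ * (1 + ‖w‖) ^ N ≤ M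

variable {Γ : Set ℝ} {H : ℂ → ℂ}

theorem VerticalDecay.exists_bound (h : VerticalDecay Γ H) :
    ∃ M, ∀ w : ℂ, w.re ∈ Γ → ‖H w‖ ≤ M * (1 + w.im ^ 2)⁻¹ := by
  obtain ⟨M, hM⟩ := h.decay 2
  refine ⟨M, fun w hw => ?_⟩
  have h1 : (0 : ℝ) < 1 + w.im ^ 2 := by positivity
  rw [← div_eq_mul_inv, le_div_iff₀ h1]
  refine le_trans ?_ (hM w hw)
  gcongr
  have h2 := Complex.abs_im_le_norm w
  have h3 : w.im ^ 2 ≤ ‖w‖ ^ 2 := by rw [← sq_abs]; gcongr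
  nlinarith [norm_nonneg w]

theorem VerticalDecay.continuous (h : VerticalDecay Γ H) {c : ℝ} (hc : c ∈ Γ) :
    Continuous fun t : ℝ => H (c + t * Complex.I) := by
  refine continuous_iff_continuousAt.2 fun t => ?_
  exact ContinuousAt.comp (g := H) (h.differentiableAt _ (by simpa using hc)).continuousAt
    (by fun_prop)

theorem VerticalDecay.integrable (h : VerticalDecay Γ H) {c : ℝ} (hc : c ∈ Γ) :
    Integrable fun t : ℝ => H (c + t * Complex.I) := by
  obtain ⟨M, hM⟩ := h.exists_bound
  refine (integrable_inv_one_add_sq.const_mul M).mono' (h.continuous hc).aestronglyMeasurable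
    (Filter.Eventually.of_forall fun t => ?_)
  simpa using hM (c + t * Complex.I) (by simpa using hc)

theorem norm_exp_vertical (c t x : ℝ) :
    ‖Complex.exp ((c + t * Complex.I) * x)‖ = Real.exp (c * x) := by
  simp [Complex.norm_exp]

theorem VerticalDecay.integrable_exp_mul (h : VerticalDecay Γ H) {c : ℝ} (hc : c ∈ Γ) (x : ℝ) :
    Integrable fun t : ℝ => Complex.exp ((c + t * Complex.I) * x) * H (c + t * Complex.I) :=
  (h.integrable hc).bdd_mul (c := Real.exp (c * x)) (Continuous.aestronglyMeasurable (by fun_prop))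
    (Filter.Eventually.of_forall fun t => (norm_exp_vertical c t x).le)

-- Cauchy's theorem between two vertical lines: writing points as `c + iζ`, the passage from `c` to
-- `c'` is a horizontal shift of `ζ` by the height `c - c'`.
open Filter Topology in
theorem VerticalDecay.laplaceInv_eq (h : VerticalDecay Γ H) (hΓ : Γ.OrdConnected) {c c' : ℝ}
    (hc : c ∈ Γ) (hc' : c' ∈ Γ) : laplaceInv c' H = laplaceInv c H := by
  funext x
  obtain ⟨M, hM⟩ := h.exists_bound
  have hre : ∀ y ∈ Set.uIcc 0 (c - c'), c - y ∈ Set.uIcc c c' := by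
    intro y hy
    rw [Set.mem_uIcc] at hy ⊢
    rcases hy with hy | hy
    · right; constructor <;> linarith [hy.1, hy.2]
    · left; constructor <;> linarith [hy.1, hy.2]
  have hmem : ∀ y ∈ Set.uIcc 0 (c - c'), c - y ∈ Γ := fun y hy =>
    hΓ.uIcc_subset hc hc' (hre y hy)
  have hshift := integral_horizontal_shift (η := c - c')
    (F := fun ζ : ℂ => Complex.exp ((c + ζ * Complex.I) * x) * H (c + ζ * Complex.I))
    (g := fun t => Real.exp ((|c| + |c'|) * |x|) * M * (1 + t ^ 2)⁻¹) ?_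
    (integrable_inv_one_add_sq.const_mul _) ?_ ?_
  · rw [laplaceInv, laplaceInv, ← hshift]
    congr 2
    funext t
    have : (c : ℂ) + (t + ((c - c' : ℝ) : ℂ) * Complex.I) * Complex.I = c' + t * Complex.I := by
      push_cast
      linear_combination ((c : ℂ) - c') * Complex.I_mul_I
    rw [this]
  · intro ζ hζ
    have hd := h.differentiableAt (c + ζ * Complex.I) (by
      simpa [sub_eq_add_neg] using hmem _ hζ)
    refine DifferentiableAt.differentiableWithinAt ?_
    exact DifferentiableAt.mul (by fun_prop) (DifferentiableAt.comp (g := H) ζ hd (by fun_prop))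
  · have h1 : Tendsto (fun t : ℝ => (1 + t ^ 2)⁻¹) (cocompact ℝ) (𝓝 0) := by
      refine tendsto_inv_atTop_zero.comp (tendsto_atTop_add_const_left _ _ ?_)
      have := (tendsto_pow_atTop (α := ℝ) two_ne_zero).comp (tendsto_norm_cocompact_atTop (E := ℝ))
      refine this.congr fun t => ?_
      simp
    simpa using h1.const_mul (Real.exp ((|c| + |c'|) * |x|) * M)
  · intro t y hy
    have e : (c : ℂ) + (t + y * Complex.I) * Complex.I = ((c - y : ℝ) : ℂ) + t * Complex.I := by
      push_cast
      linear_combination (y : ℂ) * Complex.I_mul_I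
    simp only [e]
    rw [norm_mul, norm_exp_vertical, mul_assoc]
    have h1 := hM ((c - y : ℝ) + t * Complex.I) (by simpa using hmem y hy)
    have h2 : |c - y| ≤ |c| + |c'| := by
      have := hre y hy
      rw [Set.mem_uIcc] at this
      have a1 := neg_abs_le c
      have a2 := le_abs_self c
      have a3 := neg_abs_le c'
      have a4 := le_abs_self c'
      rw [abs_le]
      rcases this with h | h <;> constructor <;> linarith [h.1, h.2, abs_nonneg c, abs_nonneg c']
    refine mul_le_mul (Real.exp_le_exp.2 ?_) (by simpa using h1) (norm_nonneg _) (Real.exp_pos _).le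
    calc (c - y) * x ≤ |c - y| * |x| := by rw [← abs_mul]; exact le_abs_self _
      _ ≤ _ := by gcongr

/-- Used for two abscissas on either side of a given one, this gives exponential decay at both ends.
-/
theorem exists_norm_laplaceInv_le (H : ℂ → ℂ) (c : ℝ) :
    ∃ M, ∀ x, ‖laplaceInv c H x‖ ≤ M * Real.exp (c * x) := by
  refine ⟨‖(1 / (2 * Real.pi) : ℂ)‖ * ∫ t : ℝ, ‖H (c + t * Complex.I)‖, fun x => ?_⟩
  rw [laplaceInv, norm_mul, mul_assoc]
  gcongr
  refine (norm_integral_le_integral_norm _).trans (le_of_eq ?_)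
  simp only [norm_mul, norm_exp_vertical]
  rw [integral_const_mul, mul_comm]

theorem VerticalDecay.aestronglyMeasurable_laplaceInv (h : VerticalDecay Γ H) {c : ℝ}
    (hc : c ∈ Γ) : AEStronglyMeasurable (laplaceInv c H) := by
  have hcont := h.continuous hc
  have : Continuous fun p : ℝ × ℝ =>
      Complex.exp ((c + p.2 * Complex.I) * p.1) * H (c + p.2 * Complex.I) := by
    exact Continuous.mul (by fun_prop) (hcont.comp continuous_snd)
  exact (this.stronglyMeasurable.integral_prod_right'.const_mul _).aestronglyMeasurable

/-- The two-sided Laplace transform inverts `laplaceInv`, with absolute convergence. -/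
theorem VerticalDecay.laplace_laplaceInv (h : VerticalDecay Γ H) (hΓ : Γ.OrdConnected)
    (hΓo : IsOpen Γ) {c : ℝ} (hc : c ∈ Γ) {w : ℂ} (hw : w.re ∈ Γ) :
    Integrable (fun x : ℝ => Complex.exp (-w * x) * laplaceInv c H x) ∧
      laplace (laplaceInv c H) w = H w := by
  -- Since `Γ` is open, the lines `w.re ± ε/2` are admissible and give the same function. The larger
  -- abscissa controls `x ≤ 0` and the smaller one `x ≥ 0`, so the Laplace integrand is at most a
  -- multiple of `exp(-(ε/2)|x|)`.
  obtain ⟨ε, hε, hball⟩ := Metric.isOpen_iff.1 hΓo _ hw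
  have hp : w.re + ε / 2 ∈ Γ := hball (by
    rw [Metric.mem_ball, Real.dist_eq, add_sub_cancel_left, abs_of_pos] <;> linarith)
  have hm : w.re - ε / 2 ∈ Γ := hball (by
    rw [Metric.mem_ball, Real.dist_eq, sub_sub_cancel_left, abs_neg, abs_of_pos] <;> linarith)
  obtain ⟨M₁, hM₁⟩ := exists_norm_laplaceInv_le H (w.re + ε / 2)
  obtain ⟨M₂, hM₂⟩ := exists_norm_laplaceInv_le H (w.re - ε / 2)
  rw [h.laplaceInv_eq hΓ hw hp] at hM₁
  rw [h.laplaceInv_eq hΓ hw hm] at hM₂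
  have hi : ∀ s : ℂ, s.re = w.re →
      Integrable (fun x : ℝ => Complex.exp (-s * x) * laplaceInv w.re H x) := by
    intro s hs
    refine ((integrable_exp_neg_mul_abs_rpow (half_pos hε) one_pos).const_mul
      (max M₁ M₂)).mono' ((Continuous.aestronglyMeasurable (by fun_prop)).mul
        (h.aestronglyMeasurable_laplaceInv hw)) (Filter.Eventually.of_forall fun x => ?_)
    rw [norm_mul, norm_exp_neg_mul_ofReal, hs, Real.rpow_one]
    rcases le_total 0 x with hx | hx
    · calc _ ≤ Real.exp (-(w.re * x)) * (M₂ * Real.exp ((w.re - ε / 2) * x)) := by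
            gcongr; exact hM₂ x
        _ = M₂ * Real.exp (-(ε / 2 * |x|)) := by
            rw [mul_left_comm, ← Real.exp_add, abs_of_nonneg hx]; ring_nf
        _ ≤ _ := by gcongr; exact le_max_right _ _
    · calc _ ≤ Real.exp (-(w.re * x)) * (M₁ * Real.exp ((w.re + ε / 2) * x)) := by
            gcongr; exact hM₁ x
        _ = M₁ * Real.exp (-(ε / 2 * |x|)) := by
            rw [mul_left_comm, ← Real.exp_add, abs_of_nonpos hx]; ring_nf
        _ ≤ _ := by gcongr; exact le_max_left _ _
  rw [h.laplaceInv_eq hΓ hw hc]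
  refine ⟨hi w rfl, ?_⟩
  have := TwistedWeyl.laplace_laplaceInv (h.continuous hw) (h.integrable hw)
    (hi w.re (Complex.ofReal_re _)) w.im
  rwa [Complex.re_add_im] at this

end VerticalLines

/-! ### The map `τ`: convergence, independence of the line, inversion, injectivity. -/

/-- The kernel of `tau` on the vertical line, for the presentation `f̂` of an entire function. -/
noncomputable def tauKernel (q : ℝ) (k : Fin 2) (f : ℂ × ℂ → ℂ) (z₁ w : ℂ) : ℂ :=
  laplace (fun x => f (z₁, x)) (twistMapInv q k w)

theorem tau_hat_apply (q : ℝ) (k : Fin 2) (c : ℝ) (f : ℂ × ℂ → ℂ) (p : ℝ × ℝ) :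
    tau q k c (hat f) p = laplaceInv c (tauKernel q k f (Complex.I * p.1)) p.2 := rfl

section

variable {A : ℝ × ℝ} {q : ℝ} {k : Fin 2} {Γ : Set ℝ} {f g : ℂ × ℂ → ℂ}

/-- The constants depend on the frozen variable only through `R`; this uniformity is needed to
differentiate in `y₁`. -/
theorem exists_laplace_section_bound (hA₁ : A.1 ∈ Set.Ioo (0 : ℝ) 1)
    (hA₂ : A.2 ∈ Set.Ioo (0 : ℝ) 1) (hf : f ∈ spaceS A) (R : ℝ) :
    ∃ a > 0, ∃ b > 0, ∃ C > 0, ∀ z₁ : ℂ, ‖z₁‖ ≤ R → ∀ z : ℂ,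
      ‖laplace (fun x => f (z₁, x)) z‖ ≤
        C * Real.exp (b * |z.re| ^ (1 / (1 - A.2)) - a * |z.im| ^ (1 / A.1)) := by
  have hp₁ := holderConjugate_one_div hA₁
  have hp₂ := holderConjugate_one_div hA₂
  obtain ⟨hd, a₁, ha₁, a₂, ha₂, b₁, hb₁, b₂, hb₂, C, hC, h⟩ := mem_spaceS_iff.1 hf
  obtain ⟨a, ha, b, hb, K, hK, hL⟩ := exists_laplace_bound hp₂ hp₁.symm ha₂ hb₂
  refine ⟨a, ha, b, hb, C * Real.exp (b₁ * R ^ (1 / (1 - A.2))) * K, by positivity,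
    fun z₁ hz₁ z => ?_⟩
  refine (hL _ _ (hd.comp (by fun_prop)) (h.section z₁) z).trans ?_
  have h1 : |z₁.im| ≤ R := (Complex.abs_im_le_norm z₁).trans hz₁
  have h2 := hp₂.symm.pos
  have h3 : -(a₁ * |z₁.re| ^ (1 / A.1)) + b₁ * |z₁.im| ^ (1 / (1 - A.2)) ≤
      b₁ * R ^ (1 / (1 - A.2)) := by
    have h4 : b₁ * |z₁.im| ^ (1 / (1 - A.2)) ≤ b₁ * R ^ (1 / (1 - A.2)) := by gcongr
    have h5 : 0 ≤ a₁ * |z₁.re| ^ (1 / A.1) := by positivity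
    linarith
  gcongr

theorem exists_section_bound (hA₁ : A.1 ∈ Set.Ioo (0 : ℝ) 1) (hf : f ∈ spaceS A) (z₁ : ℂ) :
    ∃ a > 0, ∃ C, ∀ x : ℝ, ‖f (z₁, x)‖ ≤ C * Real.exp (-(a * |x| ^ (1 / A.2))) := by
  have hp₁ := holderConjugate_one_div hA₁
  obtain ⟨hd, a₁, ha₁, a₂, ha₂, b₁, hb₁, b₂, hb₂, C, hC, h⟩ := mem_spaceS_iff.1 hf
  exact ⟨a₂, ha₂, _, (h.section z₁).ofReal hp₁.symm.pos⟩

theorem continuous_section (hf : f ∈ spaceS A) (z₁ : ℂ) : Continuous fun x : ℝ => f (z₁, x) :=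
  hf.1.continuous.comp (by fun_prop)

theorem differentiable_laplace_section (hA₁ : A.1 ∈ Set.Ioo (0 : ℝ) 1)
    (hA₂ : A.2 ∈ Set.Ioo (0 : ℝ) 1) (hf : f ∈ spaceS A) (z₁ : ℂ) :
    Differentiable ℂ (laplace fun x => f (z₁, x)) := by
  obtain ⟨a, ha, C, h⟩ := exists_section_bound hA₁ hf z₁
  exact differentiable_laplace (holderConjugate_one_div hA₂).lt ha
    (continuous_section hf z₁).aestronglyMeasurable h

theorem integrable_laplace_section (hA₁ : A.1 ∈ Set.Ioo (0 : ℝ) 1)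
    (hA₂ : A.2 ∈ Set.Ioo (0 : ℝ) 1) (hf : f ∈ spaceS A) (z₁ z : ℂ) :
    Integrable fun x : ℝ => Complex.exp (-z * x) * f (z₁, x) := by
  obtain ⟨a, ha, C, h⟩ := exists_section_bound hA₁ hf z₁
  exact integrable_laplace_integrand (holderConjugate_one_div hA₂).lt ha
    (continuous_section hf z₁).aestronglyMeasurable h z

/-- The kernel of `tau` decays rapidly on the vertical lines, locally uniformly in the
parameter. -/
theorem exists_tauKernel_bound (hA₁ : A.1 ∈ Set.Ioo (0 : ℝ) 1) (hA₂ : A.2 ∈ Set.Ioo (0 : ℝ) 1)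
    (hq : q ≠ 0) (hΓ : IsLaplaceInterval q k Γ) (hf : f ∈ spaceS A) (R : ℝ) (N : ℕ) :
    ∃ M, ∀ z₁ w : ℂ, ‖z₁‖ ≤ R → w.re ∈ Γ → ‖tauKernel q k f z₁ w‖ * (1 + ‖w‖) ^ N ≤ M := by
  have hp₁ := holderConjugate_one_div hA₁
  have hp₂ := holderConjugate_one_div hA₂
  obtain ⟨a, ha, b, hb, C, hC, h⟩ := exists_laplace_section_bound hA₁ hA₂ hf R
  have hq' : 0 < |q| := abs_pos.2 hq
  obtain ⟨K, hK, hY⟩ := exists_young_const hp₁ ha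
  -- With `z = φ⁻¹(w)`, `(1 + ‖w‖) ^ N` is at most a constant times `exp(B |Im z|)`. Since `1/A.1 >
  -- 1`, Young's inequality absorbs this into `exp(-a |Im z|^(1/A.1))`; `Re z` is bounded on the
  -- strip.
  set B := (N * |q|) with hB
  refine ⟨C * (1 + 1 / |q|) ^ N * Real.exp (b * (Real.pi / (2 * |q|)) ^ (1 / (1 - A.2)) +
    K * B ^ (1 / (1 - A.1))), fun z₁ w hz₁ hw => ?_⟩
  set z := twistMapInv q k w with hz
  have h1 : |z.re| ≤ Real.pi / (2 * |q|) := (twistMapInv_mem hq hΓ hw).le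
  have h2 := norm_le_exp_im_twistMapInv hq hΓ hw
  rw [← hz] at h2
  have h3 : 1 + ‖w‖ ≤ (1 + 1 / |q|) * Real.exp (|q| * |z.im|) := by
    have h4 : ‖w‖ ≤ 1 / |q| * Real.exp (|q| * |z.im|) := by
      rw [one_div, ← div_eq_inv_mul, le_div_iff₀ hq']
      linarith
    have h5 : 1 ≤ Real.exp (|q| * |z.im|) := Real.one_le_exp (by positivity)
    linarith
  have h4 : (1 + ‖w‖) ^ N ≤ (1 + 1 / |q|) ^ N * Real.exp (|z.im| * B) := by
    calc (1 + ‖w‖) ^ N ≤ ((1 + 1 / |q|) * Real.exp (|q| * |z.im|)) ^ N := by gcongr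
      _ = (1 + 1 / |q|) ^ N * Real.exp (|z.im| * B) := by
        rw [mul_pow, ← Real.exp_nat_mul, hB]; ring_nf
  have h5 := hY |z.im| B (abs_nonneg _) (by positivity)
  have h6 := hp₂.symm.pos
  calc ‖tauKernel q k f z₁ w‖ * (1 + ‖w‖) ^ N
      ≤ (C * Real.exp (b * |z.re| ^ (1 / (1 - A.2)) - a * |z.im| ^ (1 / A.1))) *
        ((1 + 1 / |q|) ^ N * Real.exp (|z.im| * B)) := by
        gcongr
        exact h z₁ hz₁ z
    _ = C * (1 + 1 / |q|) ^ N * Real.exp (b * |z.re| ^ (1 / (1 - A.2)) - a * |z.im| ^ (1 / A.1) +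
        |z.im| * B) := by rw [Real.exp_add]; ring
    _ ≤ _ := by
        have h7 : b * |z.re| ^ (1 / (1 - A.2)) ≤ b * (Real.pi / (2 * |q|)) ^ (1 / (1 - A.2)) := by
          gcongr
        refine mul_le_mul_of_nonneg_left (Real.exp_le_exp.2 ?_) (by positivity)
        linarith

theorem verticalDecay_tauKernel (hA₁ : A.1 ∈ Set.Ioo (0 : ℝ) 1) (hA₂ : A.2 ∈ Set.Ioo (0 : ℝ) 1)
    (hq : q ≠ 0) (hΓ : IsLaplaceInterval q k Γ) (hf : f ∈ spaceS A) (z₁ : ℂ) :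
    VerticalDecay Γ (tauKernel q k f z₁) where
  differentiableAt w hw := DifferentiableAt.comp w
    ((differentiable_laplace_section hA₁ hA₂ hf z₁) _) (differentiableAt_twistMapInv hq hΓ hw)
  decay N := by
    obtain ⟨M, hM⟩ := exists_tauKernel_bound hA₁ hA₂ hq hΓ hf ‖z₁‖ N
    exact ⟨M, fun w hw => hM z₁ w le_rfl hw⟩

theorem differentiable_tauKernel (hA₁ : A.1 ∈ Set.Ioo (0 : ℝ) 1) (hA₂ : A.2 ∈ Set.Ioo (0 : ℝ) 1)
    (hf : f ∈ spaceS A) (w : ℂ) : Differentiable ℂ fun z₁ => tauKernel q k f z₁ w := by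
  have hp₁ := holderConjugate_one_div hA₁
  have hp₂ := holderConjugate_one_div hA₂
  obtain ⟨hd, a₁, ha₁, a₂, ha₂, b₁, hb₁, b₂, hb₂, C, hC, h⟩ := mem_spaceS_iff.1 hf
  exact (h.differentiable_laplace hd hp₂.lt hp₂.symm.pos hp₁.symm.pos ha₁ hb₁ ha₂).comp
    (f := fun z : ℂ => (z, twistMapInv q k w)) (by fun_prop)

theorem tau_hat_eq_of_mem (hA₁ : A.1 ∈ Set.Ioo (0 : ℝ) 1) (hA₂ : A.2 ∈ Set.Ioo (0 : ℝ) 1)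
    (hq : q ≠ 0) (hΓ : IsLaplaceInterval q k Γ) {c c' : ℝ} (hc : c ∈ Γ) (hc' : c' ∈ Γ)
    (hf : f ∈ spaceS A) : tau q k c' (hat f) = tau q k c (hat f) := by
  funext p
  rw [tau_hat_apply, tau_hat_apply, (verticalDecay_tauKernel hA₁ hA₂ hq hΓ hf _).laplaceInv_eq
    hΓ.ordConnected hc hc']

/-- The Laplace transform of `tau ψ` is the composition of that of `ψ` with the inverse of the
twisting map. -/
theorem laplace_tau_hat (hA₁ : A.1 ∈ Set.Ioo (0 : ℝ) 1) (hA₂ : A.2 ∈ Set.Ioo (0 : ℝ) 1)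
    (hq : q ≠ 0) (hΓ : IsLaplaceInterval q k Γ) {c : ℝ} (hc : c ∈ Γ) (hf : f ∈ spaceS A)
    (y₁ : ℝ) {z : ℂ} (hz : z ∈ strip q) (hzΓ : (twistMap q k z).re ∈ Γ) :
    Integrable (fun x : ℝ => Complex.exp (-twistMap q k z * x) * tau q k c (hat f) (y₁, x)) ∧
      laplace (fun x => hat f (y₁, x)) z =
        laplace (fun x => tau q k c (hat f) (y₁, x)) (twistMap q k z) := by
  obtain ⟨h1, h2⟩ := (verticalDecay_tauKernel hA₁ hA₂ hq hΓ hf (Complex.I * y₁)).laplace_laplaceInv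
    hΓ.ordConnected hΓ.isOpen hc hzΓ
  refine ⟨h1, ?_⟩
  rw [tauKernel, twistMapInv_twistMap hq hz] at h2
  exact h2.symm

theorem integrable_laplace_vertical (hA₁ : A.1 ∈ Set.Ioo (0 : ℝ) 1)
    (hA₂ : A.2 ∈ Set.Ioo (0 : ℝ) 1) (hf : f ∈ spaceS A) (z₁ : ℂ) :
    Integrable fun t : ℝ => laplace (fun x => f (z₁, x)) (t * Complex.I) := by
  have hp₁ := holderConjugate_one_div hA₁
  have hp₂ := holderConjugate_one_div hA₂
  obtain ⟨a, ha, b, hb, C, hC, h⟩ := exists_laplace_section_bound hA₁ hA₂ hf ‖z₁‖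
  have hcont := (differentiable_laplace_section hA₁ hA₂ hf z₁).continuous
  refine ((integrable_exp_neg_mul_abs_rpow ha hp₁.pos).const_mul C).mono'
    (Continuous.aestronglyMeasurable (by fun_prop)) (Filter.Eventually.of_forall fun t => ?_)
  refine (h z₁ le_rfl (t * Complex.I)).trans (le_of_eq ?_)
  simp only [Complex.re_ofReal_mul, Complex.I_re, mul_zero, abs_zero,
    Real.zero_rpow hp₂.symm.ne_zero, Complex.im_ofReal_mul, Complex.I_im, mul_one, zero_sub]

-- Equal images under `τ` force equal Laplace transforms on the open set of strip points `z` with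
-- `Re φ(z) ∈ Γ`, which contains `φ⁻¹(c)`. These transforms are entire, so they agree everywhere, in
-- particular on the imaginary axis, where Fourier inversion recovers the functions.
open Filter Topology in
theorem hat_eq_of_tau_eq (hA₁ : A.1 ∈ Set.Ioo (0 : ℝ) 1) (hA₂ : A.2 ∈ Set.Ioo (0 : ℝ) 1)
    (hq : q ≠ 0) (hΓ : IsLaplaceInterval q k Γ) {c : ℝ} (hc : c ∈ Γ) (hf : f ∈ spaceS A)
    (hg : g ∈ spaceS A) (h : tau q k c (hat f) = tau q k c (hat g)) : hat f = hat g := by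
  have hcre : ((c : ℂ)).re ∈ Γ := hc
  have hz₀ := twistMapInv_mem hq hΓ hcre
  have hwz := twistMap_twistMapInv hq hΓ hcre
  have hL : ∀ y₁ : ℝ, (laplace fun x => hat f (y₁, x)) = laplace fun x => hat g (y₁, x) := by
    intro y₁
    refine AnalyticOnNhd.eq_of_eventuallyEq (z₀ := twistMapInv q k c)
      (fun z _ => (differentiable_laplace_section hA₁ hA₂ hf (Complex.I * y₁)).analyticAt z)
      (fun z _ => (differentiable_laplace_section hA₁ hA₂ hg (Complex.I * y₁)).analyticAt z) ?_
    have h2 : ∀ᶠ z in 𝓝 (twistMapInv q k c), (twistMap q k z).re ∈ Γ := by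
      have hcont : Continuous fun z => (twistMap q k z).re :=
        Complex.continuous_re.comp differentiable_twistMap.continuous
      refine hcont.continuousAt.eventually_mem (hΓ.isOpen.mem_nhds ?_)
      rw [hwz]
      exact hc
    filter_upwards [(isOpen_strip q).mem_nhds hz₀, h2] with z hz hzΓ
    rw [(laplace_tau_hat hA₁ hA₂ hq hΓ hc hf y₁ hz hzΓ).2,
      (laplace_tau_hat hA₁ hA₂ hq hΓ hc hg y₁ hz hzΓ).2, h]
  have hinv : ∀ {f : ℂ × ℂ → ℂ}, f ∈ spaceS A → ∀ y₁ x : ℝ,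
      hat f (y₁, x) = laplaceInv 0 (laplace fun x => hat f (y₁, x)) x := by
    intro f hf y₁ x
    refine laplace_inversion (u := fun x => hat f (y₁, x))
      (continuous_section hf (Complex.I * y₁)) ?_
      (integrable_laplace_vertical hA₁ hA₂ hf (Complex.I * y₁)) x
    simpa [hat] using integrable_laplace_section hA₁ hA₂ hf (Complex.I * y₁) 0
  funext p
  obtain ⟨y₁, x⟩ := p
  rw [hinv hf, hinv hg, hL]

/-- The one-variable identity theorem, used in one coordinate at a time. -/
theorem eq_of_forall_real {f g : ℂ × ℂ → ℂ} (hf : Differentiable ℂ f) (hg : Differentiable ℂ g)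
    (h : ∀ x y : ℝ, f (x, y) = g (x, y)) : f = g := by
  have h1 : ∀ (z : ℂ) (y : ℝ), f (z, y) = g (z, y) := fun z y =>
    congrFun (differentiable_eq_of_forall_ofReal (f := fun z => f (z, y)) (g := fun z => g (z, y))
      (hf.comp (by fun_prop)) (hg.comp (by fun_prop)) fun x => h x y) z
  funext p
  exact congrFun (differentiable_eq_of_forall_ofReal (f := fun z => f (p.1, z))
      (g := fun z => g (p.1, z)) (hf.comp (by fun_prop)) (hg.comp (by fun_prop)) (h1 p.1)) p.2

theorem realRestrict_injOn : Set.InjOn realRestrict (spaceS A) := fun _ hf _ hg h =>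
  eq_of_forall_real hf.1 hg.1 fun x y => congrFun h (x, y)

theorem hat_injOn : Set.InjOn hat (spaceS A) := fun f hf g hg h => by
  have := eq_of_forall_real (f := fun z => f (Complex.I * z.1, z.2))
    (g := fun z => g (Complex.I * z.1, z.2)) (hf.1.comp (by fun_prop)) (hg.1.comp (by fun_prop))
    fun x y => congrFun h (x, y)
  funext p
  have hp := congrFun this (-Complex.I * p.1, p.2)
  simpa [← mul_assoc] using hp

end

/-! ### Smoothness of `τ(ψ)`. -/

section SmoothKernel

/-- Kernels on a vertical line that depend holomorphically on a parameter and decay rapidly,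
locally uniformly in the parameter. -/
structure SmoothKernel (H : ℂ → ℝ → ℂ) : Prop where
  measurable : ∀ z, AEStronglyMeasurable (H z)
  differentiable : ∀ t, Differentiable ℂ fun z => H z t
  decay : ∀ (R : ℝ) (N : ℕ), ∃ M, ∀ (z : ℂ) (t : ℝ), ‖z‖ ≤ R → ‖H z t‖ * (1 + |t|) ^ N ≤ M

variable {H : ℂ → ℝ → ℂ}

/-- Differentiating `kernelIntegral` multiplies the kernel by `c + it` or differentiates it in the
parameter. Stability of the class under both (here and in `deriv_param`) is what makes an induction
on the order possible. -/
theorem SmoothKernel.mul_line (h : SmoothKernel H) (c : ℝ) :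
    SmoothKernel fun z t => (c + t * Complex.I) * H z t where
  measurable z := (Continuous.aestronglyMeasurable (by fun_prop)).mul (h.measurable z)
  differentiable t := (h.differentiable t).const_mul _
  decay R N := by
    obtain ⟨M, hM⟩ := h.decay R (N + 1)
    refine ⟨(|c| + 1) * M, fun z t hz => ?_⟩
    have h1 : ‖(c + t * Complex.I : ℂ)‖ ≤ (|c| + 1) * (1 + |t|) := by
      refine (norm_add_le _ _).trans ?_
      rw [norm_mul, Complex.norm_I, mul_one, Complex.norm_real, Complex.norm_real,
        Real.norm_eq_abs, Real.norm_eq_abs]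
      nlinarith [abs_nonneg c, abs_nonneg t, mul_nonneg (abs_nonneg c) (abs_nonneg t)]
    rw [norm_mul]
    calc ‖(c + t * Complex.I : ℂ)‖ * ‖H z t‖ * (1 + |t|) ^ N
        ≤ (|c| + 1) * (1 + |t|) * ‖H z t‖ * (1 + |t|) ^ N := by gcongr
      _ = (|c| + 1) * (‖H z t‖ * (1 + |t|) ^ (N + 1)) := by ring
      _ ≤ _ := by gcongr; exact hM z t hz

theorem norm_deriv_le_of_bound {f : ℂ → ℂ} (hf : Differentiable ℂ f) {R M : ℝ}
    (hM : ∀ z, ‖z‖ ≤ R + 1 → ‖f z‖ ≤ M) {z : ℂ} (hz : ‖z‖ ≤ R) : ‖deriv f z‖ ≤ M := by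
  have := Complex.norm_deriv_le_of_forall_mem_sphere_norm_le (c := z) one_pos (C := M)
    hf.diffContOnCl fun w hw => hM w (by
      have h1 := norm_sub_norm_le w z
      rw [mem_sphere_iff_norm] at hw
      linarith)
  simpa using this

open Filter Topology in
theorem SmoothKernel.deriv_param (h : SmoothKernel H) :
    SmoothKernel fun z t => deriv (fun z => H z t) z where
  measurable z := by
    refine aestronglyMeasurable_of_tendsto_ae (u := atTop)
      (f := fun (n : ℕ) t => ((n : ℂ)) • (H (z + ((n : ℂ))⁻¹ • 1) t - H z t))
      (fun n => by
        have h := ((h.measurable (z + ((n : ℂ))⁻¹ • 1)).sub (h.measurable z)).const_smul (n : ℂ)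
        exact h) (Eventually.of_forall fun t => ?_)
    have := ((h.differentiable t) z).hasFDerivAt.lim 1 (c := fun n : ℕ => (n : ℂ)) (by
      simpa using tendsto_natCast_atTop_atTop (R := ℝ))
    simpa using this
  differentiable t := by
    have := ((h.differentiable t).contDiff (n := 2)).differentiable_deriv_two
    exact this
  decay R N := by
    obtain ⟨M, hM⟩ := h.decay (R + 1) N
    refine ⟨M, fun z t hz => ?_⟩
    have hpos : (0 : ℝ) < (1 + |t|) ^ N := by positivity
    rw [← le_div_iff₀ hpos]
    refine norm_deriv_le_of_bound (h.differentiable t) (R := R) (fun z hz => ?_) hz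
    rw [le_div_iff₀ hpos]
    exact hM z t hz

/-- The inverse Laplace integral of a kernel. -/
noncomputable def kernelIntegral (c : ℝ) (H : ℂ → ℝ → ℂ) (p : ℝ × ℝ) : ℂ :=
  ∫ t : ℝ, Complex.exp ((c + t * Complex.I) * p.2) * H (Complex.I * p.1) t

theorem SmoothKernel.exists_bound (h : SmoothKernel H) (R : ℝ) :
    ∃ M, ∀ (z : ℂ) (t : ℝ), ‖z‖ ≤ R → ‖H z t‖ ≤ M * (1 + t ^ 2)⁻¹ := by
  obtain ⟨M, hM⟩ := h.decay R 2
  refine ⟨M, fun z t hz => ?_⟩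
  have h1 : (0 : ℝ) < 1 + t ^ 2 := by positivity
  rw [← div_eq_mul_inv, le_div_iff₀ h1]
  refine le_trans ?_ (hM z t hz)
  gcongr
  nlinarith [abs_nonneg t, sq_abs t]

/-- The derivative of `kernelIntegral`, as a continuous linear functional. -/
theorem SmoothKernel.hasFDerivAt (h : SmoothKernel H) (c : ℝ) (p : ℝ × ℝ) :
    HasFDerivAt (kernelIntegral c H)
      ((ContinuousLinearMap.fst ℝ ℝ ℝ).smulRight
          (kernelIntegral c (fun z t => Complex.I * deriv (fun z => H z t) z) p) +
        (ContinuousLinearMap.snd ℝ ℝ ℝ).smulRight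
          (kernelIntegral c (fun z t => (c + t * Complex.I) * H z t) p)) p := by
  have hd := h.deriv_param
  have hl := h.mul_line c
  obtain ⟨M₀, hM₀⟩ := h.exists_bound (‖p‖ + 1)
  obtain ⟨M₁, hM₁⟩ := hd.exists_bound (‖p‖ + 1)
  obtain ⟨M₂, hM₂⟩ := hl.exists_bound (‖p‖ + 1)
  set E := Real.exp (|c| * (‖p‖ + 1)) with hE
  have hexp : ∀ p' : ℝ × ℝ, ‖p'‖ ≤ ‖p‖ + 1 → ∀ t : ℝ,
      ‖Complex.exp ((c + t * Complex.I) * p'.2)‖ ≤ E := by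
    intro p' hp' t
    rw [norm_exp_vertical, hE]
    refine Real.exp_le_exp.2 ?_
    calc c * p'.2 ≤ |c| * |p'.2| := by rw [← abs_mul]; exact le_abs_self _
      _ ≤ _ := by gcongr; exact (norm_snd_le p').trans hp'
  have hI1 : ∀ p' : ℝ × ℝ, ‖p'‖ ≤ ‖p‖ + 1 → ‖Complex.I * p'.1‖ ≤ ‖p‖ + 1 := by
    intro p' hp'
    rw [norm_mul, Complex.norm_I, one_mul, Complex.norm_real]
    exact (norm_fst_le p').trans hp'
  have hint : ∀ {G : ℂ → ℝ → ℂ} {M : ℝ}, (∀ z, AEStronglyMeasurable (G z)) →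
      (∀ (z : ℂ) (t : ℝ), ‖z‖ ≤ ‖p‖ + 1 → ‖G z t‖ ≤ M * (1 + t ^ 2)⁻¹) →
      Integrable fun t : ℝ => Complex.exp ((c + t * Complex.I) * p.2) * G (Complex.I * p.1) t := by
    intro G M hm hG
    have h1 : Integrable (G (Complex.I * p.1)) :=
      (integrable_inv_one_add_sq.const_mul M).mono' (hm _) (Filter.Eventually.of_forall fun t =>
        hG _ t (hI1 p (by linarith)))
    exact h1.bdd_mul (c := E) (Continuous.aestronglyMeasurable (by fun_prop))
      (Filter.Eventually.of_forall fun t => hexp p (by linarith) t)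
  have i1 := (hint hd.measurable hM₁).const_mul Complex.I
  have i2 := hint hl.measurable hM₂
  set F' : ℝ × ℝ → ℝ → (ℝ × ℝ →L[ℝ] ℂ) := fun p t =>
    (ContinuousLinearMap.fst ℝ ℝ ℝ).smulRight (Complex.I * (Complex.exp ((c + t * Complex.I) * p.2) *
      deriv (fun z => H z t) (Complex.I * p.1))) +
    (ContinuousLinearMap.snd ℝ ℝ ℝ).smulRight (Complex.exp ((c + t * Complex.I) * p.2) *
      ((c + t * Complex.I) * H (Complex.I * p.1) t)) with hF'
  have j1 := (ContinuousLinearMap.smulRightL ℝ (ℝ × ℝ) ℂ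
    (ContinuousLinearMap.fst ℝ ℝ ℝ)).integrable_comp i1
  have j2 := (ContinuousLinearMap.smulRightL ℝ (ℝ × ℝ) ℂ
    (ContinuousLinearMap.snd ℝ ℝ ℝ)).integrable_comp i2
  have key := hasFDerivAt_integral_of_dominated_of_fderiv_le (𝕜 := ℝ) (μ := volume)
    (F := fun (p : ℝ × ℝ) (t : ℝ) => Complex.exp ((c + t * Complex.I) * p.2) * H (Complex.I * p.1) t)
    (F' := F') (x₀ := p) (s := Metric.ball p 1)
    (bound := fun t => ‖ContinuousLinearMap.fst ℝ ℝ ℝ‖ * (E * M₁ * (1 + t ^ 2)⁻¹) +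
      ‖ContinuousLinearMap.snd ℝ ℝ ℝ‖ * (E * M₂ * (1 + t ^ 2)⁻¹)) (Metric.ball_mem_nhds p one_pos)
    (Filter.Eventually.of_forall fun p' =>
      (Continuous.aestronglyMeasurable (by fun_prop)).mul (h.measurable _))
    (hint h.measurable hM₀) (j1.add j2).aestronglyMeasurable
    (Filter.Eventually.of_forall fun t p' hp' => ?_)
    (((integrable_inv_one_add_sq.const_mul _).const_mul _).add
      ((integrable_inv_one_add_sq.const_mul _).const_mul _))
    (Filter.Eventually.of_forall fun t p' _ => ?_)
  · refine key.congr_fderiv ?_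
    simp only [hF']
    change ∫ t : ℝ, ContinuousLinearMap.smulRightL ℝ (ℝ × ℝ) ℂ (ContinuousLinearMap.fst ℝ ℝ ℝ) _ +
      ContinuousLinearMap.smulRightL ℝ (ℝ × ℝ) ℂ (ContinuousLinearMap.snd ℝ ℝ ℝ) _ = _
    rw [integral_add j1 j2]
    have e1 := (ContinuousLinearMap.smulRightL ℝ (ℝ × ℝ) ℂ
      (ContinuousLinearMap.fst ℝ ℝ ℝ)).integral_comp_comm i1
    have e2 := (ContinuousLinearMap.smulRightL ℝ (ℝ × ℝ) ℂ
      (ContinuousLinearMap.snd ℝ ℝ ℝ)).integral_comp_comm i2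
    rw [e1, e2]
    simp only [kernelIntegral, mul_left_comm _ Complex.I]
    rfl
  · have hp'' : ‖p'‖ ≤ ‖p‖ + 1 := by
      have h1 := norm_sub_norm_le p' p
      rw [Metric.mem_ball, dist_eq_norm] at hp'
      linarith
    refine (norm_add_le _ _).trans ?_
    rw [ContinuousLinearMap.norm_smulRight_apply, ContinuousLinearMap.norm_smulRight_apply]
    gcongr
    · rw [norm_mul, Complex.norm_I, one_mul, norm_mul, mul_assoc]
      exact mul_le_mul (hexp p' hp'' t) (hM₁ _ t (hI1 p' hp'')) (norm_nonneg _) (Real.exp_pos _).le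
    · rw [norm_mul, mul_assoc E]
      exact mul_le_mul (hexp p' hp'' t) (hM₂ _ t (hI1 p' hp'')) (norm_nonneg _) (Real.exp_pos _).le
  · have h1 : HasFDerivAt (fun p : ℝ × ℝ => Complex.exp ((c + t * Complex.I) * p.2))
        ((ContinuousLinearMap.snd ℝ ℝ ℝ).smulRight
          (Complex.exp ((c + t * Complex.I) * p'.2) * (c + t * Complex.I))) p' := by
      have a1 : HasDerivAt (fun x : ℝ => Complex.exp ((c + t * Complex.I) * x))
          (Complex.exp ((c + t * Complex.I) * p'.2) * (c + t * Complex.I)) p'.2 := by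
        have := ((hasDerivAt_id ((p'.2 : ℝ) : ℂ)).const_mul (c + t * Complex.I)).cexp
        simpa using this.comp_ofReal
      have a2 := a1.hasFDerivAt.comp p' (hasFDerivAt_snd (𝕜 := ℝ) (p := p'))
      exact a2.congr_fderiv (by ext <;> simp)
    have h2 : HasFDerivAt (fun p : ℝ × ℝ => H (Complex.I * p.1) t)
        ((ContinuousLinearMap.fst ℝ ℝ ℝ).smulRight
          (deriv (fun z => H z t) (Complex.I * p'.1) * Complex.I)) p' := by
      have a1 : HasDerivAt (fun x : ℝ => H (Complex.I * x) t)
          (deriv (fun z => H z t) (Complex.I * p'.1) * Complex.I) p'.1 := by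
        have a0 : HasDerivAt (fun z : ℂ => Complex.I * z) Complex.I ((p'.1 : ℝ) : ℂ) := by
          simpa using (hasDerivAt_id ((p'.1 : ℝ) : ℂ)).const_mul Complex.I
        have := (h.differentiable t (Complex.I * p'.1)).hasDerivAt.comp _ a0
        exact this.comp_ofReal
      have a2 := a1.hasFDerivAt.comp p' (hasFDerivAt_fst (𝕜 := ℝ) (p := p'))
      exact a2.congr_fderiv (by ext <;> simp)
    have h3 := h1.mul h2
    refine h3.congr_fderiv ?_
    simp only [hF']
    ext <;> simp <;> ring

theorem SmoothKernel.const_mul (h : SmoothKernel H) (a : ℂ) : SmoothKernel fun z t => a * H z t where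
  measurable z := (h.measurable z).const_mul a
  differentiable t := (h.differentiable t).const_mul a
  decay R N := by
    obtain ⟨M, hM⟩ := h.decay R N
    refine ⟨‖a‖ * M, fun z t hz => ?_⟩
    rw [norm_mul, mul_assoc]
    gcongr
    exact hM z t hz

/-- The kernel is quantified after `n` because the induction hypothesis is applied to the two new
kernels of the derivative. -/
theorem SmoothKernel.contDiff (c : ℝ) (n : ℕ) : ∀ {H : ℂ → ℝ → ℂ}, SmoothKernel H →
    ContDiff ℝ n (kernelIntegral c H) := by
  induction n with
  | zero =>
    intro H h
    rw [Nat.cast_zero, contDiff_zero]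
    exact continuous_iff_continuousAt.2 fun p => (h.hasFDerivAt c p).continuousAt
  | succ n ih =>
    intro H h
    rw [Nat.cast_succ, contDiff_succ_iff_hasFDerivAt]
    refine ⟨_, ?_, fun p => h.hasFDerivAt c p⟩
    exact ((ContinuousLinearMap.smulRightL ℝ (ℝ × ℝ) ℂ (ContinuousLinearMap.fst ℝ ℝ ℝ)).contDiff.comp
      (ih (h.deriv_param.const_mul Complex.I))).add
      ((ContinuousLinearMap.smulRightL ℝ (ℝ × ℝ) ℂ (ContinuousLinearMap.snd ℝ ℝ ℝ)).contDiff.comp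
      (ih (h.mul_line c)))

theorem contDiff_tau_hat {A : ℝ × ℝ} {q : ℝ} {k : Fin 2} {Γ : Set ℝ} {f : ℂ × ℂ → ℂ}
    (hA₁ : A.1 ∈ Set.Ioo (0 : ℝ) 1) (hA₂ : A.2 ∈ Set.Ioo (0 : ℝ) 1)
    (hq : q ≠ 0) (hΓ : IsLaplaceInterval q k Γ) {c : ℝ} (hc : c ∈ Γ) (hf : f ∈ spaceS A) :
    ContDiff ℝ (⊤ : ℕ∞) (tau q k c (hat f)) := by
  have hK : SmoothKernel fun z (t : ℝ) => tauKernel q k f z (c + t * Complex.I) := by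
    refine ⟨fun z => ((verticalDecay_tauKernel hA₁ hA₂ hq hΓ hf z).continuous hc).aestronglyMeasurable,
      fun t => differentiable_tauKernel hA₁ hA₂ hf _, fun R N => ?_⟩
    obtain ⟨M, hM⟩ := exists_tauKernel_bound hA₁ hA₂ hq hΓ hf R N
    refine ⟨M, fun z t hz => le_trans ?_ (hM z (c + t * Complex.I) hz (by simpa using hc))⟩
    gcongr
    simpa using Complex.abs_im_le_norm (c + t * Complex.I)
  have : tau q k c (hat f) = fun p => (1 / (2 * Real.pi) : ℂ) *
      kernelIntegral c (fun z (t : ℝ) => tauKernel q k f z (c + t * Complex.I)) p := rfl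
  rw [this, contDiff_infty]
  exact fun n => contDiff_const.mul (SmoothKernel.contDiff c n hK)

end SmoothKernel

/-! ### A canonical product of order between 1 and 2 that decays in a sector. -/

/-- The genus one elementary factor. -/
noncomputable def elemFactor (w : ℂ) : ℂ := (1 + w) * Complex.exp (-w)

/-- The exponential cancels the linear term of `1 + w`; the quadratic remainder makes the product
converge for orders below two. -/
theorem norm_elemFactor_sub_one_le {w : ℂ} (hw : ‖w‖ ≤ 1) : ‖elemFactor w - 1‖ ≤ 3 * ‖w‖ ^ 2 := by
  have h := Complex.norm_exp_sub_one_sub_id_le (x := -w) (by rwa [norm_neg])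
  rw [norm_neg] at h
  have e : elemFactor w - 1 = -(w ^ 2) + (1 + w) * (Complex.exp (-w) - 1 - -w) := by
    rw [elemFactor]; ring
  have h1 : ‖1 + w‖ ≤ 2 := (norm_add_le _ _).trans (by rw [norm_one]; linarith)
  rw [e]
  refine (norm_add_le _ _).trans ?_
  rw [norm_neg, norm_pow, norm_mul]
  have : ‖1 + w‖ * ‖Complex.exp (-w) - 1 - -w‖ ≤ 2 * ‖w‖ ^ 2 := by gcongr
  linarith

theorem norm_elemFactor_le (w : ℂ) : ‖elemFactor w‖ ≤ Real.exp (2 * ‖w‖) := by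
  rw [elemFactor, norm_mul, two_mul, Real.exp_add]
  have h1 : ‖1 + w‖ ≤ Real.exp ‖w‖ := by
    refine (norm_add_le _ _).trans ?_
    rw [norm_one, add_comm]
    exact Real.add_one_le_exp _
  have h2 : ‖Complex.exp (-w)‖ ≤ Real.exp ‖w‖ := by
    refine (Complex.norm_exp_le_exp_norm _).trans ?_
    rw [norm_neg]
  gcongr

/-- This bound is for zeros of modulus at most that of the point, and the quadratic one below is for
the more distant zeros. -/
theorem norm_elemFactor_le_linear (w : ℂ) : ‖elemFactor w‖ ≤ Real.exp (3 * ‖w‖) :=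
  (norm_elemFactor_le w).trans (Real.exp_le_exp.2 (by linarith [norm_nonneg w]))

theorem norm_elemFactor_le_quadratic (w : ℂ) : ‖elemFactor w‖ ≤ Real.exp (3 * ‖w‖ ^ 2) := by
  rcases le_total ‖w‖ 1 with h | h
  · have h1 := norm_elemFactor_sub_one_le h
    have h2 : ‖elemFactor w‖ ≤ ‖elemFactor w - 1‖ + ‖(1 : ℂ)‖ := norm_le_norm_sub_add _ _
    rw [norm_one] at h2
    exact (h2.trans (by linarith)).trans (Real.add_one_le_exp _)
  · refine (norm_elemFactor_le w).trans (Real.exp_le_exp.2 ?_)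
    nlinarith

/-- In the sector, `|1 + w|² ≤ 1 + s + s²/2` with `s = 2 Re w`, the second Taylor polynomial of `exp
s`. Hence the factor has modulus at most one there, with a definite gain from the cubic term once `s
≥ 1`. -/
theorem sq_norm_elemFactor_le {w : ℂ} (hw : |w.im| ≤ w.re) :
    ‖elemFactor w‖ ^ 2 ≤ (1 + 2 * w.re + (2 * w.re) ^ 2 / 2) * Real.exp (-(2 * w.re)) := by
  have h0 : 0 ≤ w.re := (abs_nonneg _).trans hw
  have h1 : ‖1 + w‖ ^ 2 = (1 + w.re) ^ 2 + w.im ^ 2 := by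
    rw [Complex.sq_norm, Complex.normSq_apply]; simp; ring
  have h2 : ‖Complex.exp (-w)‖ ^ 2 = Real.exp (-(2 * w.re)) := by
    rw [Complex.norm_exp, ← Real.exp_nat_mul]; congr 1; simp
  have h3 : w.im ^ 2 ≤ w.re ^ 2 := by rw [← sq_abs]; gcongr
  rw [elemFactor, norm_mul, mul_pow, h1, h2]
  refine mul_le_mul_of_nonneg_right ?_ (Real.exp_pos _).le
  nlinarith

theorem norm_elemFactor_le_one {w : ℂ} (hw : |w.im| ≤ w.re) : ‖elemFactor w‖ ≤ 1 := by
  have h0 : 0 ≤ w.re := (abs_nonneg _).trans hw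
  have h := sq_norm_elemFactor_le hw
  have h1 := Real.quadratic_le_exp_of_nonneg (x := 2 * w.re) (by positivity)
  have h2 : ‖elemFactor w‖ ^ 2 ≤ 1 := by
    refine h.trans ?_
    rw [Real.exp_neg, ← div_eq_mul_inv, div_le_one (Real.exp_pos _)]
    exact h1
  nlinarith [norm_nonneg (elemFactor w)]

theorem norm_elemFactor_le_of_one_le {w : ℂ} (hw : |w.im| ≤ w.re) (h1 : 1 ≤ ‖w‖) :
    ‖elemFactor w‖ ≤ Real.exp (-(1 / 32)) := by
  have h0 : 0 ≤ w.re := (abs_nonneg _).trans hw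
  have h := sq_norm_elemFactor_le hw
  have hs : 1 ≤ 2 * w.re := by
    have h2 : ‖w‖ ≤ |w.re| + |w.im| := Complex.norm_le_abs_re_add_abs_im w
    rw [abs_of_nonneg h0] at h2
    linarith
  set s := 2 * w.re with hsdef
  have h2 : 1 + s + s ^ 2 / 2 + s ^ 3 / 6 ≤ Real.exp s := by
    have := Real.sum_le_exp_of_nonneg (x := s) (by linarith) 4
    simpa [Finset.sum_range_succ, Nat.factorial] using this
  -- For `s ≥ 1` one has `1 + s + s²/2 ≤ (5/2) s³ = 15 * (s³/6)`, so the cubic term adds at least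
  -- one fifteenth. Then `15/16 ≤ exp(-1/16)` yields the exponent `1/32` after a square root.
  have h3 : 1 + s + s ^ 2 / 2 ≤ 15 / 16 * Real.exp s := by
    have a1 : s ≤ s ^ 3 := by nlinarith [mul_nonneg (sub_nonneg.2 hs) (by linarith : 0 ≤ s)]
    have a2 : s ^ 2 ≤ s ^ 3 := by nlinarith [sq_nonneg s]
    nlinarith
  have h4 : ‖elemFactor w‖ ^ 2 ≤ 15 / 16 := by
    refine h.trans ?_
    rw [Real.exp_neg, ← div_eq_mul_inv, div_le_iff₀ (Real.exp_pos _)]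
    exact h3
  have h5 : (15 / 16 : ℝ) ≤ Real.exp (-(1 / 32)) ^ 2 := by
    rw [← Real.exp_nat_mul]
    have := Real.add_one_le_exp (-(1 / 16) : ℝ)
    norm_num at this ⊢
    linarith
  exact le_of_sq_le_sq (h4.trans h5) (Real.exp_pos _).le

theorem differentiable_elemFactor : Differentiable ℂ elemFactor := by
  unfold elemFactor; fun_prop

section Product

variable {σ : ℝ}

/-- The multiplicity of the zero `-2 ^ n` in the canonical product of order `σ`. -/
noncomputable def zeroMult (σ : ℝ) (n : ℕ) : ℕ := ⌈((2 : ℝ) ^ n) ^ σ⌉₊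

theorem le_zeroMult (σ : ℝ) (n : ℕ) : ((2 : ℝ) ^ n) ^ σ ≤ zeroMult σ n := Nat.le_ceil _

theorem zeroMult_le (hσ : 0 ≤ σ) (n : ℕ) : (zeroMult σ n : ℝ) ≤ 2 * ((2 : ℝ) ^ n) ^ σ := by
  have h1 : (1 : ℝ) ≤ ((2 : ℝ) ^ n) ^ σ :=
    Real.one_le_rpow (one_le_pow₀ (by norm_num)) hσ
  have := Nat.ceil_lt_add_one (a := ((2 : ℝ) ^ n) ^ σ) (by positivity)
  rw [zeroMult]
  linarith

/-- The factors of a canonical product of order `σ`. -/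
noncomputable def canonicalFactor (σ : ℝ) (n : ℕ) (w : ℂ) : ℂ :=
  elemFactor (w / 2 ^ n) ^ zeroMult σ n

/-- A canonical product of order `σ`, for `1 < σ < 2`. -/
noncomputable def canonicalProduct (σ : ℝ) (w : ℂ) : ℂ := ∏' n : ℕ, canonicalFactor σ n w

theorem norm_div_two_pow (w : ℂ) (n : ℕ) : ‖w / 2 ^ n‖ = ‖w‖ / 2 ^ n := by simp

/-- Multiplicity times the quadratic bound is geometric with ratio `2^(σ-2) < 1`, so the sum over
distant zeros is governed by its first term. In `two_pow_rpow_mul'` the ratio is `2^(σ-1)`, which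
exceeds one for `σ > 1`, and the last term governs. -/
theorem two_pow_rpow_mul (t : ℝ) (n : ℕ) :
    ((2 : ℝ) ^ n) ^ σ * (t / 2 ^ n) ^ 2 = t ^ 2 * ((2 : ℝ) ^ (σ - 2)) ^ n := by
  have h : ((2 : ℝ) ^ n) ^ σ = ((2 : ℝ) ^ σ) ^ n := by
    rw [← Real.rpow_natCast 2, ← Real.rpow_mul (by norm_num), mul_comm, Real.rpow_mul (by norm_num),
      Real.rpow_natCast]
  have h2 : (2 : ℝ) ^ (σ - 2) = 2 ^ σ / 4 := by
    rw [Real.rpow_sub (by norm_num)]; norm_num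
  rw [h, h2, div_pow, div_pow, ← pow_mul, mul_comm n 2, pow_mul]
  norm_num
  ring

theorem two_pow_rpow_mul' (t : ℝ) (n : ℕ) :
    ((2 : ℝ) ^ n) ^ σ * (t / 2 ^ n) = t * ((2 : ℝ) ^ (σ - 1)) ^ n := by
  have h : ((2 : ℝ) ^ n) ^ σ = ((2 : ℝ) ^ σ) ^ n := by
    rw [← Real.rpow_natCast 2, ← Real.rpow_mul (by norm_num), mul_comm, Real.rpow_mul (by norm_num),
      Real.rpow_natCast]
  have h2 : (2 : ℝ) ^ (σ - 1) = 2 ^ σ / 2 := by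
    rw [Real.rpow_sub (by norm_num)]; norm_num
  rw [h, h2, div_pow]
  ring

theorem norm_canonicalFactor_sub_one_le (hσ : 0 ≤ σ) {w : ℂ} {n : ℕ} (hw : ‖w‖ ≤ 2 ^ n) :
    ‖canonicalFactor σ n w - 1‖ ≤ Real.exp (6 * ‖w‖ ^ 2 * ((2 : ℝ) ^ (σ - 2)) ^ n) - 1 := by
  have h1 : ‖w / 2 ^ n‖ ≤ 1 := by
    rw [norm_div_two_pow]; exact div_le_one_of_le₀ hw (by positivity)
  have h2 := norm_elemFactor_sub_one_le h1
  have h3 := Finset.norm_prod_one_add_sub_one_le (Finset.range (zeroMult σ n))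
    (fun _ => elemFactor (w / 2 ^ n) - 1)
  rw [Finset.prod_const, Finset.card_range, add_sub_cancel, Finset.sum_const, Finset.card_range,
    nsmul_eq_mul] at h3
  refine h3.trans (sub_le_sub_right (Real.exp_le_exp.2 ?_) 1)
  calc (zeroMult σ n : ℝ) * ‖elemFactor (w / 2 ^ n) - 1‖
      ≤ (2 * ((2 : ℝ) ^ n) ^ σ) * (3 * ‖w / 2 ^ n‖ ^ 2) := by
        gcongr; exact zeroMult_le hσ n
    _ = 6 * (((2 : ℝ) ^ n) ^ σ * (‖w‖ / 2 ^ n) ^ 2) := by rw [norm_div_two_pow]; ring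
    _ = _ := by rw [two_pow_rpow_mul]; ring

theorem rpow_lt_one_of_lt_two (hσ : σ < 2) : (2 : ℝ) ^ (σ - 2) < 1 :=
  Real.rpow_lt_one_of_one_lt_of_neg (by norm_num) (by linarith)

theorem hasProdLocallyUniformlyOn_canonicalProduct (hσ : 0 ≤ σ) (hσ' : σ < 2) (R : ℝ) :
    HasProdLocallyUniformlyOn (canonicalFactor σ) (canonicalProduct σ) (Metric.ball 0 R) := by
  have hρ := rpow_lt_one_of_lt_two hσ'
  have hρ0 : (0 : ℝ) < 2 ^ (σ - 2) := by positivity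
  have h := Summable.hasProdLocallyUniformlyOn_nat_one_add
    (f := fun n w => canonicalFactor σ n w - 1) (K := Metric.ball (0 : ℂ) R) Metric.isOpen_ball
    (u := fun n => 6 * R ^ 2 * ((2 : ℝ) ^ (σ - 2)) ^ n * Real.exp (6 * R ^ 2))
    (((summable_geometric_of_lt_one hρ0.le hρ).mul_left _).mul_right _) ?_ ?_
  · simp only [add_sub_cancel] at h
    exact h
  · have hev : ∀ᶠ n : ℕ in Filter.atTop, R ≤ 2 ^ n :=
      (tendsto_pow_atTop_atTop_of_one_lt (by norm_num : (1 : ℝ) < 2)).eventually_ge_atTop R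
    filter_upwards [hev] with n hn w hw
    rw [mem_ball_zero_iff] at hw
    refine (norm_canonicalFactor_sub_one_le hσ (hw.le.trans hn)).trans ?_
    have hx : 6 * ‖w‖ ^ 2 * ((2 : ℝ) ^ (σ - 2)) ^ n ≤ 6 * R ^ 2 * ((2 : ℝ) ^ (σ - 2)) ^ n := by
      gcongr
    have hx0 : 0 ≤ 6 * R ^ 2 * ((2 : ℝ) ^ (σ - 2)) ^ n := by positivity
    have hx1 : 6 * R ^ 2 * ((2 : ℝ) ^ (σ - 2)) ^ n ≤ 6 * R ^ 2 :=
      mul_le_of_le_one_right (by positivity) (pow_le_one₀ hρ0.le hρ.le)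
    set x := 6 * R ^ 2 * ((2 : ℝ) ^ (σ - 2)) ^ n
    have h1 : Real.exp x - 1 ≤ x * Real.exp x := by
      have := Real.add_one_le_exp (-x)
      have h2 : Real.exp x * Real.exp (-x) = 1 := by rw [← Real.exp_add]; simp
      nlinarith [Real.exp_pos x]
    calc _ ≤ Real.exp x - 1 := by gcongr
      _ ≤ x * Real.exp x := h1
      _ ≤ _ := by gcongr
  · intro n
    have := differentiable_elemFactor.continuous
    unfold canonicalFactor
    fun_prop

theorem differentiable_canonicalProduct (hσ : 0 ≤ σ) (hσ' : σ < 2) :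
    Differentiable ℂ (canonicalProduct σ) := by
  intro w
  have h := (hasProdLocallyUniformlyOn_canonicalProduct hσ hσ' (‖w‖ + 1)).tendstoLocallyUniformlyOn_finsetRange
  have hd := h.differentiableOn (Filter.Eventually.of_forall fun N => ?_) Metric.isOpen_ball
  · exact hd.differentiableAt (Metric.isOpen_ball.mem_nhds (by
      rw [mem_ball_zero_iff]; linarith))
  · refine Differentiable.differentiableOn ?_
    refine Differentiable.fun_finsetProd fun n _ => ?_
    exact (differentiable_elemFactor.comp (by fun_prop)).pow _

theorem tendsto_canonicalProduct (hσ : 0 ≤ σ) (hσ' : σ < 2) (w : ℂ) :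
    Filter.Tendsto (fun N => ∏ n ∈ Finset.range N, canonicalFactor σ n w) Filter.atTop
      (nhds (canonicalProduct σ w)) :=
  ((hasProdLocallyUniformlyOn_canonicalProduct hσ hσ' (‖w‖ + 1)).hasProd (by
    rw [mem_ball_zero_iff]; linarith)).tendsto_prod_nat

theorem norm_canonicalProduct_le_of_forall (hσ : 0 ≤ σ) (hσ' : σ < 2) {w : ℂ} {B : ℝ}
    (h : ∀ᶠ N in Filter.atTop, ∏ n ∈ Finset.range N, ‖canonicalFactor σ n w‖ ≤ B) :
    ‖canonicalProduct σ w‖ ≤ B := by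
  refine le_of_tendsto (tendsto_canonicalProduct hσ hσ' w).norm ?_
  filter_upwards [h] with N hN
  rwa [norm_prod]

theorem canonicalProduct_zero : canonicalProduct σ 0 = 1 := by
  simp [canonicalProduct, canonicalFactor, elemFactor]

theorem norm_canonicalFactor_le (hσ : 0 ≤ σ) (w : ℂ) (n : ℕ) :
    ‖canonicalFactor σ n w‖ ≤ Real.exp (6 * (‖w‖ * ((2 : ℝ) ^ (σ - 1)) ^ n)) ∧
    ‖canonicalFactor σ n w‖ ≤ Real.exp (6 * (‖w‖ ^ 2 * ((2 : ℝ) ^ (σ - 2)) ^ n)) := by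
  have key : ∀ B : ℝ, 0 ≤ B → ‖elemFactor (w / 2 ^ n)‖ ≤ Real.exp (3 * B) →
      ‖canonicalFactor σ n w‖ ≤ Real.exp (6 * (((2 : ℝ) ^ n) ^ σ * B)) := by
    intro B hB h
    rw [canonicalFactor, norm_pow]
    refine (pow_le_pow_left₀ (norm_nonneg _) h _).trans ?_
    rw [← Real.exp_nat_mul]
    refine Real.exp_le_exp.2 ?_
    have := mul_le_mul_of_nonneg_right (zeroMult_le hσ n) (by positivity : 0 ≤ 3 * B)
    linarith
  constructor
  · have := key _ (norm_nonneg _) (norm_elemFactor_le_linear _)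
    rwa [norm_div_two_pow, two_pow_rpow_mul'] at this
  · have := key _ (by positivity) (norm_elemFactor_le_quadratic _)
    rwa [norm_div_two_pow, two_pow_rpow_mul] at this

theorem exists_two_pow_near {t : ℝ} (ht : 1 ≤ t) : ∃ k : ℕ, (2 : ℝ) ^ k ≤ t ∧ t < 2 ^ (k + 1) :=
  exists_nat_pow_near ht (by norm_num)

theorem two_rpow_pow (s : ℝ) (k : ℕ) : ((2 : ℝ) ^ s) ^ k = ((2 : ℝ) ^ k) ^ s := by
  rw [← Real.rpow_natCast, ← Real.rpow_mul (by norm_num), mul_comm, Real.rpow_mul (by norm_num),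
    Real.rpow_natCast]

/-- The canonical product is of order `σ` and finite type. -/
theorem exists_norm_canonicalProduct_le (hσ : 1 < σ) (hσ' : σ < 2) :
    ∃ b > 0, ∃ C > 0, ∀ w, ‖canonicalProduct σ w‖ ≤ C * Real.exp (b * ‖w‖ ^ σ) := by
  have hσ0 : 0 ≤ σ := by linarith
  set ρ : ℝ := 2 ^ (σ - 2) with hρdef
  have hρ : ρ < 1 := rpow_lt_one_of_lt_two hσ'
  have hρ0 : 0 < ρ := by positivity
  set β : ℝ := 2 ^ (σ - 1) with hβdef
  have hβ : 1 < β := Real.one_lt_rpow (by norm_num) (by linarith)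
  have hgeo : ∀ N, ∑ n ∈ Finset.range N, ρ ^ n ≤ 1 / (1 - ρ) := by
    intro N
    rw [one_div, ← tsum_geometric_of_lt_one hρ0.le hρ]
    exact (summable_geometric_of_lt_one hρ0.le hρ).sum_le_tsum _ fun n _ => by positivity
  have h1ρ : 0 < 1 - ρ := by linarith
  have hβ1 : 0 < β - 1 := by linarith
  set b := 6 * (2 ^ (σ - 1) / (β - 1) + 1 / (1 - ρ)) with hb
  have hb0 : 0 < b := by positivity
  refine ⟨b, hb0, Real.exp (6 * (1 / (1 - ρ))), Real.exp_pos _, fun w => ?_⟩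
  refine norm_canonicalProduct_le_of_forall hσ0 hσ' (Filter.Eventually.of_forall fun N => ?_)
  rcases le_total ‖w‖ 1 with hw | hw
  · calc ∏ n ∈ Finset.range N, ‖canonicalFactor σ n w‖
        ≤ ∏ n ∈ Finset.range N, Real.exp (6 * (‖w‖ ^ 2 * ρ ^ n)) :=
          Finset.prod_le_prod (fun _ _ => norm_nonneg _) fun n _ => (norm_canonicalFactor_le hσ0 w n).2
      _ = Real.exp (6 * (‖w‖ ^ 2 * ∑ n ∈ Finset.range N, ρ ^ n)) := by
          rw [← Real.exp_sum, ← Finset.mul_sum, ← Finset.mul_sum]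
      _ ≤ Real.exp (6 * (1 / (1 - ρ))) := by
          gcongr
          calc ‖w‖ ^ 2 * ∑ n ∈ Finset.range N, ρ ^ n ≤ 1 * (1 / (1 - ρ)) := by
                gcongr
                · exact pow_le_one₀ (norm_nonneg _) hw
                · exact hgeo N
            _ = _ := one_mul _
      _ ≤ _ := le_mul_of_one_le_right (Real.exp_pos _).le (Real.one_le_exp (by positivity))
  -- The product is cut at `2 ^ k ≤ ‖w‖ < 2 ^ (k+1)`: linear bounds for `n ≤ k`, quadratic bounds
  -- beyond. Both geometric sums are of size `‖w‖ ^ σ`.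
  · obtain ⟨k, hk, hk'⟩ := exists_two_pow_near hw
    set t := ‖w‖ with ht
    have ht0 : 0 < t := by linarith
    have hA : ∑ n ∈ Finset.range (k + 1), 6 * (t * β ^ n) ≤ 6 * (2 ^ (σ - 1) / (β - 1)) * t ^ σ := by
      rw [← Finset.mul_sum, ← Finset.mul_sum, geom_sum_eq hβ.ne']
      have h2 : β ^ (k + 1) ≤ 2 ^ (σ - 1) * t ^ (σ - 1) := by
        rw [hβdef, two_rpow_pow, ← Real.mul_rpow (by norm_num) ht0.le]
        refine Real.rpow_le_rpow (by positivity) ?_ (by linarith)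
        rw [pow_succ]; linarith
      have h3 : t ^ σ = t * t ^ (σ - 1) := by
        rw [mul_comm, ← Real.rpow_add_one ht0.ne', sub_add_cancel]
      calc 6 * (t * ((β ^ (k + 1) - 1) / (β - 1)))
          ≤ 6 * (t * ((2 ^ (σ - 1) * t ^ (σ - 1)) / (β - 1))) := by gcongr; linarith
        _ = _ := by rw [h3]; ring
    have hB : ∑ n ∈ Finset.range N, 6 * (t ^ 2 * ρ ^ (k + 1 + n)) ≤ 6 * (1 / (1 - ρ)) * t ^ σ := by
      simp only [pow_add ρ (k + 1)]
      rw [← Finset.mul_sum, ← Finset.mul_sum, ← Finset.mul_sum]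
      have h2 : ρ ^ (k + 1) ≤ t ^ (σ - 2) := by
        rw [hρdef, two_rpow_pow]
        exact Real.rpow_le_rpow_of_nonpos ht0 hk'.le (by linarith)
      have h3 : t ^ σ = t ^ 2 * t ^ (σ - 2) := by
        rw [← Real.rpow_natCast t 2, ← Real.rpow_add ht0]; norm_num
      calc 6 * (t ^ 2 * (ρ ^ (k + 1) * ∑ n ∈ Finset.range N, ρ ^ n))
          ≤ 6 * (t ^ 2 * (t ^ (σ - 2) * (1 / (1 - ρ)))) := by gcongr; exact hgeo N
        _ = _ := by rw [h3]; ring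
    have hfac1 : ∏ n ∈ Finset.range (k + 1), ‖canonicalFactor σ n w‖ ≤
        Real.exp (6 * (2 ^ (σ - 1) / (β - 1)) * t ^ σ) :=
      calc _ ≤ ∏ n ∈ Finset.range (k + 1), Real.exp (6 * (t * β ^ n)) :=
            Finset.prod_le_prod (fun _ _ => norm_nonneg _) fun n _ =>
              (norm_canonicalFactor_le hσ0 w n).1
        _ = Real.exp (∑ n ∈ Finset.range (k + 1), 6 * (t * β ^ n)) := (Real.exp_sum _ _).symm
        _ ≤ _ := Real.exp_le_exp.2 hA
    have hfac2 : ∀ N, ∏ n ∈ Finset.range N, ‖canonicalFactor σ (k + 1 + n) w‖ ≤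
        Real.exp (∑ n ∈ Finset.range N, 6 * (t ^ 2 * ρ ^ (k + 1 + n))) := fun N =>
      calc _ ≤ ∏ n ∈ Finset.range N, Real.exp (6 * (t ^ 2 * ρ ^ (k + 1 + n))) :=
            Finset.prod_le_prod (fun _ _ => norm_nonneg _) fun n _ =>
              (norm_canonicalFactor_le hσ0 w _).2
        _ = _ := (Real.exp_sum _ _).symm
    have hE : 1 ≤ Real.exp (6 * (1 / (1 - ρ))) := Real.one_le_exp (by positivity)
    have hsplit : Real.exp (b * t ^ σ) = Real.exp (6 * (2 ^ (σ - 1) / (β - 1)) * t ^ σ) *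
        Real.exp (6 * (1 / (1 - ρ)) * t ^ σ) := by
      rw [← Real.exp_add, hb]; ring_nf
    refine le_trans ?_ (le_mul_of_one_le_left (Real.exp_pos _).le hE)
    rw [hsplit]
    rcases le_total N (k + 1) with hN | hN
    · calc ∏ n ∈ Finset.range N, ‖canonicalFactor σ n w‖
          ≤ ∏ n ∈ Finset.range N, Real.exp (6 * (t * β ^ n)) :=
            Finset.prod_le_prod (fun _ _ => norm_nonneg _) fun n _ =>
              (norm_canonicalFactor_le hσ0 w n).1
        _ = Real.exp (∑ n ∈ Finset.range N, 6 * (t * β ^ n)) := (Real.exp_sum _ _).symm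
        _ ≤ Real.exp (∑ n ∈ Finset.range (k + 1), 6 * (t * β ^ n)) := by
            refine Real.exp_le_exp.2 (Finset.sum_le_sum_of_subset_of_nonneg
              (Finset.range_subset_range.2 hN) fun n _ _ => by positivity)
        _ ≤ Real.exp (6 * (2 ^ (σ - 1) / (β - 1)) * t ^ σ) := Real.exp_le_exp.2 hA
        _ ≤ _ := le_mul_of_one_le_right (Real.exp_pos _).le (Real.one_le_exp (by positivity))
    · obtain ⟨m, rfl⟩ := Nat.exists_eq_add_of_le hN
      rw [Finset.prod_range_add]
      have hBm : ∑ n ∈ Finset.range m, 6 * (t ^ 2 * ρ ^ (k + 1 + n)) ≤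
          6 * (1 / (1 - ρ)) * t ^ σ := by
        refine le_trans (Finset.sum_le_sum_of_subset_of_nonneg (Finset.range_subset_range.2
          (Nat.le_add_left m (k + 1))) fun n _ _ => by positivity) hB
      exact mul_le_mul hfac1 ((hfac2 m).trans (Real.exp_le_exp.2 hBm))
        (Finset.prod_nonneg fun _ _ => norm_nonneg _) (Real.exp_pos _).le

/-- The canonical product decays in a sector around the positive half axis. -/
theorem exists_norm_canonicalProduct_le_sector (hσ : 0 ≤ σ) (hσ' : σ < 2) :
    ∃ a > 0, ∃ C > 0, ∀ w : ℂ, |w.im| ≤ w.re →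
      ‖canonicalProduct σ w‖ ≤ C * Real.exp (-(a * ‖w‖ ^ σ)) := by
  refine ⟨1 / 32 * (1 / 2) ^ σ, by positivity, Real.exp (1 / 32 * (1 / 2) ^ σ), Real.exp_pos _,
    fun w hw => norm_canonicalProduct_le_of_forall hσ hσ' ?_⟩
  have hsec : ∀ n : ℕ, |(w / 2 ^ n).im| ≤ (w / 2 ^ n).re := by
    intro n
    have e : (w / 2 ^ n) = ((((2 : ℝ) ^ n)⁻¹ : ℝ) : ℂ) * w := by
      push_cast; rw [div_eq_inv_mul]
    have hpos : (0 : ℝ) ≤ ((2 : ℝ) ^ n)⁻¹ := by positivity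
    rw [e, Complex.re_ofReal_mul, Complex.im_ofReal_mul, abs_mul, abs_of_nonneg hpos]
    gcongr
  have hone : ∀ n, ‖canonicalFactor σ n w‖ ≤ 1 := fun n => by
    rw [canonicalFactor, norm_pow]
    exact pow_le_one₀ (norm_nonneg _) (norm_elemFactor_le_one (hsec n))
  rcases le_total ‖w‖ 1 with h1 | h1
  · refine Filter.Eventually.of_forall fun N => ?_
    refine (Finset.prod_le_one (fun _ _ => norm_nonneg _) fun n _ => hone n).trans ?_
    rw [← Real.exp_add]
    refine Real.one_le_exp ?_
    have : 1 / 32 * (1 / 2) ^ σ * ‖w‖ ^ σ ≤ 1 / 32 * (1 / 2) ^ σ * 1 := by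
      gcongr
      exact Real.rpow_le_one (norm_nonneg _) h1 hσ
    linarith
  -- All factors have modulus at most one in the sector, so the factor with `2 ^ k ≤ ‖w‖ < 2 ^
  -- (k+1)` alone suffices: its multiplicity is at least `(‖w‖/2) ^ σ` and each copy gains
  -- `exp(-1/32)`.
  · obtain ⟨k, hk, hk'⟩ := exists_two_pow_near h1
    filter_upwards [Filter.eventually_gt_atTop k] with N hN
    have hkm : k ∈ Finset.range N := Finset.mem_range.2 hN
    rw [← Finset.mul_prod_erase _ _ hkm]
    have hk1 : ‖canonicalFactor σ k w‖ ≤ Real.exp (-(1 / 32 * (1 / 2) ^ σ * ‖w‖ ^ σ)) := by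
      have h2 := norm_elemFactor_le_of_one_le (hsec k) (by
        rw [norm_div_two_pow, le_div_iff₀ (by positivity), one_mul]; exact hk)
      rw [canonicalFactor, norm_pow]
      refine (pow_le_pow_left₀ (norm_nonneg _) h2 _).trans ?_
      rw [← Real.exp_nat_mul]
      refine Real.exp_le_exp.2 ?_
      have h3 : ((1 / 2) * ‖w‖) ^ σ ≤ zeroMult σ k := by
        refine le_trans ?_ (le_zeroMult σ k)
        refine Real.rpow_le_rpow (by positivity) ?_ hσ
        rw [pow_succ] at hk'
        linarith
      rw [Real.mul_rpow (by norm_num) (norm_nonneg _)] at h3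
      linarith
    calc _ ≤ Real.exp (-(1 / 32 * (1 / 2) ^ σ * ‖w‖ ^ σ)) * 1 := by
          refine mul_le_mul hk1 (Finset.prod_le_one (fun _ _ => norm_nonneg _) fun n _ => hone n)
            (Finset.prod_nonneg fun _ _ => norm_nonneg _) (Real.exp_pos _).le
      _ ≤ _ := by
          rw [mul_one]
          exact le_mul_of_one_le_left (Real.exp_pos _).le (Real.one_le_exp (by positivity))

end Product

/-! ### Nonzero functions with equal decay and growth exponents, for every exponent above 1. -/

/-- Entire functions of order `σ` and finite type with maximal decay in a sector around the positive
half axis. -/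
structure SectorDecay (σ : ℝ) (g : ℂ → ℂ) : Prop where
  differentiable : Differentiable ℂ g
  apply_zero_ne : g 0 ≠ 0
  growth : ∃ b > 0, ∃ C > 0, ∀ w, ‖g w‖ ≤ C * Real.exp (b * ‖w‖ ^ σ)
  decay : ∃ ε > 0, ∃ a > 0, ∃ C > 0, ∀ w : ℂ, |w.im| ≤ ε * w.re →
    ‖g w‖ ≤ C * Real.exp (-(a * ‖w‖ ^ σ))

theorem norm_sq_rpow (w : ℂ) (σ : ℝ) : ‖w ^ 2‖ ^ σ = ‖w‖ ^ (2 * σ) := by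
  rw [norm_pow, ← Real.rpow_natCast, ← Real.rpow_mul (norm_nonneg _)]
  norm_num

theorem SectorDecay.growth_sq {σ : ℝ} {g : ℂ → ℂ} (h : SectorDecay σ g) :
    ∃ b > 0, ∃ C > 0, ∀ w : ℂ, ‖g (w ^ 2)‖ ≤ C * Real.exp (b * ‖w‖ ^ (2 * σ)) := by
  obtain ⟨b, hb, C, hC, h⟩ := h.growth
  exact ⟨b, hb, C, hC, fun w => by rw [← norm_sq_rpow]; exact h _⟩

/-- Squaring sends a narrow double sector around the whole real axis into the sector around the
positive half axis, so decay is gained in both real directions while the order doubles. -/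
theorem SectorDecay.decay_sq {σ : ℝ} {g : ℂ → ℂ} (h : SectorDecay σ g) :
    ∃ ε > 0, ∃ a > 0, ∃ C > 0, ∀ w : ℂ, |w.im| ≤ ε * |w.re| →
      ‖g (w ^ 2)‖ ≤ C * Real.exp (-(a * ‖w‖ ^ (2 * σ))) := by
  obtain ⟨ε, hε, a, ha, C, hC, h⟩ := h.decay
  -- The bound `1/2` gives `Re w² ≥ (3/4)(Re w)²`, and `ε/4` gives `|Im w²| ≤ (ε/2)(Re w)²`.
  refine ⟨min (1 / 2) (ε / 4), by positivity, a, ha, C, hC, fun w hw => ?_⟩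
  rw [← norm_sq_rpow]
  refine h _ ?_
  have h1 : |w.im| ≤ 1 / 2 * |w.re| := hw.trans (by gcongr; exact min_le_left _ _)
  have h2 : |w.im| ≤ ε / 4 * |w.re| := hw.trans (by gcongr; exact min_le_right _ _)
  have him : (w ^ 2).im = 2 * (w.re * w.im) := by rw [sq, Complex.mul_im]; ring
  have hre : (w ^ 2).re = |w.re| ^ 2 - |w.im| ^ 2 := by
    rw [sq, Complex.mul_re, sq_abs, sq_abs]; ring
  rw [him, hre, abs_mul, abs_mul, abs_two]
  set u := |w.re|
  set v := |w.im|
  have hu : 0 ≤ u := abs_nonneg _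
  have hv : 0 ≤ v := abs_nonneg _
  have h3 : v ^ 2 ≤ 1 / 4 * u ^ 2 := by nlinarith
  have h4 : u * v ≤ ε / 4 * u ^ 2 := by nlinarith
  have h5 : ε * v ^ 2 ≤ ε * (1 / 4 * u ^ 2) := by gcongr
  nlinarith [sq_nonneg u, mul_nonneg hε.le (sq_nonneg u)]

theorem SectorDecay.comp_sq {σ : ℝ} {g : ℂ → ℂ} (h : SectorDecay σ g) :
    SectorDecay (2 * σ) fun w => g (w ^ 2) where
  differentiable := h.differentiable.comp (by fun_prop)
  apply_zero_ne := by simpa using h.apply_zero_ne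
  growth := h.growth_sq
  decay := by
    obtain ⟨ε, hε, a, ha, C, hC, h⟩ := h.decay_sq
    refine ⟨ε, hε, a, ha, C, hC, fun w hw => h w (hw.trans ?_)⟩
    gcongr
    exact le_abs_self _

theorem sectorDecay_exp_neg : SectorDecay 1 fun w => Complex.exp (-w) where
  differentiable := by fun_prop
  apply_zero_ne := Complex.exp_ne_zero _
  growth := ⟨1, one_pos, 1, one_pos, fun w => by
    rw [one_mul, one_mul, Real.rpow_one]
    refine (Complex.norm_exp_le_exp_norm _).trans ?_
    rw [norm_neg]⟩
  decay := ⟨1, one_pos, 1 / 2, by norm_num, 1, one_pos, fun w hw => by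
    rw [Real.rpow_one, one_mul, Complex.norm_exp, Complex.neg_re]
    refine Real.exp_le_exp.2 ?_
    have h1 := Complex.norm_le_abs_re_add_abs_im w
    have h2 : 0 ≤ w.re := by linarith [abs_nonneg w.im]
    rw [abs_of_nonneg h2] at h1
    linarith⟩

/-- Halving brings `σ` into `[1, 2)`, where `exp(-w)` serves for `σ = 1` and the canonical product
otherwise; `comp_sq` then doubles the order back. -/
theorem exists_sectorDecay {σ : ℝ} (hσ : 1 ≤ σ) : ∃ g, SectorDecay σ g := by
  obtain ⟨n, hn, hn'⟩ := exists_two_pow_near hσ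
  clear hσ
  induction n generalizing σ with
  | zero =>
    rcases (by simpa using hn : 1 ≤ σ).eq_or_lt with rfl | h1
    · exact ⟨_, sectorDecay_exp_neg⟩
    · have h2 : σ < 2 := by simpa using hn'
      obtain ⟨a, ha, C, hC, h⟩ := exists_norm_canonicalProduct_le_sector (by linarith) h2
      exact ⟨canonicalProduct σ, differentiable_canonicalProduct (by linarith) h2,
        by rw [canonicalProduct_zero]; exact one_ne_zero, exists_norm_canonicalProduct_le h1 h2,
        1, one_pos, a, ha, C, hC, fun w hw => h w (by simpa using hw)⟩
  | succ n ih =>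
    obtain ⟨g, hg⟩ := ih (σ := σ / 2) (by rw [pow_succ] at hn; linarith)
      (by rw [pow_succ] at hn'; linarith)
    have := hg.comp_sq
    rw [mul_div_cancel₀ σ two_ne_zero] at this
    exact ⟨_, this⟩

/-- Take `g(w²)` with `g` of order `ρ/2 ≥ 1`. Off the double sector `|Re w|` is at most `|Im w|/ε`,
so both the growth of `g(w²)` and the missing decay are paid for by the `|Im w| ^ ρ` term. -/
theorem exists_typeBound_of_two_le {ρ : ℝ} (hρ : 2 ≤ ρ) :
    ∃ F : ℂ → ℂ, Differentiable ℂ F ∧ F ≠ 0 ∧ ∃ a > 0, ∃ b > 0, ∃ C, TypeBound ρ ρ a b C F := by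
  obtain ⟨g, hg⟩ := exists_sectorDecay (σ := ρ / 2) (by linarith)
  obtain ⟨b, hb, C, hC, hgr⟩ := hg.growth_sq
  obtain ⟨ε, hε, a, ha, C', hC', hde⟩ := hg.decay_sq
  rw [mul_div_cancel₀ ρ two_ne_zero] at hgr hde
  have hρ0 : 0 < ρ := by linarith
  refine ⟨fun w => g (w ^ 2), hg.differentiable.comp (by fun_prop), fun h => hg.apply_zero_ne ?_,
    a, ha, b * (1 / ε + 1) ^ ρ + a * (1 / ε) ^ ρ, by positivity, C + C', fun w => ?_⟩
  · simpa using congrFun h 0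
  rcases le_total |w.im| (ε * |w.re|) with h | h
  · refine (hde w h).trans ?_
    refine mul_le_mul (by linarith) (Real.exp_le_exp.2 ?_) (Real.exp_pos _).le (by positivity)
    have h1 : a * |w.re| ^ ρ ≤ a * ‖w‖ ^ ρ := by gcongr; exact Complex.abs_re_le_norm w
    have h2 : 0 ≤ (b * (1 / ε + 1) ^ ρ + a * (1 / ε) ^ ρ) * |w.im| ^ ρ := by positivity
    linarith
  · refine (hgr w).trans ?_
    refine mul_le_mul (by linarith) (Real.exp_le_exp.2 ?_) (Real.exp_pos _).le (by positivity)
    have hre : |w.re| ≤ 1 / ε * |w.im| := by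
      rw [one_div, ← div_eq_inv_mul, le_div_iff₀ hε]; linarith
    have h1 : ‖w‖ ≤ (1 / ε + 1) * |w.im| := by
      have := Complex.norm_le_abs_re_add_abs_im w
      linarith
    have h2 : b * ‖w‖ ^ ρ ≤ b * ((1 / ε + 1) ^ ρ * |w.im| ^ ρ) := by
      rw [← Real.mul_rpow (by positivity) (abs_nonneg _)]
      gcongr
    have h3 : a * |w.re| ^ ρ ≤ a * ((1 / ε) ^ ρ * |w.im| ^ ρ) := by
      rw [← Real.mul_rpow (by positivity) (abs_nonneg _)]
      gcongr
    linarith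

/-- The Laplace transform, rotated by a right angle, maps a Gelfand–Shilov type with equal exponents
to the dual type. -/
theorem laplace_I_mul_typeBound {ρ ρ' : ℝ} (hρ : ρ.HolderConjugate ρ') {a b C : ℝ} (ha : 0 < a)
    (hb : 0 < b) {F : ℂ → ℂ} (hF : Differentiable ℂ F) (hFb : TypeBound ρ ρ a b C F) :
    Differentiable ℂ (fun z => laplace (fun x => F x) (Complex.I * z)) ∧
      ∃ a' > 0, ∃ b' > 0, ∃ C', TypeBound ρ' ρ' a' b' C'
        fun z => laplace (fun x => F x) (Complex.I * z) := by
  obtain ⟨a', ha', b', hb', K, hK, h⟩ := exists_laplace_bound hρ hρ ha hb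
  have hc := hF.continuous
  refine ⟨(differentiable_laplace hρ.lt ha (u := fun x => F x)
    (Continuous.aestronglyMeasurable (by fun_prop)) (hFb.ofReal hρ.pos)).comp
    (f := fun z : ℂ => Complex.I * z) (by fun_prop), a', ha', b', hb', C * K, fun z => ?_⟩
  refine (h C F hF hFb _).trans (le_of_eq ?_)
  simp only [Complex.I_mul_re, Complex.I_mul_im, abs_neg]
  ring_nf

theorem typeBound_laplace_inversion {ρ : ℝ} (hρ : 1 < ρ) {a b C : ℝ} (ha : 0 < a)
    {F : ℂ → ℂ} (hF : Differentiable ℂ F) (hFb : TypeBound ρ ρ a b C F)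
    (h0 : (laplace fun x => F x) = 0) : F = 0 := by
  have hc := hF.continuous
  refine differentiable_eq_of_forall_ofReal hF (differentiable_const 0) fun x => ?_
  have hi := integrable_laplace_integrand hρ ha (u := fun x => F x)
    (Continuous.aestronglyMeasurable (by fun_prop)) (hFb.ofReal (by linarith)) 0
  have := laplace_inversion (u := fun x => F x) (by fun_prop) (by simpa using hi)
    (by rw [h0]; simp) x
  rw [this, h0]
  simp [laplaceInv]

/-- Nontriviality of the spaces of type S with `α + β = 1`. -/
theorem exists_typeBound_ne_zero {ρ : ℝ} (hρ : 1 < ρ) :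
    ∃ F : ℂ → ℂ, Differentiable ℂ F ∧ F ≠ 0 ∧ ∃ a > 0, ∃ b > 0, ∃ C, TypeBound ρ ρ a b C F := by
  rcases le_total 2 ρ with h | h
  · exact exists_typeBound_of_two_le h
  -- For `ρ ≤ 2` the conjugate exponent is at least two; the rotated Laplace transform carries that
  -- case here, and it is nonzero by inversion.
  · have hconj := Real.HolderConjugate.conjExponent hρ
    have h2 : 2 ≤ Real.conjExponent ρ := by
      rw [Real.conjExponent, le_div_iff₀ (by linarith)]
      linarith
    obtain ⟨F, hF, hF0, a, ha, b, hb, C, hFb⟩ := exists_typeBound_of_two_le h2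
    obtain ⟨hd, a', ha', b', hb', C', hB⟩ := laplace_I_mul_typeBound hconj.symm ha hb hF hFb
    refine ⟨_, hd, fun h0 => hF0 ?_, a', ha', b', hb', C', hB⟩
    refine typeBound_laplace_inversion hconj.symm.lt ha hF hFb ?_
    funext z
    have := congrFun h0 (-Complex.I * z)
    simpa [← mul_assoc] using this

theorem exists_ne_zero_mem_Icc {F : ℂ → ℂ} (hF : Differentiable ℂ F) (hF0 : F ≠ 0) {s t : ℝ}
    (hst : s < t) : ∃ x ∈ Set.Icc s t, F (x : ℝ) ≠ 0 := by
  by_contra! h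
  refine hF0 (differentiable_eq_of_eventually_ofReal hF (differentiable_const 0)
    (x₀ := (s + t) / 2) ?_)
  filter_upwards [Icc_mem_nhds (show s < (s + t) / 2 by linarith)
    (show (s + t) / 2 < t by linarith)] with x hx using h x hx

/-- For `y ≥ 0` the mass of `w` on `[1, 2]` suffices, for `y ≤ 0` that on `[-2, -1]`: there `y x ≥
|y|`. -/
theorem exists_exp_le_integral {w : ℝ → ℝ} (hw : Continuous w) (hw0 : ∀ x, 0 ≤ w x)
    (hi : ∀ y : ℝ, Integrable fun x => Real.exp (y * x) * w x)
    (h1 : ∃ x ∈ Set.Icc (1 : ℝ) 2, 0 < w x) (h2 : ∃ x ∈ Set.Icc (-2 : ℝ) (-1), 0 < w x) :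
    ∃ c > 0, ∀ y : ℝ, c * Real.exp |y| ≤ ∫ x, Real.exp (y * x) * w x := by
  have hp1 := intervalIntegral.integral_pos (by norm_num : (1 : ℝ) < 2) hw.continuousOn
    (fun x _ => hw0 x) h1
  have hp2 := intervalIntegral.integral_pos (by norm_num : (-2 : ℝ) < -1) hw.continuousOn
    (fun x _ => hw0 x) h2
  set I₁ := ∫ x in (1 : ℝ)..2, w x
  set I₂ := ∫ x in (-2 : ℝ)..(-1), w x
  have key : ∀ y s t : ℝ, s ≤ t → (∀ x ∈ Set.Icc s t, |y| ≤ y * x) →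
      Real.exp |y| * (∫ x in s..t, w x) ≤ ∫ x, Real.exp (y * x) * w x := by
    intro y s t hst hy
    rw [← intervalIntegral.integral_const_mul]
    calc ∫ x in s..t, Real.exp |y| * w x ≤ ∫ x in s..t, Real.exp (y * x) * w x := by
          refine intervalIntegral.integral_mono_on hst
            (Continuous.intervalIntegrable (by fun_prop) _ _)
            (Continuous.intervalIntegrable (by fun_prop) _ _) fun x hx => ?_
          have := hw0 x
          gcongr
          exact hy x hx
      _ = ∫ x in Set.Ioc s t, Real.exp (y * x) * w x := intervalIntegral.integral_of_le hst
      _ ≤ _ := setIntegral_le_integral (hi y) (Filter.Eventually.of_forall fun x =>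
          mul_nonneg (Real.exp_pos _).le (hw0 x))
  refine ⟨min I₁ I₂, lt_min hp1 hp2, fun y => ?_⟩
  rcases le_total 0 y with hy | hy
  · refine le_trans ?_ (key y 1 2 (by norm_num) fun x hx => ?_)
    · rw [mul_comm]; gcongr; exact min_le_left _ _
    · rw [abs_of_nonneg hy]; nlinarith [hx.1]
  · refine le_trans ?_ (key y (-2) (-1) (by norm_num) fun x hx => ?_)
    · rw [mul_comm]; gcongr; exact min_le_right _ _
    · rw [abs_of_nonpos hy]; nlinarith [hx.2]

/-- A function of type S which grows exponentially along the imaginary axis. -/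
theorem exists_typeBound_exp_growth {ρ : ℝ} (hρ : 1 < ρ) :
    ∃ F : ℂ → ℂ, Differentiable ℂ F ∧ (∃ a > 0, ∃ b > 0, ∃ C, TypeBound ρ ρ a b C F) ∧
      ∃ G : ℝ → ℝ, (∀ y : ℝ, F (Complex.I * y) = G y) ∧ ∃ c > 0, ∀ y, c * Real.exp |y| ≤ G y := by
  have hconj := (Real.HolderConjugate.conjExponent hρ).symm
  obtain ⟨h, hd, hh0, a, ha, b, hb, C, hB⟩ := exists_typeBound_ne_zero hconj.lt
  -- The product of `h` with its conjugate reflection is entire and equals `|h|²` on the real line,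
  -- so its Laplace transform at real points is the integral of a nonnegative function.
  set g : ℂ → ℂ := fun z => h z * (starRingEnd ℂ) (h ((starRingEnd ℂ) z)) with hg
  have hgd : Differentiable ℂ g := by
    refine hd.mul fun z => ?_
    have := (hd ((starRingEnd ℂ) z)).conj_conj
    rw [Complex.conj_conj] at this
    exact this
  have hgb : TypeBound (Real.conjExponent ρ) (Real.conjExponent ρ) (2 * a) (2 * b) (C * C) g := by
    intro z
    have h1 := hB z
    have h2 := hB ((starRingEnd ℂ) z)
    rw [Complex.conj_re, Complex.conj_im, abs_neg] at h2
    simp only [hg]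
    rw [norm_mul, RCLike.norm_conj]
    refine (mul_le_mul h1 h2 (norm_nonneg _) ((norm_nonneg _).trans h1)).trans (le_of_eq ?_)
    rw [mul_mul_mul_comm, ← Real.exp_add]
    ring_nf
  obtain ⟨hLd, hLb⟩ := laplace_I_mul_typeBound hconj (by positivity) (by positivity) hgd hgb
  set w : ℝ → ℝ := fun x => ‖h x‖ ^ 2 with hw
  have hgw : ∀ x : ℝ, g x = w x := by
    intro x
    simp only [hg, hw, Complex.conj_ofReal]
    rw [Complex.mul_conj, Complex.normSq_eq_norm_sq]
  have hL : ∀ y : ℝ, laplace (fun x => g x) (Complex.I * (Complex.I * y)) =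
      ((∫ x, Real.exp (y * x) * w x : ℝ) : ℂ) := by
    intro y
    rw [laplace, ← integral_complex_ofReal]
    congr with x
    rw [hgw, ← mul_assoc Complex.I, Complex.I_mul_I]
    push_cast
    simp
  have hgc := hgd.continuous
  have hhc := hd.continuous
  have hi : ∀ y : ℝ, Integrable fun x => Real.exp (y * x) * w x := by
    intro y
    have := integrable_laplace_integrand hconj.lt (by positivity) (u := fun x => g x)
      (Continuous.aestronglyMeasurable (by fun_prop)) (hgb.ofReal hconj.pos) (-y)
    refine this.re.congr (Filter.Eventually.of_forall fun x => ?_)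
    simp only [hgw, neg_neg]
    rw [← Complex.ofReal_mul, ← Complex.ofReal_exp, ← Complex.ofReal_mul]
    exact Complex.ofReal_re _
  have hpos : ∀ s t : ℝ, s < t → ∃ x ∈ Set.Icc s t, 0 < w x := by
    intro s t hst
    obtain ⟨x, hx, hx0⟩ := exists_ne_zero_mem_Icc hd hh0 hst
    exact ⟨x, hx, by simp only [hw]; positivity⟩
  exact ⟨_, hLd, hLb, fun y => ∫ x, Real.exp (y * x) * w x, hL,
    exists_exp_le_integral (by simp only [hw]; fun_prop) (fun x => by positivity) hi
      (hpos _ _ (by norm_num)) (hpos _ _ (by norm_num))⟩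

/-- Through this relaxation `α₁ + α₂ ≥ 1` enters: it says `1/α₁ ≤ 1/(1-α₂)` and `1/α₂ ≤ 1/(1-α₁)`.
The factor `exp b` comes from `t ^ r ≤ 1 + t ^ r'`. -/
theorem TypeBound.mono_growth {p r r' a b C : ℝ} {F : ℂ → ℂ} (h : TypeBound p r a b C F)
    (hb : 0 < b) (hr : 0 < r) (hrr' : r ≤ r') : TypeBound p r' a b (C * Real.exp b) F := by
  intro z
  refine (h z).trans ?_
  rw [mul_assoc, ← Real.exp_add]
  have hC := h.const_nonneg
  refine mul_le_mul_of_nonneg_left (Real.exp_le_exp.2 ?_) hC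
  have h1 : |z.im| ^ r ≤ 1 + |z.im| ^ r' := by
    rcases le_total |z.im| 1 with h | h
    · have := Real.rpow_le_one (abs_nonneg z.im) h hr.le
      have := Real.rpow_nonneg (abs_nonneg z.im) r'
      linarith
    · have := Real.rpow_le_rpow_of_exponent_le h hrr'
      linarith
  have := mul_le_mul_of_nonneg_left h1 hb.le
  linarith

theorem mul_mem_spaceS {A : ℝ × ℝ} {f₁ f₂ : ℂ → ℂ} (h₁ : Differentiable ℂ f₁)
    (h₂ : Differentiable ℂ f₂) {a₁ b₁ C₁ a₂ b₂ C₂ : ℝ} (ha₁ : 0 < a₁) (hb₁ : 0 < b₁) (ha₂ : 0 < a₂)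
    (hb₂ : 0 < b₂) (hB₁ : TypeBound (1 / A.1) (1 / (1 - A.2)) a₁ b₁ C₁ f₁)
    (hB₂ : TypeBound (1 / A.2) (1 / (1 - A.1)) a₂ b₂ C₂ f₂) :
    (fun z : ℂ × ℂ => f₁ z.1 * f₂ z.2) ∈ spaceS A := by
  have hC₁ := hB₁.const_nonneg
  have hC₂ := hB₂.const_nonneg
  refine mem_spaceS_iff.2 ⟨(h₁.comp differentiable_fst).mul (h₂.comp differentiable_snd),
    a₁, ha₁, a₂, ha₂, b₁, hb₁, b₂, hb₂, C₁ * C₂ + 1, by positivity, fun z => ?_⟩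
  rw [norm_mul]
  calc _ ≤ (C₁ * Real.exp (-(a₁ * |z.1.re| ^ (1 / A.1)) + b₁ * |z.1.im| ^ (1 / (1 - A.2)))) *
        (C₂ * Real.exp (-(a₂ * |z.2.re| ^ (1 / A.2)) + b₂ * |z.2.im| ^ (1 / (1 - A.1)))) :=
        mul_le_mul (hB₁ _) (hB₂ _) (norm_nonneg _) (by positivity)
    _ = C₁ * C₂ * Real.exp (-(a₁ * |z.1.re| ^ (1 / A.1)) - a₂ * |z.2.re| ^ (1 / A.2) +
        b₁ * |z.1.im| ^ (1 / (1 - A.2)) + b₂ * |z.2.im| ^ (1 / (1 - A.1))) := by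
        rw [mul_mul_mul_comm, ← Real.exp_add]
        ring_nf
    _ ≤ _ := by gcongr; linarith

/-! ### Exponential growth excludes temperedness. -/

section Tempered

open SchwartzMap

/-- A tempered distribution grows at most polynomially along the translates of a test function. -/
theorem exists_translate_bound {E : Type*} [NormedAddCommGroup E] [NormedSpace ℝ E]
    (D : SchwartzMap E ℂ →L[ℂ] ℂ) (φ : SchwartzMap E ℂ) :
    ∃ (C : ℝ) (N : ℕ), ∀ v : E, ‖D (SchwartzMap.compSubConstCLM ℂ v φ)‖ ≤ C * (1 + ‖v‖) ^ N := by
  obtain ⟨s, C, -, hC⟩ := Seminorm.bound_of_continuous (schwartz_withSeminorms ℂ E ℂ)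
    ((normSeminorm ℂ ℂ).comp (D : SchwartzMap E ℂ →ₗ[ℂ] ℂ)) (continuous_norm.comp D.continuous)
  have hsem : ∀ m : ℕ × ℕ, ∃ M, 0 ≤ M ∧ ∀ v : E,
      SchwartzMap.seminorm ℂ m.1 m.2 (SchwartzMap.compSubConstCLM ℂ v φ) ≤
        M * (1 + ‖v‖) ^ m.1 := by
    intro m
    refine ⟨2 ^ m.1 * (Finset.Iic m).sup (fun m => SchwartzMap.seminorm ℂ m.1 m.2) φ,
      by positivity, fun v => SchwartzMap.seminorm_le_bound ℂ _ _ _ (by positivity) fun x => ?_⟩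
    have h1 := SchwartzMap.one_add_le_sup_seminorm_apply (𝕜 := ℂ) (m := m) le_rfl le_rfl φ (x - v)
    have h2 : iteratedFDeriv ℝ m.2 (SchwartzMap.compSubConstCLM ℂ v φ) x =
        iteratedFDeriv ℝ m.2 φ (x - v) := iteratedFDeriv_comp_sub m.2 v x
    rw [h2]
    -- Translation commutes with derivatives, so only the polynomial weight moves, and this
    -- inequality moves it at the price of `(1 + ‖v‖) ^ m.1`.
    have h3 : ‖x‖ ≤ (1 + ‖x - v‖) * (1 + ‖v‖) := by
      have h4 : ‖x‖ ≤ ‖x - v‖ + ‖v‖ := norm_le_norm_sub_add _ _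
      nlinarith [norm_nonneg (x - v), norm_nonneg v, mul_nonneg (norm_nonneg (x - v)) (norm_nonneg v)]
    calc ‖x‖ ^ m.1 * ‖iteratedFDeriv ℝ m.2 φ (x - v)‖
        ≤ ((1 + ‖x - v‖) * (1 + ‖v‖)) ^ m.1 * ‖iteratedFDeriv ℝ m.2 φ (x - v)‖ := by gcongr
      _ = (1 + ‖x - v‖) ^ m.1 * ‖iteratedFDeriv ℝ m.2 φ (x - v)‖ * (1 + ‖v‖) ^ m.1 := by
        rw [mul_pow]; ring
      _ ≤ _ := by gcongr
  choose M hM0 hM using hsem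
  refine ⟨C * ∑ m ∈ s, M m, s.sup Prod.fst, fun v => ?_⟩
  have h1 : ‖D (SchwartzMap.compSubConstCLM ℂ v φ)‖ ≤
      C * (s.sup (schwartzSeminormFamily ℂ E ℂ)) (SchwartzMap.compSubConstCLM ℂ v φ) := hC _
  refine h1.trans ?_
  rw [mul_assoc]
  refine mul_le_mul_of_nonneg_left (Seminorm.finset_sup_apply_le ?_ fun m hm => ?_) C.2
  · exact mul_nonneg (Finset.sum_nonneg fun m _ => hM0 m) (by positivity)
  · refine (hM m v).trans ?_
    have h4 : m.1 ≤ s.sup Prod.fst := Finset.le_sup (f := Prod.fst) hm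
    have h5 : 1 ≤ 1 + ‖v‖ := by linarith [norm_nonneg v]
    have h6 : M m ≤ ∑ m ∈ s, M m := Finset.single_le_sum (fun m _ => hM0 m) hm
    have := hM0 m
    have := this.trans h6
    gcongr

theorem not_exp_le_poly {c C : ℝ} (hc : 0 < c) (N : ℕ) :
    ¬ ∀ s : ℝ, 0 ≤ s → c * Real.exp s ≤ C * (1 + s) ^ N := by
  intro h
  have ht : Filter.Tendsto (fun s : ℝ => C * Real.exp 1 * ((1 + s) ^ N * Real.exp (-(1 + s))))
      Filter.atTop (nhds (C * Real.exp 1 * 0)) :=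
    ((Real.tendsto_pow_mul_exp_neg_atTop_nhds_zero N).comp
      (Filter.tendsto_atTop_add_const_left _ 1 Filter.tendsto_id)).const_mul _
  rw [mul_zero] at ht
  refine absurd (ge_of_tendsto ht ?_) (not_le.2 hc)
  filter_upwards [Filter.eventually_ge_atTop 0] with s hs
  have h1 := h s hs
  have e : C * Real.exp 1 * ((1 + s) ^ N * Real.exp (-(1 + s))) =
      C * (1 + s) ^ N * Real.exp (-s) := by
    rw [neg_add, Real.exp_add, Real.exp_neg 1]
    field_simp
  rw [e]
  calc c = c * Real.exp s * Real.exp (-s) := by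
        rw [mul_assoc, ← Real.exp_add]; simp
    _ ≤ _ := by gcongr

/-- A tensor product with an exponentially growing positive factor is not tempered. -/
theorem not_isTempered_of_exp_growth {G : ℝ → ℝ} {b : ℝ → ℂ} (hG : Continuous G) {c : ℝ}
    (hc : 0 < c) (hGc : ∀ y, c * Real.exp |y| ≤ G y) (hb : ContDiff ℝ (⊤ : ℕ∞) b) {x₀ : ℝ}
    (hx₀ : b x₀ ≠ 0) {a : ℝ × ℝ → ℂ} (ha : ∀ p, a p = G p.1 * b p.2) : ¬ IsTempered a := by
  rintro ⟨D, hD⟩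
  obtain ⟨χ, -, hχc, hχs, hχr, hχ1⟩ := exists_contDiff_tsupport_subset (E := ℝ) (x := 0)
    (n := ⊤) Filter.univ_mem
  obtain ⟨η, -, hηc, hηs, hηr, hη1⟩ := exists_contDiff_tsupport_subset (E := ℝ) (x := x₀)
    (n := ⊤) Filter.univ_mem
  have hχ0 : ∀ x, 0 ≤ χ x := fun x => (hχr ⟨x, rfl⟩).1
  have hη0 : ∀ x, 0 ≤ η x := fun x => (hηr ⟨x, rfl⟩).1
  -- The factor `conj b` makes the pairing with `a` a positive number: the integral of `G` against a
  -- translate of `χ`, times `∫ η |b|²`.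
  set Φ : ℝ × ℝ → ℂ := fun p => (χ p.1 : ℂ) * ((η p.2 : ℂ) * (starRingEnd ℂ) (b p.2)) with hΦ
  have hΦs : ContDiff ℝ (⊤ : ℕ∞) Φ := by
    have h1 : ContDiff ℝ (⊤ : ℕ∞) fun x => (χ x : ℂ) := Complex.ofRealCLM.contDiff.comp hχs
    have h2 : ContDiff ℝ (⊤ : ℕ∞) fun x => (η x : ℂ) := Complex.ofRealCLM.contDiff.comp hηs
    have h3 : ContDiff ℝ (⊤ : ℕ∞) fun x => (starRingEnd ℂ) (b x) :=
      Complex.conjCLE.contDiff.comp hb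
    exact (h1.comp contDiff_fst).mul ((h2.comp contDiff_snd).mul (h3.comp contDiff_snd))
  have hΦc : HasCompactSupport Φ := by
    refine HasCompactSupport.intro (hχc.isCompact.prod hηc.isCompact) fun p hp => ?_
    rw [Set.mem_prod, not_and_or] at hp
    rcases hp with hp | hp
    · simp [hΦ, image_eq_zero_of_notMem_tsupport hp]
    · simp [hΦ, image_eq_zero_of_notMem_tsupport hp]
  obtain ⟨φ, hφ⟩ : ∃ φ : SchwartzMap (ℝ × ℝ) ℂ, ∀ p, φ p = Φ p :=
    ⟨hΦc.toSchwartzMap hΦs, fun _ => rfl⟩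
  obtain ⟨C, N, hCN⟩ := exists_translate_bound D φ
  have hbc := hb.continuous
  have hχcont := hχs.continuous
  have hηcont := hηs.continuous
  have hκ : 0 < ∫ x, η x * ‖b x‖ ^ 2 := by
    refine Continuous.integral_pos_of_hasCompactSupport_nonneg_nonzero (x := x₀) (by fun_prop)
      hηc.mul_right (fun x => mul_nonneg (hη0 x) (by positivity)) ?_
    rw [hη1]
    simpa using hx₀
  have hκ' : 0 < ∫ y, Real.exp (-|y|) * χ y := by
    refine Continuous.integral_pos_of_hasCompactSupport_nonneg_nonzero (x := 0) (by fun_prop)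
      hχc.mul_left (fun x => mul_nonneg (Real.exp_pos _).le (hχ0 x)) ?_
    rw [hχ1]
    simp
  set κ := ∫ x, η x * ‖b x‖ ^ 2
  set κ' := ∫ y, Real.exp (-|y|) * χ y
  refine not_exp_le_poly (c := c * κ' * κ) (C := C) (by positivity) N fun s hs => ?_
  have hval : D (SchwartzMap.compSubConstCLM ℂ ((s, 0) : ℝ × ℝ) φ) =
      (((∫ y, G y * χ (y - s)) * κ : ℝ) : ℂ) := by
    have hτ : ∀ p, SchwartzMap.compSubConstCLM ℂ ((s, 0) : ℝ × ℝ) φ p = Φ (p - (s, 0)) :=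
      fun p => by rw [SchwartzMap.compSubConstCLM_apply, hφ]
    have hτc : HasCompactSupport (SchwartzMap.compSubConstCLM ℂ ((s, 0) : ℝ × ℝ) φ) := by
      rw [funext hτ]
      exact hΦc.comp_homeomorph (Homeomorph.subRight ((s, 0) : ℝ × ℝ))
    rw [hD _ hτc]
    have e : ∀ p : ℝ × ℝ, a p * (SchwartzMap.compSubConstCLM ℂ ((s, 0) : ℝ × ℝ) φ) p =
        ((G p.1 * χ (p.1 - s) : ℝ) : ℂ) * ((η p.2 * ‖b p.2‖ ^ 2 : ℝ) : ℂ) := by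
      intro p
      rw [ha, hτ]
      simp only [hΦ, Prod.fst_sub, Prod.snd_sub, sub_zero]
      have := Complex.mul_conj (b p.2)
      rw [Complex.normSq_eq_norm_sq] at this
      push_cast at this ⊢
      linear_combination (G p.1 * χ (p.1 - s) * η p.2 : ℂ) * this
    simp only [e]
    rw [Measure.volume_eq_prod, integral_prod_mul (fun y : ℝ => ((G y * χ (y - s) : ℝ) : ℂ))
      (fun x : ℝ => ((η x * ‖b x‖ ^ 2 : ℝ) : ℂ)), integral_complex_ofReal,
      integral_complex_ofReal, Complex.ofReal_mul]
  have hlow : c * κ' * Real.exp s ≤ ∫ y, G y * χ (y - s) := by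
    rw [← integral_add_right_eq_self _ s]
    simp only [add_sub_cancel_right]
    rw [mul_right_comm, ← integral_const_mul]
    refine integral_mono ?_ ?_ fun y => ?_
    · exact (Continuous.integrable_of_hasCompactSupport (by fun_prop) hχc.mul_left).const_mul _
    · exact Continuous.integrable_of_hasCompactSupport (by fun_prop) hχc.mul_left
    · have h1 := hGc (y + s)
      -- Translating by `s` thus costs at most `exp(-|y|)`, whose integral against `χ` is the
      -- constant `κ'`.
      have h2 : Real.exp s * Real.exp (-|y|) ≤ Real.exp |y + s| := by
        rw [← Real.exp_add]
        refine Real.exp_le_exp.2 ?_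
        have := le_abs_self (y + s)
        have := neg_abs_le y
        linarith
      have h3 := mul_le_mul_of_nonneg_left h2 hc.le
      have h4 := mul_le_mul_of_nonneg_right (h3.trans h1) (hχ0 y)
      refine le_trans (le_of_eq ?_) h4
      ring
  have hfin := hCN (s, 0)
  rw [hval, Complex.norm_real] at hfin
  have hnorm : ‖((s, 0) : ℝ × ℝ)‖ = s := by
    rw [Prod.norm_mk, norm_zero, Real.norm_eq_abs, abs_of_nonneg hs, max_eq_left hs]
  rw [hnorm] at hfin
  calc c * κ' * κ * Real.exp s = c * κ' * Real.exp s * κ := by ring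
    _ ≤ (∫ y, G y * χ (y - s)) * κ := by gcongr
    _ ≤ _ := (le_abs_self _).trans hfin

end Tempered

/-! ### Linearity of `τ`, transport of the product, and the non-tempered element. -/

theorem laplace_const_mul (r : ℂ) (u : ℝ → ℂ) (z : ℂ) :
    laplace (fun x => r * u x) z = r * laplace u z := by
  rw [laplace, laplace, ← integral_const_mul]
  congr with x
  ring

theorem laplaceInv_const_mul (c : ℝ) (r : ℂ) (H : ℂ → ℂ) (x : ℝ) :
    laplaceInv c (fun w => r * H w) x = r * laplaceInv c H x := by
  have h : ∀ t : ℝ, Complex.exp ((c + t * Complex.I) * x) * (r * H (c + t * Complex.I)) =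
      r * (Complex.exp ((c + t * Complex.I) * x) * H (c + t * Complex.I)) :=
    fun t => mul_left_comm _ _ _
  simp only [laplaceInv, h, integral_const_mul]
  exact mul_left_comm _ _ _

theorem tau_smul (q : ℝ) (k : Fin 2) (c r : ℝ) (ψ : ℝ × ℝ → ℂ) :
    tau q k c (r • ψ) = r • tau q k c ψ := by
  funext p
  simp only [tau, Pi.smul_apply, Complex.real_smul, laplace_const_mul, laplaceInv_const_mul]

section

variable {A : ℝ × ℝ} {q : ℝ} {k : Fin 2} {Γ : Set ℝ} {f g : ℂ × ℂ → ℂ}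

theorem tau_hat_add (hA₁ : A.1 ∈ Set.Ioo (0 : ℝ) 1) (hA₂ : A.2 ∈ Set.Ioo (0 : ℝ) 1)
    (hq : q ≠ 0) (hΓ : IsLaplaceInterval q k Γ) {c : ℝ} (hc : c ∈ Γ) (hf : f ∈ spaceS A)
    (hg : g ∈ spaceS A) :
    tau q k c (hat f + hat g) = tau q k c (hat f) + tau q k c (hat g) := by
  have hL : ∀ (y : ℝ) (z : ℂ), laplace (fun x => (hat f + hat g) (y, x)) z =
      laplace (fun x => hat f (y, x)) z + laplace (fun x => hat g (y, x)) z := by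
    intro y z
    refine Eq.trans ?_ (integral_add (integrable_laplace_section hA₁ hA₂ hf (Complex.I * y) z)
      (integrable_laplace_section hA₁ hA₂ hg (Complex.I * y) z))
    simp only [laplace, Pi.add_apply, mul_add, hat]
  funext p
  have hi := (verticalDecay_tauKernel hA₁ hA₂ hq hΓ hf (Complex.I * p.1)).integrable_exp_mul hc p.2
  have hi' :=
    (verticalDecay_tauKernel hA₁ hA₂ hq hΓ hg (Complex.I * p.1)).integrable_exp_mul hc p.2
  rw [Pi.add_apply, tau_hat_apply, tau_hat_apply, laplaceInv, laplaceInv, ← mul_add,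
    ← integral_add hi hi']
  simp only [tau, laplaceInv, hL, mul_add]
  rfl

theorem zero_mem_spaceS : (0 : ℂ × ℂ → ℂ) ∈ spaceS A :=
  ⟨differentiable_const 0, 1, one_pos, 1, one_pos, 1, one_pos, 1, one_pos, 1, one_pos, fun z => by
    rw [Pi.zero_apply, norm_zero]; positivity⟩

/-- The space `S_A` as a real vector space. -/
def spaceSSubmodule (A : ℝ × ℝ) : Submodule ℝ (ℂ × ℂ → ℂ) where
  carrier := spaceS A
  add_mem' := add_mem_spaceS
  zero_mem' := zero_mem_spaceS
  smul_mem' r _ hf := const_mul_mem_spaceS hf (r : ℂ)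

/-- Elements of `S_A` extending Weyl products are chosen; since restriction to the real plane is
injective, the choice is forced and inherits bilinearity. -/
theorem exists_weyl_linearMap (hA₁ : A.1 ∈ Set.Ioo (0 : ℝ) 1) (hA₂ : A.2 ∈ Set.Ioo (0 : ℝ) 1)
    (q : ℝ) : ∃ W : spaceSSubmodule A →ₗ[ℝ] spaceSSubmodule A →ₗ[ℝ] spaceSSubmodule A,
      ∀ f g, realRestrict (W f g : ℂ × ℂ → ℂ) =
        weyl q (realRestrict (f : ℂ × ℂ → ℂ)) (realRestrict (g : ℂ × ℂ → ℂ)) := by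
  have hadm : ∀ f : spaceSSubmodule A, WeylAdmissible (realRestrict (f : ℂ × ℂ → ℂ)) :=
    fun f => weylAdmissible_realRestrict hA₁ hA₂ f.2
  have hex : ∀ f g : spaceSSubmodule A, ∃ h : spaceSSubmodule A, realRestrict (h : ℂ × ℂ → ℂ) =
      weyl q (realRestrict (f : ℂ × ℂ → ℂ)) (realRestrict (g : ℂ × ℂ → ℂ)) := fun f g => by
    obtain ⟨h, hh, e⟩ := weyl_mem_spaceS hA₁ hA₂ q f.2 g.2
    exact ⟨⟨h, hh⟩, e⟩
  choose W hW using hex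
  have hinj : ∀ {h h' : spaceSSubmodule A},
      realRestrict (h : ℂ × ℂ → ℂ) = realRestrict (h' : ℂ × ℂ → ℂ) → h = h' :=
    fun {h h'} e => Subtype.ext (realRestrict_injOn h.2 h'.2 e)
  refine ⟨LinearMap.mk₂ ℝ W (fun f f' g => hinj ?_) (fun r f g => hinj ?_)
    (fun f g g' => hinj ?_) (fun r f g => hinj ?_), hW⟩
  · rw [hW]
    change weyl q (realRestrict (f : ℂ × ℂ → ℂ) + realRestrict (f' : ℂ × ℂ → ℂ)) _ =
      realRestrict (W f g : ℂ × ℂ → ℂ) + realRestrict (W f' g : ℂ × ℂ → ℂ)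
    rw [(hadm f).weyl_add_left (hadm f') (hadm g), hW, hW]
  · rw [hW]
    change weyl q ((r : ℂ) • realRestrict (f : ℂ × ℂ → ℂ)) _ =
      (r : ℂ) • realRestrict (W f g : ℂ × ℂ → ℂ)
    rw [weyl_smul_left, hW]
  · rw [hW]
    change weyl q _ (realRestrict (g : ℂ × ℂ → ℂ) + realRestrict (g' : ℂ × ℂ → ℂ)) =
      realRestrict (W f g : ℂ × ℂ → ℂ) + realRestrict (W f g' : ℂ × ℂ → ℂ)
    rw [(hadm f).weyl_add_right (hadm g) (hadm g'), hW, hW]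
  · rw [hW]
    change weyl q _ ((r : ℂ) • realRestrict (g : ℂ × ℂ → ℂ)) =
      (r : ℂ) • realRestrict (W f g : ℂ × ℂ → ℂ)
    rw [weyl_smul_right, hW]

/-- Injectivity of `hat` and `realRestrict` on `S_A` turns the chosen preimages in `hatWeyl` into
the actual functions. -/
theorem hatWeyl_hat (hf : f ∈ spaceS A) (hg : g ∈ spaceS A) {h : ℂ × ℂ → ℂ} (hh : h ∈ spaceS A)
    (e : realRestrict h = weyl q (realRestrict f) (realRestrict g)) :
    hatWeyl A q (hat f) (hat g) = hat h := by
  rw [hatWeyl, hat_injOn.leftInvOn_invFunOn hf, hat_injOn.leftInvOn_invFunOn hg, ← e,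
    realRestrict_injOn.leftInvOn_invFunOn hh]

theorem tau_injOn (hA₁ : A.1 ∈ Set.Ioo (0 : ℝ) 1) (hA₂ : A.2 ∈ Set.Ioo (0 : ℝ) 1)
    (hq : q ≠ 0) (hΓ : IsLaplaceInterval q k Γ) {c : ℝ} (hc : c ∈ Γ) :
    Set.InjOn (tau q k c) (hatS A) := by
  rintro _ ⟨f, hf, rfl⟩ _ ⟨g, hg, rfl⟩ h
  exact hat_eq_of_tau_eq hA₁ hA₂ hq hΓ hc hf hg h

/-- Transport of structure along the linear isomorphism `f ↦ τ(f̂)` from `S_A` onto its range. -/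
theorem exists_twistedProduct_linearMap (hA₁ : A.1 ∈ Set.Ioo (0 : ℝ) 1)
    (hA₂ : A.2 ∈ Set.Ioo (0 : ℝ) 1) (hq : q ≠ 0) (hΓ : IsLaplaceInterval q k Γ) {c : ℝ}
    (hc : c ∈ Γ) : ∃ (V : Submodule ℝ (ℝ × ℝ → ℂ)) (m : V →ₗ[ℝ] V →ₗ[ℝ] V),
      (V : Set (ℝ × ℝ → ℂ)) = hatE A q k c ∧
      (∀ a b : V, (m a b : ℝ × ℝ → ℂ) = twistedProduct A q k c a b) ∧
      (∀ a b d : V, m (m a b) d = m a (m b d)) := by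
  obtain ⟨W, hW⟩ := exists_weyl_linearMap hA₁ hA₂ q
  let T : spaceSSubmodule A →ₗ[ℝ] (ℝ × ℝ → ℂ) :=
    { toFun := fun f => tau q k c (hat f)
      map_add' := fun f g => tau_hat_add hA₁ hA₂ hq hΓ hc f.2 g.2
      map_smul' := fun r f => tau_smul q k c r (hat f) }
  have hT : Function.Injective T := fun f g h => Subtype.ext
    (hat_injOn f.2 g.2 (hat_eq_of_tau_eq hA₁ hA₂ hq hΓ hc f.2 g.2 h))
  let e := LinearEquiv.ofInjective T hT
  have hassoc : ∀ f g h, W (W f g) h = W f (W g h) := fun f g h => by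
    refine Subtype.ext (realRestrict_injOn (W _ h).2 (W f _).2 ?_)
    have hadm : ∀ f : spaceSSubmodule A, WeylAdmissible (realRestrict (f : ℂ × ℂ → ℂ)) :=
      fun f => weylAdmissible_realRestrict hA₁ hA₂ f.2
    rw [hW, hW, hW, hW]
    exact (hadm f).weyl_assoc (hadm g) (hadm h) (by rw [← hW]; exact hadm _)
      (by rw [← hW]; exact hadm _)
  refine ⟨LinearMap.range T, (W.compl₁₂ e.symm.toLinearMap e.symm.toLinearMap).compr₂
    e.toLinearMap, ?_, fun a b => ?_, fun a b d => ?_⟩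
  · ext a
    constructor
    · rintro ⟨f, rfl⟩
      exact ⟨_, ⟨f, f.2, rfl⟩, rfl⟩
    · rintro ⟨_, ⟨f, hf, rfl⟩, rfl⟩
      exact ⟨⟨f, hf⟩, rfl⟩
  · obtain ⟨f, rfl⟩ := e.surjective a
    obtain ⟨g, rfl⟩ := e.surjective b
    have hinv : ∀ f : spaceSSubmodule A, tauInv A q k c (tau q k c (hat f)) = hat f := fun f =>
      (tau_injOn hA₁ hA₂ hq hΓ hc).leftInvOn_invFunOn ⟨f, f.2, rfl⟩
    change ((e (W (e.symm (e f)) (e.symm (e g))) : LinearMap.range T) : ℝ × ℝ → ℂ) =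
      tau q k c (hatWeyl A q (tauInv A q k c (tau q k c (hat f)))
        (tauInv A q k c (tau q k c (hat g))))
    rw [hinv, hinv, e.symm_apply_apply, e.symm_apply_apply,
      hatWeyl_hat f.2 g.2 (W f g).2 (hW f g)]
    rfl
  · simp only [LinearMap.compr₂_apply, LinearMap.compl₁₂_apply, LinearEquiv.coe_coe,
      LinearEquiv.symm_apply_apply, hassoc]

theorem exists_not_isTempered (hA₁ : A.1 ∈ Set.Ioo (0 : ℝ) 1) (hA₂ : A.2 ∈ Set.Ioo (0 : ℝ) 1)
    (hA : 1 ≤ A.1 + A.2) (hq : q ≠ 0) (hΓ : IsLaplaceInterval q k Γ) {c : ℝ} (hc : c ∈ Γ) :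
    ∃ a ∈ hatE A q k c, HasExponentialGrowth a ∧ ¬ IsTempered a := by
  have hA₁' : 0 < A.1 := hA₁.1
  have hA₂' : 0 < A.2 := hA₂.1
  have hA₁'' : A.1 < 1 := hA₁.2
  have hA₂'' : A.2 < 1 := hA₂.2
  obtain ⟨f₁, hd₁, ⟨a₁, ha₁, b₁, hb₁, C₁, hB₁⟩, G, hG, r, hr, hGr⟩ :=
    exists_typeBound_exp_growth (one_lt_one_div hA₁' hA₁'')
  obtain ⟨f₂, hd₂, hf₂0, a₂, ha₂, b₂, hb₂, C₂, hB₂⟩ :=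
    exists_typeBound_ne_zero (one_lt_one_div hA₂' hA₂'')
  have hf : (fun z : ℂ × ℂ => f₁ z.1 * f₂ z.2) ∈ spaceS A :=
    mul_mem_spaceS hd₁ hd₂ ha₁ hb₁ ha₂ hb₂
      (hB₁.mono_growth hb₁ (by positivity) (one_div_le_one_div_of_le (by linarith) (by linarith)))
      (hB₂.mono_growth hb₂ (by positivity) (one_div_le_one_div_of_le (by linarith) (by linarith)))
  set f : ℂ × ℂ → ℂ := fun z => f₁ z.1 * f₂ z.2
  set b : ℝ → ℂ := laplaceInv c fun w => laplace (fun x => f₂ x) (twistMapInv q k w)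
  -- `τ` acts on the second variable only, so the tensor product is preserved and the growth of `f₁`
  -- along the imaginary axis survives.
  have ha : ∀ p, tau q k c (hat f) p = G p.1 * b p.2 := by
    intro p
    simp only [tau, hat, f, hG, laplace_const_mul, laplaceInv_const_mul, b]
  have hGpos : ∀ y, 0 < G y := fun y => (by positivity : 0 < r * Real.exp |y|).trans_le (hGr y)
  have hGc : Continuous G := by
    have : G = fun y : ℝ => (f₁ (Complex.I * y)).re := by
      funext y
      rw [hG, Complex.ofReal_re]
    have hc₁ := hd₁.continuous
    rw [this]
    fun_prop
  -- `b` is a slice of the smooth function `τ(f̂)`, divided by `G 0 > 0`.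
  have hb : ContDiff ℝ (⊤ : ℕ∞) b := by
    have h1 : b = fun x => (G 0 : ℂ)⁻¹ * tau q k c (hat f) (0, x) := by
      funext x
      rw [ha, inv_mul_cancel_left₀ (Complex.ofReal_ne_zero.2 (hGpos 0).ne')]
    rw [h1]
    exact contDiff_const.mul ((contDiff_tau_hat hA₁ hA₂ hq hΓ hc hf).comp
      (contDiff_const.prodMk contDiff_id))
  -- If `b` vanished, `τ(f̂)` would be zero, and injectivity of `τ` would give `f₂ = 0` on the real
  -- line.
  have hb0 : ∃ x, b x ≠ 0 := by
    by_contra! h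
    have h1 : tau q k c (hat f) = tau q k c (hat 0) := by
      funext p
      rw [ha, h]
      simp [tau, hat, laplace, laplaceInv]
    have h2 := hat_eq_of_tau_eq hA₁ hA₂ hq hΓ hc hf zero_mem_spaceS h1
    refine hf₂0 (differentiable_eq_of_forall_ofReal hd₂ (differentiable_const 0) fun x => ?_)
    have h3 : f₁ (Complex.I * (0 : ℝ)) * f₂ x = 0 := congrFun h2 (0, x)
    rw [hG] at h3
    exact (mul_eq_zero.1 h3).resolve_left (Complex.ofReal_ne_zero.2 (hGpos 0).ne')
  obtain ⟨x₀, hx₀⟩ := hb0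
  refine ⟨_, ⟨_, ⟨f, hf, rfl⟩, rfl⟩, ⟨x₀, r * ‖b x₀‖, by positivity, 1, one_pos, fun y => ?_⟩,
    not_isTempered_of_exp_growth hGc hr hGr hb hx₀ ha⟩
  rw [ha, norm_mul, Complex.norm_real, Real.norm_of_nonneg (hGpos y).le, one_mul, mul_right_comm]
  exact mul_le_mul_of_nonneg_right (hGr y) (norm_nonneg _)

end

end TwistedWeyl

theorem mainTheorem2 (A : ℝ × ℝ) (hA₁ : A.1 ∈ Set.Ioo (0 : ℝ) 1) (hA₂ : A.2 ∈ Set.Ioo (0 : ℝ) 1)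
    (hA : 1 ≤ A.1 + A.2) (q : ℝ) (hq : q ≠ 0) (k : Fin 2)
    (Γ : Set ℝ) (hΓ : TwistedWeyl.IsLaplaceInterval q k Γ) (c : ℝ) (hc : c ∈ Γ) :
    -- the hat map is an injection, and the Weyl product is well defined on `S_A`
    Set.InjOn TwistedWeyl.hat (TwistedWeyl.spaceS A) ∧
    Set.InjOn TwistedWeyl.realRestrict (TwistedWeyl.spaceS A) ∧
    (∀ f ∈ TwistedWeyl.spaceS A, ∀ g ∈ TwistedWeyl.spaceS A,
      MeasureTheory.Integrable (TwistedWeyl.realRestrict f) ∧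
      MeasureTheory.Integrable (TwistedWeyl.symplFourier (TwistedWeyl.realRestrict f)) ∧
      MeasureTheory.Integrable (TwistedWeyl.twistedConv q
        (TwistedWeyl.symplFourier (TwistedWeyl.realRestrict f))
        (TwistedWeyl.symplFourier (TwistedWeyl.realRestrict g))) ∧
      TwistedWeyl.weyl q (TwistedWeyl.realRestrict f) (TwistedWeyl.realRestrict g) ∈
        TwistedWeyl.realRestrict '' TwistedWeyl.spaceS A) ∧
    -- `τ` is well defined by convergent integrals, independent of the vertical line
    (∀ ψ ∈ TwistedWeyl.hatS A, ∀ y₁ : ℝ,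
      (∀ z : ℂ, MeasureTheory.Integrable (fun x : ℝ => Complex.exp (-z * x) * ψ (y₁, x))) ∧
      (∀ x₂ : ℝ, MeasureTheory.Integrable (fun t : ℝ =>
        Complex.exp ((c + t * Complex.I) * x₂) *
          TwistedWeyl.laplace (fun x => ψ (y₁, x))
            (TwistedWeyl.twistMapInv q k (c + t * Complex.I))))) ∧
    (∀ ψ ∈ TwistedWeyl.hatS A, ∀ c' ∈ Γ, TwistedWeyl.tau q k c' ψ = TwistedWeyl.tau q k c ψ) ∧
    -- `τ` is injective, with smooth values, and its inverse is `T = id ⊗ (L⁻¹ ∘ φ^* ∘ L)`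
    Set.InjOn (TwistedWeyl.tau q k c) (TwistedWeyl.hatS A) ∧
    (∀ a ∈ TwistedWeyl.hatE A q k c, ContDiff ℝ (⊤ : ℕ∞) a) ∧
    (∀ a ∈ TwistedWeyl.hatE A q k c, ∀ y₁ : ℝ, ∀ z ∈ TwistedWeyl.strip q,
      (TwistedWeyl.twistMap q k z).re ∈ Γ →
        MeasureTheory.Integrable
          (fun x : ℝ => Complex.exp (-TwistedWeyl.twistMap q k z * x) * a (y₁, x)) ∧
        TwistedWeyl.laplace (fun x => TwistedWeyl.tauInv A q k c a (y₁, x)) z =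
          TwistedWeyl.laplace (fun x => a (y₁, x)) (TwistedWeyl.twistMap q k z)) ∧
    -- the product is an associative `ℝ`-algebra structure
    (∃ (V : Submodule ℝ (ℝ × ℝ → ℂ)) (m : V →ₗ[ℝ] V →ₗ[ℝ] V),
      (V : Set (ℝ × ℝ → ℂ)) = TwistedWeyl.hatE A q k c ∧
      (∀ a b : V, (m a b : ℝ × ℝ → ℂ) = TwistedWeyl.twistedProduct A q k c a b) ∧
      (∀ a b d : V, m (m a b) d = m a (m b d))) ∧
    -- there are non-tempered elements of exponential growth
    (∃ a ∈ TwistedWeyl.hatE A q k c,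
      TwistedWeyl.HasExponentialGrowth a ∧ ¬ TwistedWeyl.IsTempered a) := by
  refine ⟨TwistedWeyl.hat_injOn, TwistedWeyl.realRestrict_injOn, fun f hf g hg => ?_, ?_, ?_,
    TwistedWeyl.tau_injOn hA₁ hA₂ hq hΓ hc, ?_, ?_,
    TwistedWeyl.exists_twistedProduct_linearMap hA₁ hA₂ hq hΓ hc,
    TwistedWeyl.exists_not_isTempered hA₁ hA₂ hA hq hΓ hc⟩
  · have hf' := TwistedWeyl.weylAdmissible_realRestrict hA₁ hA₂ hf
    have hg' := TwistedWeyl.weylAdmissible_realRestrict hA₁ hA₂ hg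
    exact ⟨hf'.integrable, hf'.integrable_fourier,
      TwistedWeyl.integrable_twistedConv hf'.integrable_fourier hg'.integrable_fourier,
      TwistedWeyl.weyl_mem_spaceS hA₁ hA₂ q hf hg⟩
  · rintro _ ⟨f, hf, rfl⟩ y₁
    exact ⟨fun z => TwistedWeyl.integrable_laplace_section hA₁ hA₂ hf (Complex.I * y₁) z,
      fun x₂ => (TwistedWeyl.verticalDecay_tauKernel hA₁ hA₂ hq hΓ hf
        (Complex.I * y₁)).integrable_exp_mul hc x₂⟩
  · rintro _ ⟨f, hf, rfl⟩ c' hc'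
    exact TwistedWeyl.tau_hat_eq_of_mem hA₁ hA₂ hq hΓ hc hc' hf
  · rintro _ ⟨_, ⟨f, hf, rfl⟩, rfl⟩
    exact TwistedWeyl.contDiff_tau_hat hA₁ hA₂ hq hΓ hc hf
  · rintro _ ⟨_, ⟨f, hf, rfl⟩, rfl⟩ y₁ z hz hzΓ
    have hinv : TwistedWeyl.tauInv A q k c (TwistedWeyl.tau q k c (TwistedWeyl.hat f)) =
        TwistedWeyl.hat f :=
      (TwistedWeyl.tau_injOn hA₁ hA₂ hq hΓ hc).leftInvOn_invFunOn ⟨f, hf, rfl⟩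
    rw [hinv]
    exact TwistedWeyl.laplace_tau_hat hA₁ hA₂ hq hΓ hc hf y₁ hz hzΓ
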